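/- Let $H$ be a complex Hilbert space (for instance $H=L^2(\Lambda)$, $\Lambda\subset\mathbb R^d$ open and bounded), $T>0$, and let $D\subset H$ be a linear subspace. Let $A(t):D\subset H\to H$, $0\le t\le T$, be linear operators with the common domain $D$ such that: (i) there are $c>0$ and $\theta\in(\frac{\pi}{2},\pi)$ such that for all $t\in[0,T]$ and all $\lambda\in S_\theta=\{\rho e^{i\phi}:\rho>0,\ |\phi|\le\theta\}$ the resolvent exists and $\|(\lambda I-A(t))^{-1}\|_{L(H)}\le c/|\lambda|$; moreover $-A(t)$ is invertible with bounded inverse; (ii) for some $K_1>0$ and all $s,t\in[0,T]$, $\|(A(t)-A(s))(-A(0))^{-1}\|_{L(H)}\le K_1|t-s|$ and $\|(-A(0))^{-1}(A(t)-A(s))\|_{L(D,H)}\le K_1|t-s|$, where $D$ carries the graph norm of $A(0)$; (iii) for all $\alpha\in[0,1]$ and $t\in[0,T]$, $\mathcal D((-A(t))^\alpha)=\mathcal D((-A(0))^\alpha)$, and $K_2^{-1}\|(-A(0))^\alpha u\|\le\|(-A(t))^\alpha u\|\le K_2\|(-A(0))^\alpha u\|$ on this space, with $K_2>0$ independent of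 $t$ and $u$; (iv) $t\mapsto A(t)$ is twice differentiable on $[0,T]$, and for all $\alpha_1,\alpha_2\in[0,1]$ with $\alpha_1+\alpha_2=1$ there is $C_0>0$ such that for all $s,t\in[0,T]$, in the operator norm from $\mathcal D((-A(0))^{1-\alpha_2})$ (with its graph norm) to $H$, $\|(-A(s))^{-\alpha_1}A''(t)(-A(s))^{-\alpha_2}\|\le C_0$ and $\|(-A(0))^{-\alpha_1}(A(t)-A(s))(-A(0))^{-\alpha_2}\|\le C_0|t-s|$. Here $(-A(t))^{-\alpha}=\frac{\sin\pi\alpha}{\pi}\int_0^\infty r^{-\alpha}(rI-A(t))^{-1}dr$ for $0<\alpha<1$, $(-A(t))^{0}=I$, and $(-A(t))^{\alpha}=((-A(t))^{-\alpha})^{-1}$ with domain the range of $(-A(t))^{-\alpha}$. Let $F:[0,T]\times H\to H$ be twice differentiable with respect to each of its variables (in the real sense with respect to $u$), and suppose that there are $K_3,K_4\ge0$ with $$\Big\|\frac{\partial^2F}{\partial t\partial u}(t,u)\Big\|\le K_3,\quad \Big\|\frac{\partial^kF}{\partial t^k}(t,u)\Big\|\le K_3(1+\|u\|),\quad \Big\|\frac{\partial^kF}{\partial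 u^k}(t,u)\Big\|\le K_3\quad(k=1,2),$$ $$\|F(t,u)-F(s,v)\|\le K_4(|t-s|+\|u-v\|)$$ for all $s,t\in[0,T]$, $u,v\in H$, and that $-\operatorname{Re}\langle\frac{\partial F}{\partial u}(t,u)v,v\rangle\ge\kappa\|v\|^2$ for all $t\in[0,T]$, $u,v\in H$, for some $\kappa>-b_0$, where $b_0=\inf\{\operatorname{Re}\lambda:\lambda\in\sigma(-A(t)),\ 0\le t\le T\}$. Then there is a unique evolution system $U(t,s)\in L(H)$, $0\le s\le t\le T$, of the family $A(t)$, that is, a family such that $U(s,s)=I$, $U(t,r)U(r,s)=U(t,s)$ for $s\le r\le t$, $(t,s)\mapsto U(t,s)v$ is continuous for every $v\in H$, and, for some $K_0>0$: - $\|U(t,s)\|_{L(H)}\le K_0$ for $0\le s\le t\le T$; - $U(t,s)H\subset D$ for $s<t$, $U(\cdot,s)\in C^1((s,T];L(H))$ with $\frac{\partial U}{\partial t}(t,s)=A(t)U(t,s)$, and $\|A(t)U(t,s)\|_{L(H)}\le\frac{K_0}{t-s}$ for $0\le s<t\le T$; - for $v\in D$ and $0<t\le T$, $U(t,\cdot)v\in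 C^1([0,t);H)$ with $\frac{\partial U}{\partial s}(t,s)v=-U(t,s)A(s)v$ for $0\le s\le t$ (one-sided derivatives at the end points); moreover $U(t,s)D\subset D$ and $\|A(t)U(t,s)A(s)^{-1}\|_{L(H)}\le K_0$ for $0\le s\le t\le T$. For every $\beta\in[0,2]$ and every $u_0\in\mathcal D((-A(0))^{\beta/2})$, the problem $u'(t)=A(t)u(t)+F(t,u(t))$, $t\in(0,T]$, $u(0)=u_0$, has a unique mild solution, i.e. there is a unique $u\in C([0,T];H)$ with $u(0)=u_0$ and $$u(t)=U(t,0)u_0+\int_0^tU(t,s)F(s,u(s))\,ds,\qquad t\in(0,T].$$ Moreover, for every $\beta\in[0,2)$ there is a constant $C$, independent of $u_0$ and $t$, such that for every $u_0\in\mathcal D((-A(0))^{\beta/2})$ the mild solution satisfies $u(t)\in\mathcal D((-A(0))^{\beta/2})$ and $$\|(-A(0))^{\beta/2}u(t)\|\le C\big(1+\|(-A(0))^{\beta/2}u_0\|\big),\qquad t\in[0,T].$$ -/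

import Mathlib

open Set MeasureTheory

noncomputable section

variable {H : Type*} [NormedAddCommGroup H] [InnerProductSpace ℂ H] [CompleteSpace H]
variable {D : Submodule ℂ H}

/-- `R` is the (bounded, everywhere defined) resolvent `(z I - L)⁻¹` of the possibly unbounded
operator `L` with domain `D ⊆ H`. -/
def IsResolventOf (L : D →ₗ[ℂ] H) (z : ℂ) (R : H →L[ℂ] H) : Prop :=
  (∀ y : H, ∃ h : R y ∈ D, z • R y - L ⟨R y, h⟩ = y) ∧
    ∀ x : D, R (z • (x : H) - L x) = x

/-- The spectrum of the operator `L` with domain `D`. -/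
def pspectrum (L : D →ₗ[ℂ] H) : Set ℂ :=
  {z | ¬ ∃ R : H →L[ℂ] H, IsResolventOf L z R}

open Classical in
/-- The resolvent `(z I - L)⁻¹`, with the value `0` if `z` lies in the spectrum of `L`. -/
def presolvent (L : D →ₗ[ℂ] H) (z : ℂ) : H →L[ℂ] H :=
  if h : ∃ R : H →L[ℂ] H, IsResolventOf L z R then h.choose else 0

/-- The bounded operators `(-L)^(-α)`, `0 ≤ α ≤ 1`, for a sectorial operator `L` with bounded
inverse: `I` for `α = 0`, the inverse of `-L` for `α = 1`, and Balakrishnan's integral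
`(sin (π α) / π) ∫₀^∞ r^(-α) (r I - L)⁻¹ dr` for `0 < α < 1`. -/
def negFracPow (L : D →ₗ[ℂ] H) (α : ℝ) : H →L[ℂ] H :=
  if α = 0 then ContinuousLinearMap.id ℂ H
  else if α = 1 then presolvent L 0
  else (Real.sin (Real.pi * α) / Real.pi) •
    ∫ r in Ioi (0 : ℝ), (r ^ (-α) : ℝ) • presolvent L (r : ℂ)

/-- The fractional power `(-L)^α = ((-L)^(-α))⁻¹`, `0 ≤ α ≤ 1`, an operator whose domain is the
range of `(-L)^(-α)`. -/
def fracPow (L : D →ₗ[ℂ] H) (α : ℝ) : H →ₗ.[ℂ] H :=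
  (((negFracPow L α : H →L[ℂ] H) : H →ₗ[ℂ] H).toPMap ⊤).inverse

/-- The sector `S_θ = {ρ e^{iφ} : ρ > 0, |φ| ≤ θ}`, `0 < θ < π`. -/
def sectorSet (θ : ℝ) : Set ℂ := {z | z ≠ 0 ∧ |z.arg| ≤ θ}

/-- The assumptions on the family `A(t) : D ⊆ H → H`, `0 ≤ t ≤ T`. -/
structure LinearPartAssumption (T : ℝ) (A : ℝ → D →ₗ[ℂ] H) : Prop where
  /-- uniform sectoriality -/
  sectorial : ∃ c > 0, ∃ θ ∈ Ioo (Real.pi / 2) Real.pi, ∀ t ∈ Icc 0 T, ∀ z ∈ sectorSet θ,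
    ∃ R : H →L[ℂ] H, IsResolventOf (A t) z R ∧ ‖R‖ ≤ c / ‖z‖
  /-- `-A(t)` is invertible with bounded inverse -/
  invertible : ∀ t ∈ Icc 0 T, ∃ R : H →L[ℂ] H, IsResolventOf (A t) 0 R
  /-- `‖(A(t) - A(s)) (-A(0))⁻¹‖ ≤ K₁ |t - s|` in `L(H)`; here `x = (-A(0))⁻¹ v` -/
  lipschitz_right : ∃ K₁ > 0, ∀ s ∈ Icc 0 T, ∀ t ∈ Icc 0 T, ∀ x : D,
    ‖(A t - A s) x‖ ≤ K₁ * |t - s| * ‖A 0 x‖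
  /-- `‖(-A(0))⁻¹ (A(t) - A(s))‖ ≤ K₁ |t - s|` in `L(D, H)`, `D` with the graph norm of `A(0)` -/
  lipschitz_left : ∃ K₁ > 0, ∀ s ∈ Icc 0 T, ∀ t ∈ Icc 0 T, ∀ x : D,
    ‖negFracPow (A 0) 1 ((A t - A s) x)‖ ≤ K₁ * |t - s| * (‖x‖ + ‖A 0 x‖)
  /-- the domains of the fractional powers do not depend on `t` -/
  domain_eq : ∀ α ∈ Icc (0 : ℝ) 1, ∀ t ∈ Icc 0 T,
    (fracPow (A t) α).domain = (fracPow (A 0) α).domain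
  /-- the norms of the fractional powers are equivalent, uniformly in `t` -/
  norm_equiv : ∀ α ∈ Icc (0 : ℝ) 1, ∃ K₂ > 0, ∀ t ∈ Icc 0 T, ∀ (u : H)
    (h₀ : u ∈ (fracPow (A 0) α).domain) (h : u ∈ (fracPow (A t) α).domain),
    K₂⁻¹ * ‖fracPow (A 0) α ⟨u, h₀⟩‖ ≤ ‖fracPow (A t) α ⟨u, h⟩‖ ∧
      ‖fracPow (A t) α ⟨u, h⟩‖ ≤ K₂ * ‖fracPow (A 0) α ⟨u, h₀⟩‖
  /-- `t ↦ A(t)` is twice differentiable, with `A''` bounded in the sense of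
  `‖(-A(s))^(-α₁) A''(t) (-A(s))^(-α₂)‖ ≤ C₀` in `L(𝒟((-A(0))^(1-α₂)), H)` -/
  twice_differentiable : ∃ A₁ A₂ : ℝ → D →ₗ[ℂ] H,
    (∀ x : D, ∀ t ∈ Icc 0 T,
      HasDerivWithinAt (fun r => A r x) (A₁ t x) (Icc 0 T) t ∧
      HasDerivWithinAt (fun r => A₁ r x) (A₂ t x) (Icc 0 T) t) ∧
    ∀ α₁ ∈ Icc (0 : ℝ) 1, ∀ α₂ ∈ Icc (0 : ℝ) 1, α₁ + α₂ = 1 → ∃ C₀ > 0,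
      ∀ s ∈ Icc 0 T, ∀ t ∈ Icc 0 T, ∀ (v : (fracPow (A 0) (1 - α₂)).domain)
        (h : negFracPow (A s) α₂ v ∈ D),
        ‖negFracPow (A s) α₁ (A₂ t ⟨negFracPow (A s) α₂ v, h⟩)‖
          ≤ C₀ * (‖v‖ + ‖fracPow (A 0) (1 - α₂) v‖)
  /-- `‖(-A(0))^(-α₁) (A(t) - A(s)) (-A(0))^(-α₂)‖ ≤ C₀ |t - s|` in
  `L(𝒟((-A(0))^(1-α₂)), H)` -/
  lipschitz_mixed : ∀ α₁ ∈ Icc (0 : ℝ) 1, ∀ α₂ ∈ Icc (0 : ℝ) 1, α₁ + α₂ = 1 → ∃ C₀ > 0,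
    ∀ s ∈ Icc 0 T, ∀ t ∈ Icc 0 T, ∀ (v : (fracPow (A 0) (1 - α₂)).domain)
      (h : negFracPow (A 0) α₂ v ∈ D),
      ‖negFracPow (A 0) α₁ ((A t - A s) ⟨negFracPow (A 0) α₂ v, h⟩)‖
        ≤ C₀ * |t - s| * (‖v‖ + ‖fracPow (A 0) (1 - α₂) v‖)

/-- The assumptions on the nonlinearity `F : [0, T] × H → H`. Derivatives with respect to `u` are
Fréchet derivatives over `ℝ`, and in the coercivity condition one takes the real part of the
inner product of `H`. -/
structure NonlinearPartAssumption (T : ℝ) (A : ℝ → D →ₗ[ℂ] H) (F : ℝ → H → H) : Prop where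
  /-- `F` is twice differentiable in both variables, with bounded partial derivatives, and
  `F' = ∂F/∂u` is coercive: `-⟨F'(t,u) v, v⟩ ≥ κ ‖v‖²` for some `κ > -b₀`, where `b₀` is the
  infimum of the real parts of the points of the spectra of the `-A(t)` (so that `κ > -b₀` means
  `κ > -b` for some lower bound `b`) -/
  differentiable : ∃ (Ft Ftt : ℝ → H → H) (Fu Ftu : ℝ → H → H →L[ℝ] H)
      (Fuu : ℝ → H → H →L[ℝ] H →L[ℝ] H),
    (∀ t ∈ Icc 0 T, ∀ u : H,
      HasDerivWithinAt (fun r => F r u) (Ft t u) (Icc 0 T) t ∧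
      HasDerivWithinAt (fun r => Ft r u) (Ftt t u) (Icc 0 T) t ∧
      HasFDerivAt (F t) (Fu t u) u ∧
      HasFDerivAt (Fu t) (Fuu t u) u ∧
      HasDerivWithinAt (fun r => Fu r u) (Ftu t u) (Icc 0 T) t) ∧
    (∃ K₃ ≥ 0, ∀ t ∈ Icc 0 T, ∀ u : H,
      ‖Ftu t u‖ ≤ K₃ ∧ ‖Ft t u‖ ≤ K₃ * (1 + ‖u‖) ∧ ‖Ftt t u‖ ≤ K₃ * (1 + ‖u‖) ∧
      ‖Fu t u‖ ≤ K₃ ∧ ‖Fuu t u‖ ≤ K₃) ∧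
    ∃ κ : ℝ, (∃ b : ℝ, (∀ t ∈ Icc 0 T, ∀ z ∈ pspectrum (-(A t)), b ≤ z.re) ∧ -b < κ) ∧
      ∀ t ∈ Icc 0 T, ∀ u v : H, κ * ‖v‖ ^ 2 ≤ -(inner ℂ (Fu t u v) v).re
  /-- the Lipschitz condition -/
  lipschitz : ∃ K₄ ≥ 0, ∀ s ∈ Icc 0 T, ∀ t ∈ Icc 0 T, ∀ u v : H,
    ‖F t u - F s v‖ ≤ K₄ * (|t - s| + ‖u - v‖)

/-- Evolution systems `U(t, s)`, `0 ≤ s ≤ t ≤ T`; the values at other `(t, s)` are irrelevant. -/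
structure IsEvolutionSystem (T : ℝ) (U : ℝ → ℝ → H →L[ℂ] H) : Prop where
  refl : ∀ s ∈ Icc 0 T, U s s = ContinuousLinearMap.id ℂ H
  comp : ∀ s r t : ℝ, 0 ≤ s → s ≤ r → r ≤ t → t ≤ T → (U t r).comp (U r s) = U t s
  strongly_continuous : ∀ v : H,
    ContinuousOn (fun p : ℝ × ℝ => U p.1 p.2 v) {p | 0 ≤ p.2 ∧ p.2 ≤ p.1 ∧ p.1 ≤ T}

/-- `U` is an evolution system on `[0, T]` belonging to the family `A(t)`. -/
structure IsEvolutionSystemOf (T : ℝ) (A : ℝ → D →ₗ[ℂ] H) (U : ℝ → ℝ → H →L[ℂ] H) : Prop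
    extends IsEvolutionSystem T U where
  /-- `‖U(t,s)‖ ≤ K₀`, `‖A(t) U(t,s)‖ ≤ K₀ / (t - s)` and `‖A(t) U(t,s) A(s)⁻¹‖ ≤ K₀` -/
  bounds : ∃ K₀ > 0,
    (∀ s t : ℝ, 0 ≤ s → s ≤ t → t ≤ T → ‖U t s‖ ≤ K₀) ∧
    (∀ s t : ℝ, 0 ≤ s → s < t → t ≤ T → ∀ v : H,
      ∃ h : U t s v ∈ D, ‖A t ⟨U t s v, h⟩‖ ≤ K₀ / (t - s) * ‖v‖) ∧
    (∀ s t : ℝ, 0 ≤ s → s ≤ t → t ≤ T → ∀ x : D,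
      ∃ h : U t s x ∈ D, ‖A t ⟨U t s x, h⟩‖ ≤ K₀ * ‖A s x‖)
  /-- `U(·, s)` is continuously differentiable on `(s, T]` with values in `L(H)`, and
  `∂U/∂t (t,s) = A(t) U(t,s)` -/
  deriv_fst : ∃ V : ℝ → ℝ → H →L[ℂ] H, ∀ s ∈ Ico 0 T,
    ContinuousOn (fun t => V t s) (Ioc s T) ∧
    ∀ t ∈ Ioc s T, HasDerivWithinAt (fun r => U r s) (V t s) (Icc s T) t ∧
      ∀ v : H, ∃ h : U t s v ∈ D, V t s v = A t ⟨U t s v, h⟩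
  /-- for `x ∈ D`, `U(t, ·) x` is continuously differentiable, and
  `∂U/∂s (t,s) x = -U(t,s) A(s) x` -/
  deriv_snd : ∀ t ∈ Ioc 0 T, ∀ x : D,
    ContinuousOn (fun s => U t s (A s x)) (Ico 0 t) ∧
    ∀ s ∈ Icc 0 t, HasDerivWithinAt (fun r => U t r x) (-(U t s (A s x))) (Icc 0 t) s

/-- Mild solutions `u ∈ C([0, T]; H)` of `u' = A(t) u + F(t, u)`, `u(0) = u₀`, where `U` is the
evolution system of the family `A(t)`. -/
structure IsMildSolution (T : ℝ) (U : ℝ → ℝ → H →L[ℂ] H) (F : ℝ → H → H) (u₀ : H)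
    (u : ℝ → H) : Prop where
  continuousOn : ContinuousOn u (Icc 0 T)
  initial : u 0 = u₀
  integrable : ∀ t ∈ Ioc 0 T, IntervalIntegrable (fun s => U t s (F s (u s))) volume 0 t
  eq : ∀ t ∈ Ioc 0 T, u t = U t 0 u₀ + ∫ s in (0 : ℝ)..t, U t s (F s (u s))

end

/-!
The operators `A(t)` are replaced by their Yosida approximations `A_n(t) = n (n R(n, A(t)) - 1)`.
These are bounded, their resolvents satisfy the sectorial estimate on the right half plane uniformly
in `n` (`IsSectorialOp.yosida_halfPlane`), and `A_n(t) A_n(s)⁻¹ - 1 = O(|t - s|)` uniformly in `n`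
(`IsSectorialFamily.parabolicFamily`). All estimates can therefore be proved for continuous
families `B(t)` in a Banach algebra, with constants that depend only on these bounds.

For a single `B` the inverse Laplace transform of the cube of the resolvent converges absolutely
and gives the bounds for `exp (t B)` and `B exp (t B)`, and for their variation under a scalar
perturbation of `B⁻¹` (`exists_exp_bounds`). For a family, the two Duhamel formulas which compare
the flow `U(t, s)` with `exp ((t - s) B(s))` and with `exp ((t - s) B(t))` have bounded kernels, so
that Gronwall's inequality bounds `U(t, s)`, `V = B(t) U(t, s) B(s)⁻¹` and `(t - s) B(t) U(t, s)`
(`exists_flow_bounds`). Since `A_n(t)⁻¹ = A(t)⁻¹ - 1/n`, two Yosida approximations differ by a scalar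
on the level of the inverses, and the comparison in `exists_flow_bounds` makes the conjugated flows
`V_n` a Cauchy sequence in norm, uniformly for `t - s` bounded below. As `D` is dense
(`IsSectorialOp.dense`), `U_n` and `A_n(t) U_n(t, s)` converge strongly
(`IsSectorialFamily.exists_yosidaLimit`), the bounds are inherited, and the factorization
`A(t) U(t, s) = V(t, m) A(m) U(m, s)` gives continuity of `A(t) U(t, s)` in the operator norm
(`YosidaLimit.isEvolutionSystemOf`).

If `y' = A y + g`, then `τ ↦ U(t, τ) y(τ)` has derivative `U(t, τ) g(τ)`. This variation of
constants formula (`IsEvolutionSystemOf.eq_add_integral`) gives the uniqueness of `U`, and shows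
that `U(t, 0)` differs from the semigroup generated by `A(0)` by an integral of the form
`∫ U(t, τ) g(τ) dτ` with bounded `g`. Mild solutions are fixed points of a Volterra operator.

For the fractional powers `(-A(0))^α`, `0 < α < 1`, the product of Balakrishnan's integrals for
`α` and `1 - α` is a non-zero multiple of `A(0)⁻¹`, by Fubini's theorem and a Frullani integral
(`IsSectorialOp.balakrishnan_mul`). Hence the fractional powers are well defined, their domains
contain `D`, and they satisfy a moment inequality (`IsSectorialOp.exists_fracPow_on_domain`). The
latter applies to the integrals `∫ U(t, τ) h(τ) dτ` with bounded `h`, because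
`A(0) U(t, τ) = O(1 / (t - τ))` and `α < 1`, while the semigroup generated by `A(0)` commutes with
the fractional powers; together this is the space regularity
(`IsEvolutionSystemOf.exists_regularity_bound`).
-/

set_option linter.unusedSectionVars false

/-! ### Gronwall inequalities and Volterra fixed points -/

/-- Gronwall's inequality for a forcing term `h` that is only integrable; it is used with
`h` constant and with `h` having an inverse square root singularity at `a`. -/
theorem gronwall_integral {f h : ℝ → ℝ} {a b L S : ℝ} (hL : 0 ≤ L) (hS : b - a ≤ S)
    (hf : ContinuousOn f (Icc a b)) (hh : IntervalIntegrable h volume a b)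
    (h0 : ∀ t ∈ Ioc a b, 0 ≤ h t)
    (hle : ∀ t ∈ Ioc a b, f t ≤ h t + L * ∫ τ in a..t, f τ) :
    ∀ t ∈ Ioc a b, f t ≤ h t + L * Real.exp (L * S) * ∫ τ in a..t, h τ := by
  intro t ht
  have hat : a ≤ t := ht.1.le
  have hfi : ∀ x ∈ Icc a b, IntervalIntegrable f volume a x := fun x hx =>
    (hf.mono (Icc_subset_Icc_right hx.2)).intervalIntegrable_of_Icc hx.1
  have hsub : Icc a t ⊆ Icc a b := Icc_subset_Icc_right ht.2
  have hht : IntervalIntegrable h volume a t := hh.mono_set (by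
    rw [uIcc_of_le hat, uIcc_of_le (hat.trans ht.2)]; exact hsub)
  set g : ℝ → ℝ := fun x => ∫ τ in a..x, f τ with hg
  have hgc : ContinuousOn g (Icc a t) := by
    have := intervalIntegral.continuousOn_primitive_interval (μ := volume) (f := f) (a := a)
      (b := t) (by rw [uIcc_of_le hat]; exact (hf.mono hsub).integrableOn_Icc)
    rwa [uIcc_of_le hat] at this
  have hgd : ∀ x ∈ Ioo a t, HasDerivAt g (f x) x := by
    intro x hx
    have hxb : x ∈ Icc a b := ⟨hx.1.le, hx.2.le.trans ht.2⟩
    have hn : Icc a b ∈ nhds x := Icc_mem_nhds hx.1 (hx.2.trans_le ht.2)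
    exact intervalIntegral.integral_hasDerivAt_right (hfi x hxb)
      ((hf.stronglyMeasurableAtFilter_nhdsWithin measurableSet_Icc x).filter_mono
        (nhdsWithin_eq_nhds.2 hn).ge) (hf.continuousAt hn)
  have hE : ∀ x, HasDerivAt (fun x => Real.exp (-(L * (x - a)))) (Real.exp (-(L * (x - a))) * (-L)) x := by
    intro x
    have h1 : HasDerivAt (fun x : ℝ => -(L * (x - a))) (-(L * 1)) x :=
      (((hasDerivAt_id x).sub_const a).const_mul L).neg
    simpa using h1.exp
  have hEc : Continuous fun x => Real.exp (-(L * (x - a))) := by fun_prop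
  have hcont' : ContinuousOn (fun x => Real.exp (-(L * (x - a))) * (-L) * g x
      + Real.exp (-(L * (x - a))) * f x) (Icc a t) :=
    ((hEc.mul continuous_const).continuousOn.mul hgc).add (hEc.continuousOn.mul (hf.mono hsub))
  have hint := hcont'.intervalIntegrable_of_Icc (μ := volume) hat
  have key := intervalIntegral.integral_eq_sub_of_hasDerivAt_of_le hat
    (f := fun x => Real.exp (-(L * (x - a))) * g x)
    (f' := fun x => Real.exp (-(L * (x - a))) * (-L) * g x + Real.exp (-(L * (x - a))) * f x)
    (hEc.continuousOn.mul hgc) (fun x hx => (hE x).mul (hgd x hx)) hint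
  have hga : g a = 0 := intervalIntegral.integral_same
  simp only [hga, mul_zero, sub_zero] at key
  have hle2 : Real.exp (-(L * (t - a))) * g t ≤ ∫ τ in a..t, h τ := by
    rw [← key]
    refine intervalIntegral.integral_mono_on_of_le_Ioo hat hint hht fun x hx => ?_
    have hxb : x ∈ Ioc a b := ⟨hx.1, hx.2.le.trans ht.2⟩
    have h1 := hle x hxb
    have h2 : Real.exp (-(L * (x - a))) ≤ 1 := by
      rw [Real.exp_le_one_iff]
      have := mul_nonneg hL (sub_nonneg.2 hx.1.le)
      linarith
    have h3 := Real.exp_pos (-(L * (x - a)))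
    calc _ = Real.exp (-(L * (x - a))) * (f x - L * g x) := by ring
      _ ≤ Real.exp (-(L * (x - a))) * h x := by gcongr; simp only [hg]; linarith
      _ ≤ 1 * h x := by gcongr; exact h0 x hxb
      _ = h x := one_mul _
  have hI : 0 ≤ ∫ τ in a..t, h τ := intervalIntegral.integral_nonneg_of_ae_restrict hat (by
    filter_upwards [ae_restrict_mem measurableSet_Icc,
      ae_restrict_of_ae (Measure.ae_ne volume a)] with x hx hxa
    exact h0 x ⟨lt_of_le_of_ne hx.1 (Ne.symm hxa), hx.2.trans ht.2⟩)
  have hle3 : g t ≤ Real.exp (L * S) * ∫ τ in a..t, h τ := by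
    have h4 : g t = Real.exp (L * (t - a)) * (Real.exp (-(L * (t - a))) * g t) := by
      rw [← mul_assoc, ← Real.exp_add]; simp
    rw [h4]
    have h5 : L * (t - a) ≤ L * S := by gcongr; linarith [ht.2]
    exact (mul_le_mul_of_nonneg_left hle2 (Real.exp_nonneg _)).trans
      (mul_le_mul_of_nonneg_right (Real.exp_le_exp.2 h5) hI)
  calc f t ≤ h t + L * g t := hle t ht
    _ ≤ h t + L * (Real.exp (L * S) * ∫ τ in a..t, h τ) := by gcongr
    _ = _ := by ring

/-- Gronwall's inequality backwards in time. -/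
theorem gronwall_integral_backward {f h : ℝ → ℝ} {a b L S : ℝ} (hL : 0 ≤ L) (hS : b - a ≤ S)
    (hf : ContinuousOn f (Icc a b)) (hh : IntervalIntegrable h volume a b)
    (h0 : ∀ t ∈ Ico a b, 0 ≤ h t)
    (hle : ∀ t ∈ Ico a b, f t ≤ h t + L * ∫ τ in t..b, f τ) :
    ∀ t ∈ Ico a b, f t ≤ h t + L * Real.exp (L * S) * ∫ τ in t..b, h τ := by
  intro t ht
  have hc : ContinuousOn (fun x => f (-x)) (Icc (-b) (-a)) :=
    hf.comp continuous_neg.continuousOn fun x hx => ⟨by linarith [hx.2], by linarith [hx.1]⟩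
  have hi : IntervalIntegrable (fun x => h (-x)) volume (-b) (-a) := by
    have := (IntervalIntegrable.iff_comp_neg (f := h) (a := a) (b := b)).1 hh
    exact this.symm
  have := gronwall_integral (f := fun x => f (-x)) (h := fun x => h (-x)) (a := -b) (b := -a)
    (S := S) hL (by linarith) hc hi (fun x hx => h0 _ ⟨by linarith [hx.2], by linarith [hx.1]⟩)
    (fun x hx => by
      have h1 := hle (-x) ⟨by linarith [hx.2], by linarith [hx.1]⟩
      rw [intervalIntegral.integral_comp_neg (fun x => f x), neg_neg]
      exact h1) (-t) ⟨by linarith [ht.2], by linarith [ht.1]⟩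
  rw [intervalIntegral.integral_comp_neg (fun x => h x)] at this
  simpa using this

theorem integral_inv_sqrt (a t : ℝ) :
    IntervalIntegrable (fun τ => (τ - a) ^ (-(1 / 2) : ℝ)) volume a t ∧
      ∫ τ in a..t, (τ - a) ^ (-(1 / 2) : ℝ) = 2 * (t - a) ^ (1 / 2 : ℝ) := by
  constructor
  · have := (intervalIntegral.intervalIntegrable_rpow' (a := 0) (b := t - a)
      (r := -(1 / 2)) (by norm_num)).comp_sub_right a
    simpa using this
  · rw [intervalIntegral.integral_comp_sub_right (fun x => x ^ (-(1 / 2) : ℝ)),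
      integral_rpow (Or.inl (by norm_num))]
    norm_num
    ring

theorem integral_inv_sqrt' (s b : ℝ) :
    IntervalIntegrable (fun τ => (b - τ) ^ (-(1 / 2) : ℝ)) volume s b ∧
      ∫ τ in s..b, (b - τ) ^ (-(1 / 2) : ℝ) = 2 * (b - s) ^ (1 / 2 : ℝ) := by
  constructor
  · have := (intervalIntegral.intervalIntegrable_rpow' (a := b - s) (b := 0)
      (r := -(1 / 2)) (by norm_num)).comp_sub_left b
    simpa using this
  · rw [intervalIntegral.integral_comp_sub_left (fun x => x ^ (-(1 / 2) : ℝ)),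
      integral_rpow (Or.inl (by norm_num))]
    norm_num
    ring

theorem sqrt_le_mul_inv_sqrt {x S : ℝ} (hx : 0 < x) (hS : x ≤ S) :
    x ^ (1 / 2 : ℝ) ≤ S * x ^ (-(1 / 2) : ℝ) := by
  have : x ^ (1 / 2 : ℝ) = x * x ^ (-(1 / 2) : ℝ) := by
    rw [← Real.rpow_one_add' hx.le (by norm_num)]; norm_num
  rw [this]
  gcongr

theorem gronwall_inv_sqrt {f : ℝ → ℝ} {a b L S M : ℝ} (hL : 0 ≤ L) (hS : b - a ≤ S) (hM : 0 ≤ M)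
    (hf : ContinuousOn f (Icc a b))
    (hle : ∀ t ∈ Ioc a b, f t ≤ M * (t - a) ^ (-(1 / 2) : ℝ) + L * ∫ τ in a..t, f τ) :
    ∀ t ∈ Ioc a b, f t ≤ (1 + 2 * L * Real.exp (L * S) * S) * M * (t - a) ^ (-(1 / 2) : ℝ) := by
  intro t ht
  have hab : a ≤ b := ht.1.le.trans ht.2
  have h := gronwall_integral hL hS hf ((integral_inv_sqrt a b).1.const_mul M)
    (fun t ht => mul_nonneg hM (Real.rpow_nonneg (by linarith [ht.1]) _)) hle t ht
  rw [intervalIntegral.integral_const_mul, (integral_inv_sqrt a t).2] at h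
  have h2 := sqrt_le_mul_inv_sqrt (x := t - a) (S := S) (by linarith [ht.1]) (by linarith [ht.2])
  refine h.trans ?_
  calc _ ≤ M * (t - a) ^ (-(1 / 2) : ℝ)
        + L * Real.exp (L * S) * (M * (2 * (S * (t - a) ^ (-(1 / 2) : ℝ)))) := by gcongr
    _ = _ := by ring

theorem gronwall_inv_sqrt_backward {f : ℝ → ℝ} {a b L S M : ℝ} (hL : 0 ≤ L) (hS : b - a ≤ S)
    (hM : 0 ≤ M) (hf : ContinuousOn f (Icc a b))
    (hle : ∀ t ∈ Ico a b, f t ≤ M * (b - t) ^ (-(1 / 2) : ℝ) + L * ∫ τ in t..b, f τ) :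
    ∀ t ∈ Ico a b, f t ≤ (1 + 2 * L * Real.exp (L * S) * S) * M * (b - t) ^ (-(1 / 2) : ℝ) := by
  intro t ht
  have hab : a ≤ b := ht.1.trans ht.2.le
  have h := gronwall_integral_backward hL hS hf ((integral_inv_sqrt' a b).1.const_mul M)
    (fun t ht => mul_nonneg hM (Real.rpow_nonneg (by linarith [ht.2]) _)) hle t ht
  rw [intervalIntegral.integral_const_mul, (integral_inv_sqrt' t b).2] at h
  have h2 := sqrt_le_mul_inv_sqrt (x := b - t) (S := S) (by linarith [ht.2]) (by linarith [ht.1])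
  refine h.trans ?_
  calc _ ≤ M * (b - t) ^ (-(1 / 2) : ℝ)
        + L * Real.exp (L * S) * (M * (2 * (S * (b - t) ^ (-(1 / 2) : ℝ)))) := by gcongr
    _ = _ := by ring

theorem gronwall_const {f : ℝ → ℝ} {a b L S M : ℝ} (hL : 0 ≤ L) (hS : b - a ≤ S) (hM : 0 ≤ M)
    (hf : ContinuousOn f (Icc a b))
    (hle : ∀ t ∈ Ioc a b, f t ≤ M + L * ∫ τ in a..t, f τ) :
    ∀ t ∈ Ioc a b, f t ≤ (1 + L * Real.exp (L * S) * S) * M := by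
  intro t ht
  have h := gronwall_integral (h := fun _ => M) hL hS hf (by simp) (fun _ _ => hM) hle t ht
  rw [intervalIntegral.integral_const, smul_eq_mul] at h
  refine h.trans ?_
  have : t - a ≤ S := by linarith [ht.2]
  calc _ ≤ M + L * Real.exp (L * S) * (S * M) := by gcongr
    _ = _ := by ring

theorem gronwall_const_backward {f : ℝ → ℝ} {a b L S M : ℝ} (hL : 0 ≤ L) (hS : b - a ≤ S)
    (hM : 0 ≤ M) (hf : ContinuousOn f (Icc a b))
    (hle : ∀ t ∈ Ico a b, f t ≤ M + L * ∫ τ in t..b, f τ) :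
    ∀ t ∈ Ico a b, f t ≤ (1 + L * Real.exp (L * S) * S) * M := by
  intro t ht
  have h := gronwall_integral_backward (h := fun _ => M) hL hS hf (by simp) (fun _ _ => hM) hle t ht
  rw [intervalIntegral.integral_const, smul_eq_mul] at h
  refine h.trans ?_
  have : b - t ≤ S := by linarith [ht.1]
  calc _ ≤ M + L * Real.exp (L * S) * (S * M) := by gcongr
    _ = _ := by ring

/-- A map on `C([0, T]; E)` with a Volterra type Lipschitz bound has a fixed point: its iterates
are eventually contractions, by the factor `(L T) ^ n / n!`. -/
theorem exists_volterra_fixedPoint {E : Type*} [NormedAddCommGroup E] [CompleteSpace E]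
    {T L : ℝ} (hT : 0 ≤ T) (hL : 0 ≤ L) (Φ : (ℝ → E) → ℝ → E)
    (hΦc : ∀ u, Continuous u → ContinuousOn (Φ u) (Icc 0 T))
    (hΦ : ∀ u v, Continuous u → Continuous v → ∀ t ∈ Icc 0 T,
      ‖Φ u t - Φ v t‖ ≤ L * ∫ s in (0 : ℝ)..t, ‖u s - v s‖) :
    ∃ u, Continuous u ∧ ∀ t ∈ Icc 0 T, u t = Φ u t := by
  let ext : C(Icc (0 : ℝ) T, E) → ℝ → E := fun u t => u (projIcc 0 T hT t)
  have hext : ∀ u, Continuous (ext u) := fun u => u.continuous.comp continuous_projIcc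
  let ψ : C(Icc (0 : ℝ) T, E) → C(Icc (0 : ℝ) T, E) := fun u =>
    ⟨fun t => Φ (ext u) t, (hΦc _ (hext u)).comp_continuous continuous_subtype_val fun t => t.2⟩
  have hiter : ∀ (n : ℕ) (u v : C(Icc (0 : ℝ) T, E)), ∀ t ∈ Icc 0 T,
      ‖ext (ψ^[n] u) t - ext (ψ^[n] v) t‖ ≤ (L * t) ^ n / n.factorial * dist u v := by
    intro n
    induction n with
    | zero =>
      intro u v t ht
      simp only [Function.iterate_zero, id_eq, pow_zero, Nat.factorial_zero, Nat.cast_one, div_one,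
        one_mul]
      rw [← dist_eq_norm]
      exact ContinuousMap.dist_apply_le_dist _
    | succ n ih =>
      intro u v t ht
      have h1 : ∀ w, ext (ψ w) t = Φ (ext w) t := fun w => by
        simp only [ext, ψ, ContinuousMap.coe_mk, projIcc_of_mem hT ht]
      rw [Function.iterate_succ_apply', Function.iterate_succ_apply', h1, h1]
      refine (hΦ _ _ (hext _) (hext _) t ht).trans ?_
      have h2 : ∫ s in (0 : ℝ)..t, ‖ext (ψ^[n] u) s - ext (ψ^[n] v) s‖
          ≤ ∫ s in (0 : ℝ)..t, (L ^ n / n.factorial * dist u v) * s ^ n := by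
        refine intervalIntegral.integral_mono_on ht.1 ?_ ?_ fun s hs => ?_
        · exact (((hext _).sub (hext _)).norm).intervalIntegrable _ _
        · exact (continuous_const.mul (continuous_pow n)).intervalIntegrable _ _
        · refine (ih u v s ⟨hs.1, hs.2.trans ht.2⟩).trans (le_of_eq ?_)
          rw [mul_pow]; ring
      rw [intervalIntegral.integral_const_mul, integral_pow] at h2
      refine (mul_le_mul_of_nonneg_left h2 hL).trans (le_of_eq ?_)
      rw [Nat.factorial_succ]
      push_cast
      have : (n.factorial : ℝ) ≠ 0 := by positivity
      field_simp
      ring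
  obtain ⟨n, hn⟩ := ((FloorSemiring.tendsto_pow_div_factorial_atTop (L * T)).eventually
    (gt_mem_nhds (show (0 : ℝ) < 1 by norm_num))).exists
  have hLT : 0 ≤ (L * T) ^ n / n.factorial := by positivity
  have hcw : ContractingWith ⟨(L * T) ^ n / n.factorial, hLT⟩ (ψ^[n]) := by
    refine ⟨by exact_mod_cast hn, LipschitzWith.of_dist_le_mul fun u v => ?_⟩
    rw [ContinuousMap.dist_le (by positivity)]
    intro t
    have h := hiter n u v t t.2
    simp only [ext, projIcc_val] at h
    rw [dist_eq_norm]
    refine h.trans ?_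
    have ht := t.2
    have : 0 ≤ (t : ℝ) := t.2.1
    change _ ≤ (L * T) ^ n / n.factorial * dist u v
    gcongr
    exact ht.2
  have : Nonempty C(Icc (0 : ℝ) T, E) := ⟨0⟩
  have hfix := hcw.isFixedPt_fixedPoint_iterate
  set w := hcw.fixedPoint
  refine ⟨ext w, hext w, fun t ht => ?_⟩
  have h : ψ w = w := hfix
  have := congrArg (fun z : C(Icc (0 : ℝ) T, E) => z ⟨t, ht⟩) h
  simp only [ψ, ContinuousMap.coe_mk] at this
  simp only [ext, projIcc_of_mem hT ht]
  exact this.symm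

/-! ### Analytic semigroups generated by elements of a Banach algebra -/

section ExpEstimates

variable {𝔸 : Type*} [NormedRing 𝔸] [NormedAlgebra ℂ 𝔸] [CompleteSpace 𝔸]

/-- `B` satisfies the sectorial resolvent estimate `‖(z - B)⁻¹‖ ≤ c / |z|` on the right half
plane; this half of a sector suffices for all estimates of `exp (t B)`, `t > 0`. -/
def HalfPlaneBound (c : ℝ) (B : 𝔸) : Prop :=
  ∀ z : ℂ, 0 < z.re → z ∈ resolventSet ℂ B ∧ ‖resolvent B z‖ ≤ c / ‖z‖

theorem resolvent_mul_self_sub {B : 𝔸} {z : ℂ} (h : z ∈ resolventSet ℂ B) :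
    resolvent B z * (algebraMap ℂ 𝔸 z - B) = 1 :=
  Ring.inverse_mul_cancel _ h

theorem self_sub_mul_resolvent {B : 𝔸} {z : ℂ} (h : z ∈ resolventSet ℂ B) :
    (algebraMap ℂ 𝔸 z - B) * resolvent B z = 1 :=
  Ring.mul_inverse_cancel _ h

theorem self_mul_resolvent {B : 𝔸} {z : ℂ} (h : z ∈ resolventSet ℂ B) :
    B * resolvent B z = z • resolvent B z - 1 := by
  have := self_sub_mul_resolvent h
  rw [sub_mul, ← Algebra.smul_def] at this
  rw [← this]; abel

theorem resolvent_mul_self {B : 𝔸} {z : ℂ} (h : z ∈ resolventSet ℂ B) :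
    resolvent B z * B = z • resolvent B z - 1 := by
  have := resolvent_mul_self_sub h
  rw [mul_sub, ← Algebra.commutes, ← Algebra.smul_def] at this
  rw [← this]; abel

theorem HalfPlaneBound.nonneg {c : ℝ} {B : 𝔸} (h : HalfPlaneBound c B) : 0 ≤ c := by
  have := (norm_nonneg _).trans (h 1 (by simp)).2
  simpa using this

theorem norm_exp_smul_le (B : 𝔸) {t : ℝ} (ht : 0 ≤ t) :
    ‖NormedSpace.exp (t • B)‖ ≤ ‖(1 : 𝔸)‖ * Real.exp (‖B‖ * t) := by
  have hd : ∀ x : ℝ, HasDerivAt (fun u : ℝ => NormedSpace.exp (u • B))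
      (B * NormedSpace.exp (x • B)) x := fun x => hasDerivAt_exp_smul_const' B x
  have := norm_le_gronwallBound_of_norm_deriv_right_le (f := fun u : ℝ => NormedSpace.exp (u • B))
    (f' := fun x => B * NormedSpace.exp (x • B)) (δ := ‖(1 : 𝔸)‖) (K := ‖B‖) (ε := 0) (a := 0)
    (b := t) (fun x _ => (hd x).continuousAt.continuousWithinAt)
    (fun x _ => (hd x).hasDerivWithinAt) (by simp)
    (fun x _ => by simpa using norm_mul_le _ _) t ⟨ht, le_rfl⟩
  simpa [gronwallBound_ε0] using this

theorem line_ne_zero {a : ℝ} (ha : 0 < a) (y : ℝ) : ((a : ℂ) + y * Complex.I) ≠ 0 := by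
  intro h
  have := congrArg Complex.re h
  simp at this
  exact ha.ne' this

theorem norm_line_sq (a y : ℝ) : ‖(a : ℂ) + y * Complex.I‖ ^ 2 = a ^ 2 + y ^ 2 := by
  rw [← Complex.normSq_eq_norm_sq, Complex.normSq_add_mul_I]

theorem le_norm_line (a y : ℝ) : a ≤ ‖(a : ℂ) + y * Complex.I‖ := by
  have := Complex.re_le_norm ((a : ℂ) + y * Complex.I)
  simpa using this

theorem integral_inv_line_sq {a : ℝ} (ha : 0 < a) :
    Integrable (fun y : ℝ => (a ^ 2 + y ^ 2)⁻¹) ∧ ∫ y : ℝ, (a ^ 2 + y ^ 2)⁻¹ = Real.pi / a := by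
  have h : (fun y : ℝ => (a ^ 2 + y ^ 2)⁻¹) = fun y => (a ^ 2)⁻¹ * (1 + (y / a) ^ 2)⁻¹ := by
    funext y
    rw [← mul_inv]
    congr 1
    field_simp
  rw [h]
  refine ⟨(integrable_inv_one_add_sq.comp_div ha.ne').const_mul _, ?_⟩
  rw [integral_const_mul, Measure.integral_comp_div (fun y : ℝ => (1 + y ^ 2)⁻¹) a,
    integral_univ_inv_one_add_sq, abs_of_pos ha, smul_eq_mul]
  field_simp

theorem norm_cexp_line (a t y : ℝ) :
    ‖Complex.exp (((a : ℂ) + y * Complex.I) * t)‖ = Real.exp (a * t) := by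
  rw [Complex.norm_exp]
  simp

/-- A bound by `M / |z| ^ 2` on a vertical line yields integrability, and the bound that comes
from the choice `a = 1 / t` of the line. -/
theorem norm_integral_line_le {E : Type*} [NormedAddCommGroup E] [NormedSpace ℂ E]
    {f : ℂ → E} {M t : ℝ} (ht : 0 < t)
    (hM : ∀ z : ℂ, z.re = t⁻¹ → ‖f z‖ ≤ M / ‖z‖ ^ 2) :
    ‖∫ y : ℝ, Complex.exp (((t⁻¹ : ℝ) + y * Complex.I) * t) • f ((t⁻¹ : ℝ) + y * Complex.I)‖
      ≤ Real.exp 1 * M * Real.pi * t := by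
  have ha : 0 < t⁻¹ := inv_pos.2 ht
  have hI := integral_inv_line_sq ha
  refine (norm_integral_le_of_norm_le (hI.1.const_mul (Real.exp 1 * M))
    (Filter.Eventually.of_forall fun y => ?_)).trans (le_of_eq ?_)
  · rw [norm_smul, norm_cexp_line, inv_mul_cancel₀ ht.ne']
    have := hM ((t⁻¹ : ℝ) + y * Complex.I) (by simp)
    rw [norm_line_sq] at this
    calc _ ≤ Real.exp 1 * (M / ((t⁻¹) ^ 2 + y ^ 2)) := by gcongr
      _ = _ := by ring
  · rw [integral_const_mul, hI.2]
    field_simp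

section Contour

variable {c : ℝ} {B : 𝔸} (hB : HalfPlaneBound c B)
include hB

theorem HalfPlaneBound.norm_pow_three_le {z : ℂ} (hz : 0 < z.re) :
    ‖resolvent B z ^ 3‖ ≤ c ^ 3 / ‖z‖ ^ 3 := by
  rw [← div_pow]
  exact (norm_pow_le' _ (by norm_num)).trans (pow_le_pow_left₀ (norm_nonneg _) (hB z hz).2 _)

theorem HalfPlaneBound.differentiableAt_integrand (t : ℝ) {z : ℂ} (hz : 0 < z.re) :
    DifferentiableAt ℂ (fun z => Complex.exp (z * t) • resolvent B z ^ 3) z := by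
  have h1 : DifferentiableAt ℂ (resolvent B) z :=
    (spectrum.hasDerivAt_resolvent_const_left (hB z hz).1).differentiableAt
  exact ((differentiableAt_id.mul_const _).cexp).smul (h1.pow 3)

theorem HalfPlaneBound.continuous_line (t : ℝ) {a : ℝ} (ha : 0 < a) :
    Continuous fun y : ℝ => Complex.exp (((a : ℂ) + y * Complex.I) * t) •
      resolvent B ((a : ℂ) + y * Complex.I) ^ 3 := by
  rw [continuous_iff_continuousAt]
  intro y
  have := (hB.differentiableAt_integrand t (z := (a : ℂ) + y * Complex.I)
    (by simpa using ha)).continuousAt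
  exact ContinuousAt.comp (f := fun y : ℝ => (a : ℂ) + y * Complex.I) this (by fun_prop)

theorem HalfPlaneBound.integrable_line (t : ℝ) {a : ℝ} (ha : 0 < a) :
    Integrable fun y : ℝ => Complex.exp (((a : ℂ) + y * Complex.I) * t) •
      resolvent B ((a : ℂ) + y * Complex.I) ^ 3 := by
  refine ((integral_inv_line_sq ha).1.const_mul (Real.exp (a * t) * (c ^ 3 / a))).mono'
    (hB.continuous_line t ha).aestronglyMeasurable (Filter.Eventually.of_forall fun y => ?_)
  rw [norm_smul, norm_cexp_line, mul_assoc]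
  gcongr
  have h1 := hB.norm_pow_three_le (z := (a : ℂ) + y * Complex.I) (by simpa using ha)
  have h2 := le_norm_line a y
  have hc := hB.nonneg
  refine h1.trans ?_
  rw [← norm_line_sq, pow_succ' _ 2, div_mul_eq_mul_div, ← div_eq_mul_inv, div_div]
  have h3 : 0 < ‖(a : ℂ) + y * Complex.I‖ := norm_pos_iff.2 (line_ne_zero ha y)
  have h4 : ‖(a : ℂ) + y * Complex.I‖ ^ 2 * a ≤ ‖(a : ℂ) + y * Complex.I‖ ^ 3 := by
    rw [pow_succ _ 2]; gcongr
  exact div_le_div_of_nonneg_left (by positivity) (by positivity) h4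

/-- Cauchy's theorem on rectangles: the line of integration can be moved. -/
theorem HalfPlaneBound.line_integral_eq {t : ℝ} {a b : ℝ} (ha : 0 < a) (hab : a ≤ b) :
    ∫ y : ℝ, Complex.exp (((a : ℂ) + y * Complex.I) * t) •
        resolvent B ((a : ℂ) + y * Complex.I) ^ 3
      = ∫ y : ℝ, Complex.exp (((b : ℂ) + y * Complex.I) * t) •
        resolvent B ((b : ℂ) + y * Complex.I) ^ 3 := by
  set f : ℂ → 𝔸 := fun z => Complex.exp (z * t) • resolvent B z ^ 3 with hf
  have hb : 0 < b := ha.trans_le hab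
  have hrect : ∀ N : ℝ, (∫ x : ℝ in a..b, f (x + (-N : ℝ) * Complex.I))
      - (∫ x : ℝ in a..b, f (x + N * Complex.I)) +
      Complex.I • (∫ y : ℝ in (-N)..N, f (b + y * Complex.I)) -
      Complex.I • (∫ y : ℝ in (-N)..N, f (a + y * Complex.I)) = 0 := by
    intro N
    have := Complex.integral_boundary_rect_eq_zero_of_differentiableOn f
      (⟨a, -N⟩ : ℂ) (⟨b, N⟩ : ℂ) (fun z hz => by
        have hz1 := hz.1
        simp only [mem_preimage, uIcc_of_le hab] at hz1
        exact (hB.differentiableAt_integrand t (ha.trans_le hz1.1)).differentiableWithinAt)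
    simpa using this
  have hlim : ∀ {d : ℝ}, 0 < d → Filter.Tendsto (fun N : ℝ => ∫ y : ℝ in (-N)..N,
      f (d + y * Complex.I)) Filter.atTop (nhds (∫ y : ℝ, f (d + y * Complex.I))) := fun hd =>
    intervalIntegral_tendsto_integral (hB.integrable_line t hd)
      Filter.tendsto_neg_atTop_atBot Filter.tendsto_id
  have hhor : ∀ s : ℝ, |s| = 1 → Filter.Tendsto (fun N : ℝ => ∫ x : ℝ in a..b,
      f (x + (s * N : ℝ) * Complex.I)) Filter.atTop (nhds 0) := by
    intro s hs
    have hlim0 : Filter.Tendsto (fun N : ℝ => Real.exp (b * |t|) * c ^ 3 * (N ^ 3)⁻¹ * |b - a|)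
        Filter.atTop (nhds 0) := by
      have : Filter.Tendsto (fun N : ℝ => (N ^ 3)⁻¹) Filter.atTop (nhds 0) :=
        (Filter.tendsto_pow_atTop (by norm_num)).inv_tendsto_atTop
      simpa using (this.const_mul (Real.exp (b * |t|) * c ^ 3)).mul_const |b - a|
    refine squeeze_zero_norm' ?_ hlim0
    filter_upwards [Filter.eventually_gt_atTop 0] with N hN
    refine intervalIntegral.norm_integral_le_of_norm_le_const fun x hx => ?_
    rw [uIoc_of_le hab] at hx
    have hx0 : 0 < x := ha.trans hx.1
    simp only [hf]
    rw [norm_smul, norm_cexp_line, mul_assoc (Real.exp (b * |t|))]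
    have h1 := hB.norm_pow_three_le (z := (x : ℂ) + (s * N : ℝ) * Complex.I) (by simpa using hx0)
    have h2 : N ≤ ‖(x : ℂ) + (s * N : ℝ) * Complex.I‖ := by
      have := Complex.abs_im_le_norm ((x : ℂ) + (s * N : ℝ) * Complex.I)
      simpa [abs_mul, hs, abs_of_pos hN] using this
    have hc := hB.nonneg
    have h3 : x * t ≤ b * |t| :=
      (mul_le_mul_of_nonneg_left (le_abs_self t) hx0.le).trans
        (mul_le_mul_of_nonneg_right hx.2 (abs_nonneg t))
    gcongr
    refine h1.trans ?_
    rw [div_eq_mul_inv]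
    gcongr
  have e1 := hhor (-1) (by simp)
  have e2 := hhor 1 (by simp)
  have := ((e1.sub e2).add ((hlim hb).const_smul Complex.I)).sub ((hlim ha).const_smul Complex.I)
  have h0 := tendsto_nhds_unique this (tendsto_const_nhds.congr fun N => by
    have := hrect N
    simp only [neg_mul, one_mul] 
    exact this.symm)
  simp only [sub_zero, zero_add] at h0
  rw [← smul_sub, smul_eq_zero_iff_right Complex.I_ne_zero, sub_eq_zero] at h0
  exact h0.symm

open scoped FourierTransform in
/-- The Laplace transform of `t ↦ (t² / 2) exp (t B)` is the cube of the resolvent. -/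
theorem HalfPlaneBound.fourier_exp (w : ℝ) :
    𝓕 (fun v : ℝ => ((max v 0) ^ 2 / 2 * Real.exp (-((‖B‖ + 1) * v))) • NormedSpace.exp (v • B)) w
      = resolvent B (((‖B‖ + 1 : ℝ) : ℂ) + (2 * Real.pi * w : ℝ) * Complex.I) ^ 3 ∧
    IntegrableOn (fun v : ℝ => ((max v 0) ^ 2 / 2 * Real.exp (-((‖B‖ + 1) * v))) •
      NormedSpace.exp (v • B)) (Ioi 0) := by
  set a : ℝ := ‖B‖ + 1 with ha
  have ha0 : 0 < a := by positivity
  set z : ℂ := (a : ℂ) + (2 * Real.pi * w : ℝ) * Complex.I with hz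
  have hzr : z ∈ resolventSet ℂ B := (hB z (by simpa [hz] using ha0)).1
  set R := resolvent B z with hR
  set X : ℝ → 𝔸 := fun t => (t ^ 2 / 2) • R + t • R ^ 2 + R ^ 3 with hX
  have hXd : ∀ t, HasDerivAt X (t • R + R ^ 2) t := by
    intro t
    have h1 : HasDerivAt (fun t : ℝ => t ^ 2 / 2) t t := by
      simpa using (hasDerivAt_pow 2 t).div_const 2
    rw [hX]
    simpa using ((h1.smul_const R).add ((hasDerivAt_id t).smul_const (R ^ 2))).add_const (R ^ 3)
  set Ψ : ℝ → 𝔸 := fun t => Complex.exp (-(z * t)) • (NormedSpace.exp (t • B) * X t) with hΨ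
  have hΨd : ∀ t : ℝ, HasDerivAt Ψ
      (-(Complex.exp (-(z * t)) • (NormedSpace.exp (t • B) * algebraMap ℝ 𝔸 (t ^ 2 / 2)))) t := by
    intro t
    have h1 : HasDerivAt (fun t : ℝ => Complex.exp (-(z * t))) (Complex.exp (-(z * t)) * -z) t := by
      have h2 : HasDerivAt (fun t : ℝ => -(z * (t : ℂ))) (-(z * 1)) t :=
        ((hasDerivAt_id t).ofReal_comp.const_mul z).neg
      simpa using h2.cexp
    refine (h1.smul ((hasDerivAt_exp_smul_const B t).mul (hXd t))).congr_deriv ?_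
    have h3 : algebraMap ℝ 𝔸 (t ^ 2 / 2) = z • X t - B * X t - (t • R + R ^ 2) := by
      have h4 : B * R = z • R - 1 := self_mul_resolvent hzr
      have h5 : B * X t = (t ^ 2 / 2) • (z • R - 1) + t • (z • R ^ 2 - R) + (z • R ^ 3 - R ^ 2) := by
        simp only [hX, mul_add, mul_smul_comm, pow_succ' R 2, pow_two R, ← mul_assoc, h4, sub_mul,
          smul_mul_assoc, one_mul]
      rw [h5, Algebra.algebraMap_eq_smul_one]
      simp only [hX, smul_sub, smul_add, smul_comm z]
      abel
    rw [h3]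
    simp only [mul_sub, mul_add, mul_assoc, mul_smul, mul_smul_comm, smul_sub, smul_add, neg_smul,
      smul_neg]
    abel
  have hnorm : ∀ t : ℝ, 0 ≤ t →
      ‖Complex.exp (-(z * t))‖ * ‖NormedSpace.exp (t • B)‖ ≤ ‖(1 : 𝔸)‖ * Real.exp (-t) := by
    intro t ht
    have h1 := norm_exp_smul_le B ht
    rw [Complex.norm_exp]
    have h2 : (-(z * t)).re = -(a * t) := by simp [hz]
    rw [h2]
    calc _ ≤ Real.exp (-(a * t)) * (‖(1 : 𝔸)‖ * Real.exp (‖B‖ * t)) := by gcongr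
      _ = ‖(1 : 𝔸)‖ * (Real.exp (-(a * t)) * Real.exp (‖B‖ * t)) := by ring
      _ = _ := by rw [← Real.exp_add]; congr 2; rw [ha]; ring
  have hpe : ∀ n : ℕ, Filter.Tendsto (fun t : ℝ => t ^ n * Real.exp (-t)) Filter.atTop (nhds 0) :=
    Real.tendsto_pow_mul_exp_neg_atTop_nhds_zero
  have hΨl : Filter.Tendsto Ψ Filter.atTop (nhds 0) := by
    have h0 : Filter.Tendsto (fun t : ℝ => ‖(1 : 𝔸)‖ * ((t ^ 2 * Real.exp (-t)) * (‖R‖ / 2)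
        + (t ^ 1 * Real.exp (-t)) * ‖R ^ 2‖ + (t ^ 0 * Real.exp (-t)) * ‖R ^ 3‖))
        Filter.atTop (nhds 0) := by
      simpa using ((((hpe 2).mul_const (‖R‖ / 2)).add ((hpe 1).mul_const ‖R ^ 2‖)).add
        ((hpe 0).mul_const ‖R ^ 3‖)).const_mul ‖(1 : 𝔸)‖
    refine squeeze_zero_norm' ?_ h0
    filter_upwards [Filter.eventually_ge_atTop 0] with t ht
    have h1 : ‖X t‖ ≤ t ^ 2 / 2 * ‖R‖ + t * ‖R ^ 2‖ + ‖R ^ 3‖ := by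
      refine (norm_add₃_le).trans ?_
      rw [norm_smul, norm_smul, Real.norm_of_nonneg ht, Real.norm_of_nonneg (by positivity)]
    calc ‖Ψ t‖ ≤ (‖Complex.exp (-(z * t))‖ * ‖NormedSpace.exp (t • B)‖) * ‖X t‖ := by
          rw [hΨ, norm_smul, mul_assoc]; gcongr; exact norm_mul_le _ _
      _ ≤ (‖(1 : 𝔸)‖ * Real.exp (-t)) * (t ^ 2 / 2 * ‖R‖ + t * ‖R ^ 2‖ + ‖R ^ 3‖) := by
          exact mul_le_mul (hnorm t ht) h1 (norm_nonneg _) (by positivity)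
      _ = _ := by ring
  have hcf : Continuous fun v : ℝ => ((max v 0) ^ 2 / 2 * Real.exp (-(a * v))) •
      NormedSpace.exp (v • B) := by
    have : Continuous fun v : ℝ => NormedSpace.exp (v • B) :=
      (differentiable_exp_smul_const ℝ B).continuous
    fun_prop
  have hexpint : IntegrableOn (fun t : ℝ => t ^ 2 * Real.exp (-t)) (Ioi 0) := by
    have := Real.GammaIntegral_convergent (s := 3) (by norm_num)
    refine this.congr_fun (fun x hx => ?_) measurableSet_Ioi
    simp only
    rw [mul_comm]
    norm_num
  have hint1 : IntegrableOn (fun v : ℝ => ((max v 0) ^ 2 / 2 * Real.exp (-(a * v))) •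
      NormedSpace.exp (v • B)) (Ioi 0) := by
    refine (hexpint.const_mul (‖(1 : 𝔸)‖ / 2)).mono' hcf.aestronglyMeasurable
      ((ae_restrict_mem measurableSet_Ioi).mono fun t ht => ?_)
    have ht0 : 0 ≤ t := le_of_lt ht
    have h1 := norm_exp_smul_le B ht0
    rw [norm_smul, max_eq_left ht0, Real.norm_of_nonneg (by positivity)]
    calc _ ≤ t ^ 2 / 2 * Real.exp (-(a * t)) * (‖(1 : 𝔸)‖ * Real.exp (‖B‖ * t)) := by gcongr
      _ = ‖(1 : 𝔸)‖ / 2 * (t ^ 2 * (Real.exp (-(a * t)) * Real.exp (‖B‖ * t))) := by ring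
      _ = _ := by rw [← Real.exp_add]; congr 3; rw [ha]; ring
  refine ⟨?_, hint1⟩
  have hpt : ∀ v ∈ Ioi (0 : ℝ), Complex.exp (↑(-2 * Real.pi * v * w) * Complex.I) •
      (((max v 0) ^ 2 / 2 * Real.exp (-(a * v))) • NormedSpace.exp (v • B))
      = Complex.exp (-(z * v)) • (NormedSpace.exp (v • B) * algebraMap ℝ 𝔸 (v ^ 2 / 2)) := by
    intro v hv
    rw [max_eq_left (le_of_lt hv), ← Algebra.commutes, ← Algebra.smul_def, mul_smul,
      smul_comm _ (v ^ 2 / 2), smul_comm _ (v ^ 2 / 2), ← Complex.coe_smul (Real.exp _), smul_smul,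
      Complex.ofReal_exp, ← Complex.exp_add]
    congr 3
    rw [hz]
    push_cast
    ring
  have hint2 : IntegrableOn (fun v : ℝ => Complex.exp (-(z * v)) •
      (NormedSpace.exp (v • B) * algebraMap ℝ 𝔸 (v ^ 2 / 2))) (Ioi 0) := by
    refine IntegrableOn.congr_fun (f := fun v : ℝ => Complex.exp (↑(-2 * Real.pi * v * w) * Complex.I) •
      (((max v 0) ^ 2 / 2 * Real.exp (-(a * v))) • NormedSpace.exp (v • B))) ?_ hpt
      measurableSet_Ioi
    refine hint1.norm.mono' ?_ (Filter.Eventually.of_forall fun v => ?_)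
    · exact (Continuous.smul (by fun_prop) hcf).aestronglyMeasurable
    · rw [norm_smul, Complex.norm_exp_ofReal_mul_I, one_mul]
  rw [Real.fourier_real_eq_integral_exp_smul, ← setIntegral_eq_integral_of_forall_compl_eq_zero
    (s := Ioi (0 : ℝ)), setIntegral_congr_fun measurableSet_Ioi hpt]
  · have h := integral_Ioi_of_hasDerivAt_of_tendsto' (a := 0) (fun t _ => hΨd t) hint2.neg hΨl
    rw [integral_neg, zero_sub, neg_inj] at h
    rw [h]
    simp [hΨ, hX]
  · intro v hv
    rw [max_eq_right (not_lt.1 hv)]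
    simp

/-- Inversion of the Laplace transform: a representation of the semigroup by an absolutely
convergent integral over any vertical line in the right half plane. -/
theorem HalfPlaneBound.line_integral_eq_exp {t a : ℝ} (ht : 0 < t) (ha : 0 < a) :
    ∫ y : ℝ, Complex.exp (((a : ℂ) + y * Complex.I) * t) •
        resolvent B ((a : ℂ) + y * Complex.I) ^ 3 = (Real.pi * t ^ 2) • NormedSpace.exp (t • B) := by
  set b : ℝ := ‖B‖ + 1 with hb
  have hb0 : 0 < b := by positivity
  have hshift : ∫ y : ℝ, Complex.exp (((a : ℂ) + y * Complex.I) * t) •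
        resolvent B ((a : ℂ) + y * Complex.I) ^ 3
      = ∫ y : ℝ, Complex.exp (((b : ℂ) + y * Complex.I) * t) •
        resolvent B ((b : ℂ) + y * Complex.I) ^ 3 := by
    rcases le_total a b with h | h
    · exact hB.line_integral_eq ha h
    · exact (hB.line_integral_eq hb0 h).symm
  rw [hshift]
  set f : ℝ → 𝔸 := fun v : ℝ => ((max v 0) ^ 2 / 2 * Real.exp (-(b * v))) •
    NormedSpace.exp (v • B) with hf
  have hcf : Continuous f := by
    have : Continuous fun v : ℝ => NormedSpace.exp (v • B) :=
      (differentiable_exp_smul_const ℝ B).continuous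
    fun_prop
  have hfi : Integrable f := by
    have h := (hB.fourier_exp 0).2
    rw [← integrable_indicator_iff measurableSet_Ioi] at h
    refine h.congr (Filter.Eventually.of_forall fun v => ?_)
    by_cases hv : v ∈ Ioi (0 : ℝ)
    · rw [indicator_of_mem hv]
    · rw [indicator_of_notMem hv]
      simp only [hf]
      rw [max_eq_right (not_lt.1 hv)]
      simp
  have hff : FourierTransform.fourier f = fun w : ℝ => resolvent B ((b : ℂ) + (2 * Real.pi * w : ℝ) * Complex.I) ^ 3 :=
    funext fun w => (hB.fourier_exp w).1
  have hline : Integrable fun y : ℝ => resolvent B ((b : ℂ) + (y : ℝ) * Complex.I) ^ 3 := by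
    simpa using hB.integrable_line 0 hb0
  have hffi : Integrable (FourierTransform.fourier f) := by
    rw [hff]
    exact hline.comp_mul_left' (R := 2 * Real.pi) (by positivity)
  have hinv := congrFun (hcf.fourierInv_fourier_eq hfi hffi) t
  rw [Real.fourierInv_eq', hff] at hinv
  have hsub := Measure.integral_comp_mul_left (fun y : ℝ => Complex.exp (((b : ℂ) + y * Complex.I) * t) •
        resolvent B ((b : ℂ) + y * Complex.I) ^ 3) (2 * Real.pi)
  have hpt : ∀ v : ℝ, Complex.exp (((b : ℂ) + (2 * Real.pi * v : ℝ) * Complex.I) * t) •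
        resolvent B ((b : ℂ) + (2 * Real.pi * v : ℝ) * Complex.I) ^ 3
      = (Real.exp (b * t)) • (Complex.exp (↑(2 * Real.pi * inner ℝ v t) * Complex.I) •
        resolvent B ((b : ℂ) + (2 * Real.pi * v : ℝ) * Complex.I) ^ 3) := by
    intro v
    rw [← Complex.coe_smul (Real.exp _), smul_smul, Complex.ofReal_exp, ← Complex.exp_add]
    congr 2
    simp only [RCLike.inner_apply, conj_trivial]
    push_cast
    ring
  simp only [hpt] at hsub
  rw [integral_smul, hinv] at hsub
  have hpi : |(2 * Real.pi)⁻¹| = (2 * Real.pi)⁻¹ := abs_of_pos (by positivity)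
  rw [hpi] at hsub
  have h2 := congrArg (fun x => (2 * Real.pi) • x) hsub
  simp only [smul_smul] at h2
  rw [mul_inv_cancel₀ (by positivity), one_smul] at h2
  rw [← h2, hf]
  simp only
  rw [max_eq_left ht.le, smul_smul]
  congr 1
  have : Real.exp (b * t) * Real.exp (-(b * t)) = 1 := by rw [← Real.exp_add]; simp
  linear_combination (Real.pi * t ^ 2) * this

end Contour

theorem HalfPlaneBound.exp_eq {c : ℝ} {B : 𝔸} (hB : HalfPlaneBound c B) {t : ℝ} (ht : 0 < t) :
    NormedSpace.exp (t • B) = (Real.pi * t ^ 2)⁻¹ •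
      ∫ y : ℝ, Complex.exp (((t⁻¹ : ℝ) + y * Complex.I) * t) •
        resolvent B ((t⁻¹ : ℝ) + y * Complex.I) ^ 3 := by
  rw [hB.line_integral_eq_exp ht (inv_pos.2 ht), smul_smul, inv_mul_cancel₀ (by positivity),
    one_smul]

theorem HalfPlaneBound.norm_exp_le {c : ℝ} {B : 𝔸} (hB : HalfPlaneBound c B) {t : ℝ} (ht : 0 < t) :
    ‖NormedSpace.exp (t • B)‖ ≤ Real.exp 1 * c ^ 3 := by
  have hc := hB.nonneg
  have h := norm_integral_line_le (f := fun z => resolvent B z ^ 3) (M := c ^ 3 * t) ht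
    fun z hz => by
      have hz0 : 0 < z.re := by rw [hz]; exact inv_pos.2 ht
      refine (hB.norm_pow_three_le hz0).trans ?_
      have h1 : t⁻¹ ≤ ‖z‖ := hz ▸ Complex.re_le_norm z
      have h2 : 0 < ‖z‖ := hz0.trans_le (Complex.re_le_norm z)
      rw [div_le_div_iff₀ (by positivity) (by positivity)]
      have h3 : 1 ≤ t * ‖z‖ := by
        calc (1 : ℝ) = t * t⁻¹ := (mul_inv_cancel₀ ht.ne').symm
          _ ≤ _ := by gcongr
      calc c ^ 3 * ‖z‖ ^ 2 = c ^ 3 * ‖z‖ ^ 2 * 1 := by ring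
        _ ≤ c ^ 3 * ‖z‖ ^ 2 * (t * ‖z‖) := by gcongr
        _ = _ := by ring
  rw [hB.exp_eq ht, norm_smul, Real.norm_of_nonneg (by positivity)]
  refine (mul_le_mul_of_nonneg_left h (by positivity)).trans (le_of_eq ?_)
  field_simp

theorem HalfPlaneBound.norm_mul_exp_le {c : ℝ} {B : 𝔸} (hB : HalfPlaneBound c B) {t : ℝ}
    (ht : 0 < t) : ‖B * NormedSpace.exp (t • B)‖ ≤ Real.exp 1 * (c ^ 3 + c ^ 2) / t := by
  have hc := hB.nonneg
  have h := norm_integral_line_le (f := fun z => B * resolvent B z ^ 3) (M := c ^ 3 + c ^ 2) ht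
    fun z hz => by
      have hz0 : 0 < z.re := by rw [hz]; exact inv_pos.2 ht
      have h2 : 0 < ‖z‖ := hz0.trans_le (Complex.re_le_norm z)
      have h3 : B * resolvent B z ^ 3 = z • resolvent B z ^ 3 - resolvent B z ^ 2 := by
        rw [pow_succ' _ 2, ← mul_assoc, self_mul_resolvent (hB z hz0).1, sub_mul, one_mul,
          smul_mul_assoc]
      simp only [h3]
      refine (norm_sub_le _ _).trans ?_
      have h4 : ‖resolvent B z ^ 2‖ ≤ c ^ 2 / ‖z‖ ^ 2 := by
        rw [← div_pow]
        exact (norm_pow_le' _ (by norm_num)).trans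
          (pow_le_pow_left₀ (norm_nonneg _) (hB z hz0).2 _)
      rw [norm_smul, add_div]
      refine add_le_add ((mul_le_mul_of_nonneg_left (hB.norm_pow_three_le hz0)
        (norm_nonneg z)).trans (le_of_eq ?_)) h4
      field_simp
  have h5 : B * NormedSpace.exp (t • B) = (Real.pi * t ^ 2)⁻¹ •
      ∫ y : ℝ, Complex.exp (((t⁻¹ : ℝ) + y * Complex.I) * t) •
        (B * resolvent B ((t⁻¹ : ℝ) + y * Complex.I) ^ 3) := by
    rw [hB.exp_eq ht, mul_smul_comm]
    congr 1
    have := (ContinuousLinearMap.mul ℝ 𝔸 B).integral_comp_comm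
      (hB.integrable_line t (inv_pos.2 ht))
    simp only [ContinuousLinearMap.mul_apply', mul_smul_comm] at this
    exact this.symm
  rw [h5, norm_smul, Real.norm_of_nonneg (by positivity)]
  refine (mul_le_mul_of_nonneg_left h (by positivity)).trans (le_of_eq ?_)
  field_simp

theorem HalfPlaneBound.norm_exp_sub_exp_le {c ε : ℝ} {B₁ B₂ : 𝔸} (h₁ : HalfPlaneBound c B₁)
    (h₂ : HalfPlaneBound c B₂)
    (hε : ∀ z : ℂ, 0 < z.re → ‖resolvent B₁ z - resolvent B₂ z‖ ≤ ε) {t : ℝ} (ht : 0 < t) :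
    ‖NormedSpace.exp (t • B₁) - NormedSpace.exp (t • B₂)‖ ≤ Real.exp 1 * (3 * c ^ 2) * ε / t := by
  have hc := h₁.nonneg
  have h := norm_integral_line_le (f := fun z => resolvent B₁ z ^ 3 - resolvent B₂ z ^ 3)
    (M := 3 * c ^ 2 * ε) ht fun z hz => by
      have hz0 : 0 < z.re := by rw [hz]; exact inv_pos.2 ht
      have hz1 : 0 < ‖z‖ := hz0.trans_le (Complex.re_le_norm z)
      have e1 := (h₁ z hz0).2
      have e2 := (h₂ z hz0).2
      have e3 := hε z hz0
      set R₁ := resolvent B₁ z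
      set R₂ := resolvent B₂ z
      have hq : 0 ≤ c / ‖z‖ := by positivity
      have h3 : R₁ ^ 3 - R₂ ^ 3
          = R₁ * R₁ * (R₁ - R₂) + R₁ * (R₁ - R₂) * R₂ + (R₁ - R₂) * R₂ * R₂ := by noncomm_ring
      simp only [h3]
      have n3 : ∀ x y w : 𝔸, ‖x * y * w‖ ≤ ‖x‖ * ‖y‖ * ‖w‖ := fun x y w =>
        (norm_mul_le _ _).trans (by gcongr; exact norm_mul_le _ _)
      calc _ ≤ ‖R₁‖ * ‖R₁‖ * ‖R₁ - R₂‖ + ‖R₁‖ * ‖R₁ - R₂‖ * ‖R₂‖ + ‖R₁ - R₂‖ * ‖R₂‖ * ‖R₂‖ :=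
            norm_add₃_le.trans (add_le_add (add_le_add (n3 _ _ _) (n3 _ _ _)) (n3 _ _ _))
        _ ≤ c / ‖z‖ * (c / ‖z‖) * ε + c / ‖z‖ * ε * (c / ‖z‖) + ε * (c / ‖z‖) * (c / ‖z‖) := by
            have := (norm_nonneg _).trans e3
            gcongr
        _ = _ := by field_simp; ring
  rw [h₁.exp_eq ht, h₂.exp_eq ht, ← smul_sub, ← integral_sub
    (h₁.integrable_line t (inv_pos.2 ht)) (h₂.integrable_line t (inv_pos.2 ht)), norm_smul,
    Real.norm_of_nonneg (by positivity)]
  simp only [smul_sub] at h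
  refine (mul_le_mul_of_nonneg_left h (by positivity)).trans (le_of_eq ?_)
  field_simp

theorem commute_exp_smul (B : 𝔸) (t : ℝ) : B * NormedSpace.exp (t • B) = NormedSpace.exp (t • B) * B :=
  ((Commute.refl B).smul_right t).exp_right.eq

theorem exp_half_mul_exp_half (B : 𝔸) (t : ℝ) :
    NormedSpace.exp ((t / 2) • B) * NormedSpace.exp ((t / 2) • B) = NormedSpace.exp (t • B) := by
  let _ : NormedAlgebra ℚ 𝔸 := NormedAlgebra.restrictScalars ℚ ℂ 𝔸
  rw [← NormedSpace.exp_add_of_commute (Commute.refl _), ← add_smul, add_halves]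

/-- The estimates of the semigroup `exp (t B)` that depend only on the constant in the resolvent
estimate; the last ones compare two generators whose inverses differ by a multiple of `1`. -/
theorem exists_exp_bounds (𝔸 : Type*) [NormedRing 𝔸] [NormedAlgebra ℂ 𝔸] [CompleteSpace 𝔸]
    (h1 : ‖(1 : 𝔸)‖ ≤ 1) (c : ℝ) : ∃ M : ℝ, 1 ≤ M ∧
    (∀ B : 𝔸, HalfPlaneBound c B → ∀ t : ℝ, 0 < t →
      ‖NormedSpace.exp (t • B)‖ ≤ M ∧ ‖B * NormedSpace.exp (t • B)‖ ≤ M / t) ∧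
    (∀ B₁ B₂ C₁ C₂ : 𝔸, HalfPlaneBound c B₁ → HalfPlaneBound c B₂ → C₁ * B₁ = 1 → B₁ * C₁ = 1 →
      C₂ * B₂ = 1 → B₂ * C₂ = 1 → ∀ δ : ℝ, C₁ - C₂ = δ • (1 : 𝔸) → ∀ t : ℝ, 0 < t →
      ‖B₁ * NormedSpace.exp (t • B₁) - B₂ * NormedSpace.exp (t • B₂)‖ ≤ M * |δ| / t ^ 2 ∧
      ‖B₁ * (B₁ * NormedSpace.exp (t • B₁)) - B₂ * (B₂ * NormedSpace.exp (t • B₂))‖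
        ≤ M * |δ| / t ^ 3) := by
  by_cases hc : 0 ≤ c
  swap
  · exact ⟨1, le_rfl, fun B hB => absurd hB.nonneg hc, fun B₁ _ _ _ hB => absurd hB.nonneg hc⟩
  set N : ℝ := Real.exp 1 * (c ^ 3 + c ^ 2) + Real.exp 1 * (3 * c ^ 2) * (1 + c) ^ 2 + 1 with hN
  have hN1 : 1 ≤ N := by
    rw [hN]
    have h1 : 0 ≤ Real.exp 1 * (c ^ 3 + c ^ 2) := by positivity
    have h2 : 0 ≤ Real.exp 1 * (3 * c ^ 2) * (1 + c) ^ 2 := by positivity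
    linarith
  have hN0 : 0 ≤ N := by linarith
  have hb1 : ∀ B : 𝔸, HalfPlaneBound c B → ∀ t : ℝ, 0 < t →
      ‖NormedSpace.exp (t • B)‖ ≤ N ∧ ‖B * NormedSpace.exp (t • B)‖ ≤ N / t := by
    intro B hB t ht
    refine ⟨(hB.norm_exp_le ht).trans ?_, (hB.norm_mul_exp_le ht).trans ?_⟩
    · rw [hN]
      have h1 : 0 ≤ Real.exp 1 * c ^ 2 := by positivity
      have h2 : 0 ≤ Real.exp 1 * (3 * c ^ 2) * (1 + c) ^ 2 := by positivity
      linarith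
    · gcongr
      rw [hN]; linarith [show 0 ≤ Real.exp 1 * (3 * c ^ 2) * (1 + c) ^ 2 by positivity]
  have hb2 : ∀ B₁ B₂ C₁ C₂ : 𝔸, HalfPlaneBound c B₁ → HalfPlaneBound c B₂ → C₁ * B₁ = 1 →
      B₁ * C₁ = 1 → C₂ * B₂ = 1 → B₂ * C₂ = 1 → ∀ δ : ℝ, C₁ - C₂ = δ • (1 : 𝔸) → ∀ t : ℝ, 0 < t →
      ‖B₁ * NormedSpace.exp (t • B₁) - B₂ * NormedSpace.exp (t • B₂)‖
        ≤ 12 * N ^ 2 * |δ| / t ^ 2 := by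
    intro B₁ B₂ C₁ C₂ h₁ h₂ hc1 hc1' hc2 hc2' δ hδ t ht
    -- `B₁ - B₂ = - δ B₁ B₂`, so that the difference of the resolvents is `O(δ)`
    have hBB : B₁ - B₂ = (-δ) • (B₁ * B₂) := by
      have : B₁ * (C₁ - C₂) * B₂ = B₂ - B₁ := by
        rw [mul_sub, sub_mul, hc1', one_mul, mul_assoc, hc2, mul_one]
      rw [hδ, mul_smul_comm, mul_one, smul_mul_assoc] at this
      rw [neg_smul, this]; abel
    have hres : ∀ z : ℂ, 0 < z.re → ‖resolvent B₁ z - resolvent B₂ z‖ ≤ (1 + c) ^ 2 * |δ| := by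
      intro z hz
      have hz1 : 0 < ‖z‖ := hz.trans_le (Complex.re_le_norm z)
      have m1 := (h₁ z hz).1
      have m2 := (h₂ z hz).1
      have e : resolvent B₁ z - resolvent B₂ z
          = (-δ) • ((resolvent B₁ z * B₁) * (B₂ * resolvent B₂ z)) := by
        have : resolvent B₁ z - resolvent B₂ z = resolvent B₁ z * (B₁ - B₂) * resolvent B₂ z := by
          have : B₁ - B₂ = (algebraMap ℂ 𝔸 z - B₂) - (algebraMap ℂ 𝔸 z - B₁) := by abel
          rw [this, mul_sub, sub_mul, mul_assoc, self_sub_mul_resolvent m2,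
            resolvent_mul_self_sub m1, mul_one, one_mul]
        rw [this, hBB, mul_smul_comm, smul_mul_assoc]
        simp only [mul_assoc]
      have n1 : ∀ R : 𝔸, ‖R‖ ≤ c / ‖z‖ → ‖z • R - 1‖ ≤ 1 + c := by
        intro R hR
        calc ‖z • R - 1‖ ≤ ‖z‖ * ‖R‖ + ‖(1 : 𝔸)‖ := by rw [← norm_smul]; exact norm_sub_le _ _
          _ ≤ ‖z‖ * (c / ‖z‖) + 1 := by gcongr
          _ = 1 + c := by field_simp; ring
      rw [e, resolvent_mul_self m1, self_mul_resolvent m2, norm_smul, norm_neg, Real.norm_eq_abs,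
        mul_comm, pow_two]
      gcongr
      refine (norm_mul_le _ _).trans ?_
      exact mul_le_mul (n1 _ (h₁ z hz).2) (n1 _ (h₂ z hz).2) (norm_nonneg _) (by positivity)
    have ht2 : 0 < t / 2 := by positivity
    obtain ⟨a1, b1⟩ := hb1 B₁ h₁ _ ht2
    obtain ⟨a2, b2⟩ := hb1 B₂ h₂ _ ht2
    have d := h₁.norm_exp_sub_exp_le h₂ hres ht2
    have d' : ‖NormedSpace.exp ((t / 2) • B₁) - NormedSpace.exp ((t / 2) • B₂)‖
        ≤ N * |δ| / (t / 2) := by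
      refine d.trans ?_
      rw [← mul_assoc]
      gcongr
      rw [hN]; linarith [show 0 ≤ Real.exp 1 * (c ^ 3 + c ^ 2) by positivity]
    rw [← exp_half_mul_exp_half B₁ t, ← exp_half_mul_exp_half B₂ t]
    set E₁ := NormedSpace.exp ((t / 2) • B₁)
    set E₂ := NormedSpace.exp ((t / 2) • B₂)
    have c1 : B₁ * E₁ = E₁ * B₁ := commute_exp_smul _ _
    have e : B₁ * (E₁ * E₁) - B₂ * (E₂ * E₂)
        = (B₁ * E₁) * (E₁ - E₂) + (-δ) • ((B₁ * E₁) * (B₂ * E₂)) + (E₁ - E₂) * (B₂ * E₂) := by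
      have h2 : (-δ) • ((B₁ * E₁) * (B₂ * E₂)) = E₁ * (B₁ - B₂) * E₂ := by
        rw [hBB, c1, mul_smul_comm, smul_mul_assoc]
        simp only [mul_assoc]
      have h3 : B₂ * E₂ = E₂ * B₂ := commute_exp_smul _ _
      rw [h2]
      calc B₁ * (E₁ * E₁) - B₂ * (E₂ * E₂)
          = B₁ * E₁ * E₁ - (B₁ * E₁) * E₂ + E₁ * B₁ * E₂ - E₂ * B₂ * E₂ := by
            rw [← c1, ← h3]; noncomm_ring
        _ = _ := by noncomm_ring
    rw [e]
    calc _ ≤ ‖B₁ * E₁‖ * ‖E₁ - E₂‖ + |δ| * (‖B₁ * E₁‖ * ‖B₂ * E₂‖) + ‖E₁ - E₂‖ * ‖B₂ * E₂‖ := by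
          refine norm_add₃_le.trans (add_le_add (add_le_add (norm_mul_le _ _) ?_) (norm_mul_le _ _))
          rw [norm_smul, norm_neg, Real.norm_eq_abs]
          gcongr
          exact norm_mul_le _ _
      _ ≤ N / (t / 2) * (N * |δ| / (t / 2)) + |δ| * (N / (t / 2) * (N / (t / 2)))
          + N * |δ| / (t / 2) * (N / (t / 2)) := by gcongr
      _ = _ := by field_simp; ring
  refine ⟨200 * N ^ 3, ?_, ?_, ?_⟩
  · have := one_le_pow₀ hN1 (n := 3); linarith
  · intro B hB t ht
    have h3 : N ≤ 200 * N ^ 3 := by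
      have := le_self_pow₀ hN1 (n := 3) (by norm_num); linarith [pow_nonneg hN0 3]
    obtain ⟨a, b⟩ := hb1 B hB t ht
    exact ⟨a.trans h3, b.trans (by gcongr)⟩
  · intro B₁ B₂ C₁ C₂ h₁ h₂ hc1 hc1' hc2 hc2' δ hδ t ht
    constructor
    · refine (hb2 B₁ B₂ C₁ C₂ h₁ h₂ hc1 hc1' hc2 hc2' δ hδ t ht).trans ?_
      gcongr ?_ * _ / _
      have : N ^ 2 ≤ N ^ 3 := pow_le_pow_right₀ hN1 (by norm_num)
      linarith [pow_nonneg hN0 3]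
    · have ht2 : 0 < t / 2 := by positivity
      have d := hb2 B₁ B₂ C₁ C₂ h₁ h₂ hc1 hc1' hc2 hc2' δ hδ _ ht2
      obtain ⟨-, b1⟩ := hb1 B₁ h₁ _ ht2
      obtain ⟨-, b2⟩ := hb1 B₂ h₂ _ ht2
      rw [← exp_half_mul_exp_half B₁ t, ← exp_half_mul_exp_half B₂ t]
      have c1 := commute_exp_smul B₁ (t / 2)
      have c2 := commute_exp_smul B₂ (t / 2)
      set E₁ := NormedSpace.exp ((t / 2) • B₁)
      set E₂ := NormedSpace.exp ((t / 2) • B₂)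
      have e : B₁ * (B₁ * (E₁ * E₁)) - B₂ * (B₂ * (E₂ * E₂))
          = (B₁ * E₁) * (B₁ * E₁ - B₂ * E₂) + (B₁ * E₁ - B₂ * E₂) * (B₂ * E₂) := by
        have e1 : B₁ * (B₁ * (E₁ * E₁)) = (B₁ * E₁) * (B₁ * E₁) := by
          rw [← mul_assoc B₁ E₁ E₁, c1, mul_assoc, ← mul_assoc B₁ E₁, c1, mul_assoc]
        have e2 : B₂ * (B₂ * (E₂ * E₂)) = (B₂ * E₂) * (B₂ * E₂) := by
          rw [← mul_assoc B₂ E₂ E₂, c2, mul_assoc, ← mul_assoc B₂ E₂, c2, mul_assoc]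
        rw [e1, e2]; noncomm_ring
      rw [e]
      calc _ ≤ ‖B₁ * E₁‖ * ‖B₁ * E₁ - B₂ * E₂‖ + ‖B₁ * E₁ - B₂ * E₂‖ * ‖B₂ * E₂‖ :=
            (norm_add_le _ _).trans (add_le_add (norm_mul_le _ _) (norm_mul_le _ _))
        _ ≤ N / (t / 2) * (12 * N ^ 2 * |δ| / (t / 2) ^ 2)
            + 12 * N ^ 2 * |δ| / (t / 2) ^ 2 * (N / (t / 2)) := by gcongr
        _ = 192 * N ^ 3 * |δ| / t ^ 3 := by field_simp; ring
        _ ≤ _ := by gcongr; norm_num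

end ExpEstimates

/-! ### Evolution systems of bounded generators -/

/-- Linear differential equations with continuous coefficients have global solutions. -/
theorem exists_linear_ode {E : Type*} [NormedAddCommGroup E] [NormedSpace ℝ E] [CompleteSpace E]
    {T : ℝ} (hT : 0 ≤ T) {Λ : ℝ → E →L[ℝ] E} (hΛ : ContinuousOn Λ (Icc 0 T)) (x : E) :
    ∃ X : ℝ → E, X 0 = x ∧ ∀ t ∈ Icc 0 T, HasDerivAt X (Λ t (X t)) t := by
  set Γ : ℝ → E →L[ℝ] E := fun t => Λ (projIcc 0 T hT t) with hΓ
  have hΓc : Continuous Γ :=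
    (continuousOn_iff_continuous_domRestrict.1 hΛ).comp continuous_projIcc
  have hΓe : ∀ t ∈ Icc 0 T, Γ t = Λ t := fun t ht => by simp [hΓ, projIcc_of_mem hT ht]
  obtain ⟨L, hL⟩ := isCompact_Icc.exists_bound_of_continuousOn hΛ
  have hL0 : 0 ≤ L := (norm_nonneg _).trans (hL 0 ⟨le_rfl, hT⟩)
  have hbd : ∀ t, ‖Γ t‖ ≤ L := fun t => hL _ (projIcc 0 T hT t).2
  have hc : ∀ u : ℝ → E, Continuous u → Continuous fun t => Γ t (u t) := fun u hu => hΓc.clm_apply hu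
  have hd : ∀ u : ℝ → E, Continuous u → ∀ t,
      HasDerivAt (fun t => x + ∫ s in (0 : ℝ)..t, Γ s (u s)) (Γ t (u t)) t := fun u hu t => by
    have := (intervalIntegral.integral_hasDerivAt_right ((hc u hu).intervalIntegrable 0 t)
      ((hc u hu).stronglyMeasurableAtFilter _ _) (hc u hu).continuousAt)
    exact this.const_add x
  obtain ⟨u, hu, hfix⟩ := exists_volterra_fixedPoint hT hL0
    (fun (u : ℝ → E) t => x + ∫ s in (0 : ℝ)..t, Γ s (u s))
    (fun u hu => (continuous_iff_continuousAt.2 fun t => (hd u hu t).continuousAt).continuousOn)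
    (fun u v hu hv t ht => by
      rw [add_sub_add_left_eq_sub, ← intervalIntegral.integral_sub
        ((hc u hu).intervalIntegrable _ _) ((hc v hv).intervalIntegrable _ _),
        ← intervalIntegral.integral_const_mul]
      refine intervalIntegral.norm_integral_le_of_norm_le ht.1
        (Filter.Eventually.of_forall fun s _ => ?_)
        ((hu.sub hv).norm.const_smul L |>.intervalIntegrable _ _)
      rw [← map_sub]
      exact (Γ s).le_of_opNorm_le (hbd s) _)
  refine ⟨fun t => x + ∫ s in (0 : ℝ)..t, Γ s (u s), by simp, fun t ht => ?_⟩
  have h := hd u hu t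
  have e := hfix t ht
  rw [hΓe t ht] at h
  exact h.congr_deriv (congrArg (Λ t) e)

section BoundedFamily

variable {𝔸 : Type*} [NormedRing 𝔸] [NormedAlgebra ℂ 𝔸] [CompleteSpace 𝔸]

/-- `U` is the evolution system of the bounded generators `B t`. -/
structure IsFlow (T : ℝ) (B : ℝ → 𝔸) (U : ℝ → ℝ → 𝔸) : Prop where
  refl : ∀ s ∈ Icc 0 T, U s s = 1
  comp : ∀ s ∈ Icc 0 T, ∀ r ∈ Icc 0 T, ∀ t ∈ Icc 0 T, U t r * U r s = U t s
  deriv_fst : ∀ s ∈ Icc 0 T, ∀ t ∈ Icc 0 T, HasDerivAt (fun r => U r s) (B t * U t s) t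
  deriv_snd : ∀ s ∈ Icc 0 T, ∀ t ∈ Icc 0 T, HasDerivAt (fun r => U t r) (-(U t s * B s)) s

theorem exists_isFlow {T : ℝ} (hT : 0 ≤ T) {B : ℝ → 𝔸} (hB : ContinuousOn B (Icc 0 T)) :
    ∃ U, IsFlow T B U := by
  have hc1 : ContinuousOn (fun t => ContinuousLinearMap.mul ℝ 𝔸 (B t)) (Icc 0 T) :=
    (ContinuousLinearMap.mul ℝ 𝔸).continuous.comp_continuousOn hB
  have hc2 : ContinuousOn (fun t => -((ContinuousLinearMap.mul ℝ 𝔸).flip (B t))) (Icc 0 T) :=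
    ((ContinuousLinearMap.mul ℝ 𝔸).flip.continuous.comp_continuousOn hB).neg
  obtain ⟨X, hX0, hX⟩ := exists_linear_ode hT hc1 (1 : 𝔸)
  obtain ⟨Y, hY0, hY⟩ := exists_linear_ode hT hc2 (1 : 𝔸)
  simp only [ContinuousLinearMap.mul_apply', neg_apply, ContinuousLinearMap.flip_apply] at hX hY
  have hYX : ∀ t ∈ Icc 0 T, Y t * X t = 1 := by
    intro t ht
    have := constant_of_has_deriv_right_zero (f := fun t => Y t * X t) (a := 0) (b := T)
      (fun t ht => ((hY t ht).mul (hX t ht)).continuousAt.continuousWithinAt)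
      (fun t ht => by
        have := ((hY t ⟨ht.1, ht.2.le⟩).mul (hX t ⟨ht.1, ht.2.le⟩)).hasDerivWithinAt (s := Ici t)
        refine this.congr_deriv ?_
        noncomm_ring) t ht
    rw [this, hX0, hY0, mul_one]
  -- `X Y` solves the linear equation `Z' = B Z - Z B`, as does the constant `1`
  have hXY : ∀ t ∈ Icc 0 T, X t * Y t = 1 := by
    obtain ⟨L, hL⟩ := isCompact_Icc.exists_bound_of_continuousOn hB
    intro t ht
    have hd : ∀ t ∈ Icc 0 T, HasDerivAt (fun t => X t * Y t - 1)
        (B t * (X t * Y t - 1) - (X t * Y t - 1) * B t) t := fun t ht => by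
      refine (((hX t ht).mul (hY t ht)).sub_const 1).congr_deriv ?_
      noncomm_ring
    have := norm_le_gronwallBound_of_norm_deriv_right_le (f := fun t => X t * Y t - 1)
      (f' := fun t => B t * (X t * Y t - 1) - (X t * Y t - 1) * B t) (δ := 0) (K := 2 * L) (ε := 0)
      (a := 0) (b := T) (fun t ht => (hd t ht).continuousAt.continuousWithinAt)
      (fun t ht => (hd t ⟨ht.1, ht.2.le⟩).hasDerivWithinAt) (by simp [hX0, hY0])
      (fun t ht => by
        have hl := hL t ⟨ht.1, ht.2.le⟩
        calc _ ≤ ‖B t‖ * ‖X t * Y t - 1‖ + ‖X t * Y t - 1‖ * ‖B t‖ :=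
              (norm_sub_le _ _).trans (add_le_add (norm_mul_le _ _) (norm_mul_le _ _))
          _ ≤ L * ‖X t * Y t - 1‖ + ‖X t * Y t - 1‖ * L := by gcongr
          _ = _ := by ring) t ht
    rw [gronwallBound_ε0_δ0] at this
    exact sub_eq_zero.1 (norm_le_zero_iff.1 this)
  refine ⟨fun t s => X t * Y s, fun s hs => hXY s hs, fun s _ r hr t _ => ?_, fun s _ t ht => ?_,
    fun s hs t _ => ?_⟩
  · calc X t * Y r * (X r * Y s) = X t * (Y r * X r) * Y s := by noncomm_ring
      _ = _ := by rw [hYX r hr, mul_one]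
  · simpa [mul_assoc] using (hX t ht).mul_const (Y s)
  · simpa [mul_assoc] using (hY s hs).const_mul (X t)

/-- A family of bounded operators `B t` with inverses `C t`, with bounds of the kind assumed of
the unbounded generators. All estimates below depend only on `T`, `c` and `K`, so that they apply
uniformly to approximations of unbounded generators. -/
structure ParabolicFamily (T c K : ℝ) (B C : ℝ → 𝔸) : Prop where
  norm_one_le : ‖(1 : 𝔸)‖ ≤ 1
  halfPlane : ∀ t ∈ Icc 0 T, HalfPlaneBound c (B t)
  mul_inv : ∀ t ∈ Icc 0 T, B t * C t = 1
  inv_mul : ∀ t ∈ Icc 0 T, C t * B t = 1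
  lip : ∀ t ∈ Icc 0 T, ∀ s ∈ Icc 0 T, ‖B t * C s - 1‖ ≤ K * |t - s|
  norm_inv_le : ∀ t ∈ Icc 0 T, ‖C t‖ ≤ K

namespace ParabolicFamily

variable {T c K : ℝ} {B C : ℝ → 𝔸} (hP : ParabolicFamily T c K B C)
include hP

theorem sub_eq {s t : ℝ} (hs : s ∈ Icc 0 T) : B t - B s = (B t * C s - 1) * B s := by
  rw [sub_mul, mul_assoc, hP.inv_mul s hs, mul_one, one_mul]

theorem continuousOn : ContinuousOn B (Icc 0 T) := by
  intro s hs
  rw [ContinuousWithinAt, tendsto_iff_norm_sub_tendsto_zero]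
  have h0 : Filter.Tendsto (fun t => K * |t - s| * ‖B s‖) (nhdsWithin s (Icc 0 T)) (nhds 0) := by
    have : Continuous fun t => K * |t - s| * ‖B s‖ := by fun_prop
    simpa using (this.tendsto s).mono_left nhdsWithin_le_nhds
  refine squeeze_zero' (Filter.Eventually.of_forall fun _ => norm_nonneg _) ?_ h0
  filter_upwards [self_mem_nhdsWithin] with t ht
  rw [hP.sub_eq hs]
  exact (norm_mul_le _ _).trans (by gcongr; exact hP.lip t ht s hs)

theorem nonneg (hT : 0 ≤ T) : 0 ≤ K :=
  (norm_nonneg _).trans (hP.norm_inv_le 0 ⟨le_rfl, hT⟩)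

theorem norm_mul_inv_le {s t : ℝ} (hs : s ∈ Icc 0 T) (ht : t ∈ Icc 0 T) :
    ‖B t * C s‖ ≤ 1 + K * T := by
  have hK := hP.nonneg (hs.1.trans hs.2)
  have h1 := hP.lip t ht s hs
  have h2 : |t - s| ≤ T := abs_le.2 ⟨by linarith [ht.1, hs.2], by linarith [ht.2, hs.1]⟩
  calc ‖B t * C s‖ = ‖1 + (B t * C s - 1)‖ := by congr 1; abel
    _ ≤ ‖(1 : 𝔸)‖ + ‖B t * C s - 1‖ := norm_add_le _ _
    _ ≤ 1 + K * T := by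
      gcongr
      · exact hP.norm_one_le
      · exact h1.trans (by gcongr)

end ParabolicFamily

theorem hasDerivAt_exp_sub_smul (B : 𝔸) (t x : ℝ) :
    HasDerivAt (fun τ : ℝ => NormedSpace.exp ((t - τ) • B)) (-(NormedSpace.exp ((t - x) • B) * B)) x := by
  have h := (hasDerivAt_exp_smul_const (𝕂 := ℝ) B (t - x)).scomp x ((hasDerivAt_id x).const_sub t)
  simpa [Function.comp_def] using h

theorem hasDerivAt_exp_smul_sub (B : 𝔸) (s x : ℝ) :
    HasDerivAt (fun τ : ℝ => NormedSpace.exp ((τ - s) • B)) (B * NormedSpace.exp ((x - s) • B)) x := by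
  have h := (hasDerivAt_exp_smul_const' (𝕂 := ℝ) B (x - s)).scomp x ((hasDerivAt_id x).sub_const s)
  simpa [Function.comp_def] using h

theorem le_mul_rpow_of_le_of_le {x P y p : ℝ} (hP : 0 ≤ P) (hy : 0 ≤ y) (hp : 0 ≤ p) (hp1 : p ≤ 1)
    (h1 : x ≤ P) (h2 : x ≤ P * y) : x ≤ P * y ^ p := by
  rcases le_total y 1 with h | h
  · rcases hy.eq_or_lt with rfl | hy0
    · exact h2.trans (by rw [mul_zero]; positivity)
    · refine h2.trans (mul_le_mul_of_nonneg_left ?_ hP)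
      simpa using Real.rpow_le_rpow_of_exponent_ge hy0 h hp1
  · exact h1.trans (le_mul_of_one_le_right hP (Real.one_le_rpow h hp))


theorem IsFlow.continuousOn_fst {T : ℝ} {B : ℝ → 𝔸} {U : ℝ → ℝ → 𝔸} (hU : IsFlow T B U) {s : ℝ}
    (hs : s ∈ Icc 0 T) : ContinuousOn (fun τ => U τ s) (Icc 0 T) := fun t ht =>
  (hU.deriv_fst s hs t ht).continuousAt.continuousWithinAt

theorem IsFlow.continuousOn_snd {T : ℝ} {B : ℝ → 𝔸} {U : ℝ → ℝ → 𝔸} (hU : IsFlow T B U) {t : ℝ}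
    (ht : t ∈ Icc 0 T) : ContinuousOn (fun τ => U t τ) (Icc 0 T) := fun s hs =>
  (hU.deriv_snd s hs t ht).continuousAt.continuousWithinAt

theorem continuous_exp_smul (B : 𝔸) : Continuous fun v : ℝ => NormedSpace.exp (v • B) :=
  (differentiable_exp_smul_const ℝ B).continuous

namespace ParabolicFamily

variable {T c K M : ℝ} {B C : ℝ → 𝔸} {U : ℝ → ℝ → 𝔸}

/-- Variation of constants, with the generator frozen at the initial time. -/
theorem duhamel_right (hP : ParabolicFamily T c K B C) (hU : IsFlow T B U) {s t : ℝ} (hs : 0 ≤ s)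
    (hst : s ≤ t) (ht : t ≤ T) :
    U t s = NormedSpace.exp ((t - s) • B s)
      + ∫ τ in s..t, U t τ * ((B τ - B s) * NormedSpace.exp ((τ - s) • B s)) := by
  have hsub : Icc s t ⊆ Icc 0 T := Icc_subset_Icc hs ht
  have hsm : s ∈ Icc 0 T := ⟨hs, hst.trans ht⟩
  have htm : t ∈ Icc 0 T := ⟨hs.trans hst, ht⟩
  have hd : ∀ τ ∈ uIcc s t, HasDerivAt (fun τ => U t τ * NormedSpace.exp ((τ - s) • B s))
      (-(U t τ * ((B τ - B s) * NormedSpace.exp ((τ - s) • B s)))) τ := by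
    intro τ hτ
    rw [uIcc_of_le hst] at hτ
    refine ((hU.deriv_snd τ (hsub hτ) t htm).mul (hasDerivAt_exp_smul_sub (B s) s τ)).congr_deriv ?_
    noncomm_ring
  have hc : ContinuousOn (fun τ => U t τ * ((B τ - B s) * NormedSpace.exp ((τ - s) • B s)))
      (Icc s t) :=
    ((hU.continuousOn_snd htm).mono hsub).mul (((hP.continuousOn.mono hsub).sub continuousOn_const).mul
      ((continuous_exp_smul (B s)).comp (continuous_id.sub continuous_const)).continuousOn)
  have h := intervalIntegral.integral_eq_sub_of_hasDerivAt hd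
    (hc.neg.intervalIntegrable_of_Icc hst)
  rw [intervalIntegral.integral_neg, hU.refl t htm, sub_self, zero_smul, NormedSpace.exp_zero,
    mul_one, one_mul] at h
  rw [neg_eq_iff_eq_neg] at h
  rw [h]
  abel

theorem continuousOn_left_integrand (hP : ParabolicFamily T c K B C) (hU : IsFlow T B U)
    {s m t : ℝ} (hs : s ∈ Icc 0 T) (hm : 0 ≤ m) (ht : t ≤ T) (X : 𝔸) :
    ContinuousOn (fun τ => (B t * NormedSpace.exp ((t - τ) • B t) * (1 - B t * C τ)) *
      (B τ * (U τ s * X))) (Icc m t) := by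
  have hsub : Icc m t ⊆ Icc 0 T := Icc_subset_Icc hm ht
  have hCc : ContinuousOn (fun τ => (1 - B t * C τ) * (B τ * (U τ s * X))) (Icc m t) := by
    have : ContinuousOn (fun τ => (B τ - B t) * (U τ s * X)) (Icc m t) :=
      ((hP.continuousOn.mono hsub).sub continuousOn_const).mul
        (((hU.continuousOn_fst hs).mono hsub).mul continuousOn_const)
    refine this.congr fun τ hτ => ?_
    have h1 : (1 - B t * C τ) * B τ = B τ - B t := by
      rw [sub_mul, one_mul, mul_assoc, hP.inv_mul τ (hsub hτ), mul_one]
    rw [← mul_assoc, h1]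
  have hE : Continuous fun τ => B t * NormedSpace.exp ((t - τ) • B t) :=
    continuous_const.mul ((continuous_exp_smul (B t)).comp (continuous_const.sub continuous_id))
  exact (hE.continuousOn.mul hCc).congr fun τ _ => mul_assoc _ _ _

/-- Variation of constants, with the generator frozen at the final time. -/
theorem duhamel_left (hP : ParabolicFamily T c K B C) (hU : IsFlow T B U) {s m t : ℝ}
    (hs : s ∈ Icc 0 T) (hm : 0 ≤ m) (hmt : m ≤ t) (ht : t ≤ T) (X : 𝔸) :
    B t * (U t s * X) = B t * (NormedSpace.exp ((t - m) • B t) * (U m s * X))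
      + ∫ τ in m..t, (B t * NormedSpace.exp ((t - τ) • B t) * (1 - B t * C τ)) *
        (B τ * (U τ s * X)) := by
  have hsub : Icc m t ⊆ Icc 0 T := Icc_subset_Icc hm ht
  have htm : t ∈ Icc 0 T := ⟨hm.trans hmt, ht⟩
  have hd : ∀ τ ∈ uIcc m t, HasDerivAt
      (fun τ => B t * (NormedSpace.exp ((t - τ) • B t) * (U τ s * X)))
      ((B t * NormedSpace.exp ((t - τ) • B t) * (1 - B t * C τ)) * (B τ * (U τ s * X))) τ := by
    intro τ hτ
    rw [uIcc_of_le hmt] at hτ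
    refine (((hasDerivAt_exp_sub_smul (B t) t τ).mul
      ((hU.deriv_fst s hs τ (hsub hτ)).mul_const X)).const_mul (B t)).congr_deriv ?_
    have h1 : (1 - B t * C τ) * B τ = B τ - B t := by
      rw [sub_mul, one_mul, mul_assoc, hP.inv_mul τ (hsub hτ), mul_one]
    calc _ = B t * NormedSpace.exp ((t - τ) • B t) * ((B τ - B t) * (U τ s * X)) := by noncomm_ring
      _ = _ := by rw [← h1]; noncomm_ring
  have hc := hP.continuousOn_left_integrand hU hs hm ht X
  have h := intervalIntegral.integral_eq_sub_of_hasDerivAt hd (hc.intervalIntegrable_of_Icc hmt)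
  rw [h, sub_self, zero_smul, NormedSpace.exp_zero, one_mul]
  abel

section Bounds

variable (hP : ParabolicFamily T c K B C) (hU : IsFlow T B U) (hT : 0 ≤ T) (hM1 : 1 ≤ M)
  (hM : ∀ B : 𝔸, HalfPlaneBound c B → ∀ t : ℝ, 0 < t →
      ‖NormedSpace.exp (t • B)‖ ≤ M ∧ ‖B * NormedSpace.exp (t • B)‖ ≤ M / t)
include hP hT hM1 hM

theorem norm_right_kernel_le {s τ : ℝ} (hs : s ∈ Icc 0 T) (hτ : τ ∈ Icc 0 T) (hsτ : s ≤ τ) :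
    ‖(B τ - B s) * NormedSpace.exp ((τ - s) • B s)‖ ≤ M * K := by
  have hK := hP.nonneg hT
  rcases hsτ.eq_or_lt with rfl | h
  · rw [sub_self, zero_mul, norm_zero]; positivity
  · have h0 : 0 < τ - s := sub_pos.2 h
    have h1 := hP.lip τ hτ s hs
    rw [abs_of_pos h0] at h1
    rw [hP.sub_eq hs, mul_assoc]
    calc _ ≤ K * (τ - s) * (M / (τ - s)) :=
          (norm_mul_le _ _).trans (mul_le_mul h1 ((hM _ (hP.halfPlane s hs) _ h0).2) (norm_nonneg _)
            (by positivity))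
      _ = M * K := by field_simp

theorem norm_left_kernel_le {τ t : ℝ} (hτ : τ ∈ Icc 0 T) (ht : t ∈ Icc 0 T) (hτt : τ ≤ t) :
    ‖B t * NormedSpace.exp ((t - τ) • B t) * (1 - B t * C τ)‖ ≤ M * K := by
  have hK := hP.nonneg hT
  rcases hτt.eq_or_lt with rfl | h
  · rw [hP.mul_inv τ hτ, sub_self (1 : 𝔸), mul_zero, norm_zero]; positivity
  · have h0 : 0 < t - τ := sub_pos.2 h
    have h1 := hP.lip t ht τ hτ
    rw [abs_of_pos h0, norm_sub_rev] at h1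
    calc _ ≤ (M / (t - τ)) * (K * (t - τ)) :=
          (norm_mul_le _ _).trans (mul_le_mul ((hM _ (hP.halfPlane t ht) _ h0).2) h1 (norm_nonneg _)
            (by positivity))
      _ = M * K := by field_simp

theorem norm_exp_le {s t : ℝ} (hs : s ∈ Icc 0 T) (ht : 0 ≤ t) :
    ‖NormedSpace.exp (t • B s)‖ ≤ M := by
  rcases ht.eq_or_lt with rfl | h
  · rw [zero_smul, NormedSpace.exp_zero]; exact hP.norm_one_le.trans hM1
  · exact (hM _ (hP.halfPlane s hs) _ h).1

include hU

theorem norm_mul_flow_le (X : 𝔸) {s t : ℝ} (hs : 0 ≤ s) (hst : s ≤ t) (ht : t ≤ T) :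
    ‖X * U t s‖ ≤ ‖X * NormedSpace.exp ((t - s) • B s)‖ + M * K * ∫ τ in s..t, ‖X * U t τ‖ := by
  have hK := hP.nonneg hT
  have htm : t ∈ Icc 0 T := ⟨hs.trans hst, ht⟩
  have hsm : s ∈ Icc 0 T := ⟨hs, hst.trans ht⟩
  have hsub : Icc s t ⊆ Icc 0 T := Icc_subset_Icc hs ht
  have hc : ContinuousOn (fun τ => U t τ * ((B τ - B s) * NormedSpace.exp ((τ - s) • B s)))
      (Icc s t) :=
    ((hU.continuousOn_snd htm).mono hsub).mul (((hP.continuousOn.mono hsub).sub continuousOn_const).mul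
      ((continuous_exp_smul (B s)).comp (continuous_id.sub continuous_const)).continuousOn)
  have hc2 : ContinuousOn (fun τ => ‖X * U t τ‖) (Icc s t) :=
    (continuousOn_const.mul ((hU.continuousOn_snd htm).mono hsub)).norm
  have h := hP.duhamel_right hU hs hst ht
  have e : X * U t s = X * NormedSpace.exp ((t - s) • B s)
      + ∫ τ in s..t, X * (U t τ * ((B τ - B s) * NormedSpace.exp ((τ - s) • B s))) := by
    have := (ContinuousLinearMap.mul ℝ 𝔸 X).intervalIntegral_comp_comm
      (hc.intervalIntegrable_of_Icc (μ := volume) hst)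
    simp only [ContinuousLinearMap.mul_apply'] at this
    rw [this, ← mul_add, ← h]
  rw [e]
  refine (norm_add_le _ _).trans (add_le_add le_rfl ?_)
  rw [← intervalIntegral.integral_const_mul]
  refine intervalIntegral.norm_integral_le_of_norm_le hst
    (Filter.Eventually.of_forall fun τ hτ => ?_)
    ((continuousOn_const.mul hc2).intervalIntegrable_of_Icc hst)
  have hτ' : τ ∈ Icc s t := ⟨hτ.1.le, hτ.2⟩
  rw [← mul_assoc, mul_comm]
  exact (norm_mul_le _ _).trans (mul_le_mul_of_nonneg_left
    (hP.norm_right_kernel_le hT hM1 hM hsm (hsub hτ') hτ'.1) (norm_nonneg _)) |>.trans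
    (le_of_eq (mul_comm _ _)) |>.trans (le_of_eq (mul_comm _ _))

theorem norm_flow_le {s t : ℝ} (hs : 0 ≤ s) (hst : s ≤ t) (ht : t ≤ T) :
    ‖U t s‖ ≤ (1 + M * K * Real.exp (M * K * T) * T) * M := by
  have hK := hP.nonneg hT
  have htm : t ∈ Icc 0 T := ⟨hs.trans hst, ht⟩
  have hMK : 0 ≤ M * K := by positivity
  rcases hst.eq_or_lt with rfl | h
  · rw [hU.refl s htm]
    refine hP.norm_one_le.trans (hM1.trans (le_mul_of_one_le_left (by linarith) ?_))
    have : 0 ≤ M * K * Real.exp (M * K * T) * T := by positivity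
    linarith
  · refine gronwall_const_backward (f := fun s => ‖U t s‖) (a := 0) (b := t) hMK (by linarith)
      (by linarith) ((hU.continuousOn_snd htm).mono (Icc_subset_Icc_right ht)).norm
      (fun r hr => ?_) s ⟨hs, h⟩
    have h1 := hP.norm_mul_flow_le hU hT hM1 hM 1 hr.1 hr.2.le ht
    simp only [one_mul] at h1
    refine h1.trans ?_
    gcongr
    exact hP.norm_exp_le hT hM1 hM ⟨hr.1, hr.2.le.trans ht⟩ (by linarith [hr.2])

theorem norm_gen_mul_flow_mul_le (X : 𝔸) {s m t : ℝ} (hs : s ∈ Icc 0 T) (hm : 0 ≤ m) (hmt : m ≤ t)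
    (ht : t ≤ T) :
    ‖B t * (U t s * X)‖ ≤ ‖B t * (NormedSpace.exp ((t - m) • B t) * (U m s * X))‖
      + M * K * ∫ τ in m..t, ‖B τ * (U τ s * X)‖ := by
  have hK := hP.nonneg hT
  have htm : t ∈ Icc 0 T := ⟨hm.trans hmt, ht⟩
  have hsub : Icc m t ⊆ Icc 0 T := Icc_subset_Icc hm ht
  have hc2 : ContinuousOn (fun τ => ‖B τ * (U τ s * X)‖) (Icc m t) :=
    ((hP.continuousOn.mono hsub).mul
      (((hU.continuousOn_fst hs).mono hsub).mul continuousOn_const)).norm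
  rw [hP.duhamel_left hU hs hm hmt ht X]
  refine (norm_add_le _ _).trans (add_le_add le_rfl ?_)
  rw [← intervalIntegral.integral_const_mul]
  refine intervalIntegral.norm_integral_le_of_norm_le hmt
    (Filter.Eventually.of_forall fun τ hτ => ?_)
    ((continuousOn_const.mul hc2).intervalIntegrable_of_Icc hmt)
  have hτ' : τ ∈ Icc m t := ⟨hτ.1.le, hτ.2⟩
  exact (norm_mul_le _ _).trans (mul_le_mul_of_nonneg_right
    (hP.norm_left_kernel_le hT hM1 hM (hsub hτ') htm hτ'.2) (norm_nonneg _))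

theorem norm_conj_flow_le {s t : ℝ} (hs : 0 ≤ s) (hst : s ≤ t) (ht : t ≤ T) :
    ‖B t * (U t s * C s)‖ ≤ (1 + M * K * Real.exp (M * K * T) * T) * (M * (1 + K * T)) := by
  have hK := hP.nonneg hT
  have hsm : s ∈ Icc 0 T := ⟨hs, hst.trans ht⟩
  have hMK : 0 ≤ M * K := by positivity
  rcases hst.eq_or_lt with rfl | h
  · rw [hU.refl s hsm, one_mul, hP.mul_inv s hsm]
    refine hP.norm_one_le.trans (one_le_mul_of_one_le_of_one_le ?_
      (one_le_mul_of_one_le_of_one_le hM1 ?_))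
    · have : 0 ≤ M * K * Real.exp (M * K * T) * T := by positivity
      linarith
    · have : 0 ≤ K * T := by positivity
      linarith
  · have hsub : Icc s T ⊆ Icc 0 T := Icc_subset_Icc_left hs
    refine gronwall_const (f := fun t => ‖B t * (U t s * C s)‖) (a := s) (b := T) hMK (by linarith)
      (by positivity) (((hP.continuousOn.mono hsub).mul
      (((hU.continuousOn_fst hsm).mono hsub).mul continuousOn_const)).norm)
      (fun r hr => ?_) t ⟨h, ht⟩
    have hrm : r ∈ Icc 0 T := ⟨hs.trans hr.1.le, hr.2⟩
    refine (hP.norm_gen_mul_flow_mul_le hU hT hM1 hM (C s) hsm hs hr.1.le hr.2).trans ?_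
    gcongr
    rw [hU.refl s hsm, one_mul, ← mul_assoc, commute_exp_smul, mul_assoc]
    refine (norm_mul_le _ _).trans ?_
    have h1 := hP.norm_exp_le hT hM1 hM hrm (t := r - s) (by linarith [hr.1])
    have h2 := hP.norm_mul_inv_le hsm hrm
    gcongr

/-- The smoothing estimate. The factor `(m - s)⁻¹` that `B m * U m s` is expected to carry is
not integrable in the Duhamel formula; so one first bounds `B t exp ((t - m) B t) U m s` by the
geometric mean of `(t - m)⁻¹` and `(m - s)⁻¹`, and then takes `m = (s + t) / 2`. -/
theorem norm_gen_mul_flow_le {s t : ℝ} (hs : 0 ≤ s) (hst : s < t) (ht : t ≤ T) :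
    ‖B t * U t s‖ ≤ 2 * (1 + 2 * (M * K) * Real.exp (M * K * T) * T) ^ 2 * (M ^ 2 * (1 + K * T))
      / (t - s) := by
  have hK := hP.nonneg hT
  have hMK : 0 ≤ M * K := by positivity
  set P := M ^ 2 * (1 + K * T) with hPdef
  have hP0 : 0 ≤ P := by positivity
  set G := 1 + 2 * (M * K) * Real.exp (M * K * T) * T with hG
  have hG0 : 0 ≤ G := by positivity
  set m := (s + t) / 2 with hm
  have hsm : s < m := by rw [hm]; linarith
  have hmt : m < t := by rw [hm]; linarith
  have hsI : s ∈ Icc 0 T := ⟨hs, hst.le.trans ht⟩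
  have hmI : m ∈ Icc 0 T := ⟨hs.trans hsm.le, hmt.le.trans ht⟩
  -- `‖B r exp ((r - m) B r) U m s‖ ≤ C (r - m)^(-1/2) (m - s)^(-1/2)`
  have step1 : ∀ r ∈ Ioc m T, ‖B r * NormedSpace.exp ((r - m) • B r) * U m s‖
      ≤ G * (P * (r - m) ^ (-(1 / 2) : ℝ)) * (m - s) ^ (-(1 / 2) : ℝ) := by
    intro r hr
    have hrI : r ∈ Icc 0 T := ⟨hmI.1.trans hr.1.le, hr.2⟩
    have hrm : 0 < r - m := sub_pos.2 hr.1
    refine gronwall_inv_sqrt_backward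
      (f := fun s => ‖B r * NormedSpace.exp ((r - m) • B r) * U m s‖) (a := 0) (b := m)
      hMK (by linarith [hmI.2]) (by positivity)
      ((continuousOn_const.mul
        ((hU.continuousOn_snd hmI).mono (Icc_subset_Icc_right hmI.2))).norm)
      (fun q hq => ?_) s ⟨hs, hsm⟩
    have hqI : q ∈ Icc 0 T := ⟨hq.1, hq.2.le.trans hmI.2⟩
    have hmq : 0 < m - q := sub_pos.2 hq.2
    refine (hP.norm_mul_flow_le hU hT hM1 hM _ hq.1 hq.2.le hmI.2).trans ?_
    gcongr
    obtain ⟨a1, b1⟩ := hM _ (hP.halfPlane r hrI) _ hrm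
    obtain ⟨a2, b2⟩ := hM _ (hP.halfPlane q hqI) _ hmq
    have hMP : M * M ≤ P := by
      rw [hPdef, pow_two]
      exact le_mul_of_one_le_right (by positivity) (by linarith [mul_nonneg hK hT])
    have e1 : ‖B r * NormedSpace.exp ((r - m) • B r) * NormedSpace.exp ((m - q) • B q)‖
        ≤ P / (r - m) := by
      calc _ ≤ M / (r - m) * M := (norm_mul_le _ _).trans (mul_le_mul b1 a2 (norm_nonneg _)
            (by positivity))
        _ = M * M / (r - m) := by ring
        _ ≤ _ := by gcongr
    have e2 : ‖B r * NormedSpace.exp ((r - m) • B r) * NormedSpace.exp ((m - q) • B q)‖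
        ≤ P / (r - m) * ((r - m) / (m - q)) := by
      have : B r * NormedSpace.exp ((r - m) • B r) * NormedSpace.exp ((m - q) • B q)
          = NormedSpace.exp ((r - m) • B r) * ((B r * C q)
            * (B q * NormedSpace.exp ((m - q) • B q))) := by
        rw [mul_assoc (B r) (C q), ← mul_assoc (C q), hP.inv_mul q hqI, one_mul, commute_exp_smul,
          mul_assoc]
      rw [this]
      calc _ ≤ M * ((1 + K * T) * (M / (m - q))) :=
            (norm_mul_le _ _).trans (mul_le_mul a1 ((norm_mul_le _ _).trans
              (mul_le_mul (hP.norm_mul_inv_le hqI hrI) b2 (norm_nonneg _) (by positivity)))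
              (norm_nonneg _) (by positivity))
        _ = _ := by rw [hPdef]; field_simp
    have e3 := le_mul_rpow_of_le_of_le (p := 1 / 2) (by positivity) (by positivity) (by norm_num)
      (by norm_num) e1 e2
    refine e3.trans (le_of_eq ?_)
    rw [Real.div_rpow hrm.le hmq.le, Real.rpow_neg hrm.le, Real.rpow_neg hmq.le]
    have h3 : r - m = (r - m) ^ (1 / 2 : ℝ) * (r - m) ^ (1 / 2 : ℝ) := by
      rw [← Real.rpow_add hrm]; norm_num
    have h4 : 0 < (r - m) ^ (1 / 2 : ℝ) := Real.rpow_pos_of_pos hrm _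
    have h5 : 0 < (m - q) ^ (1 / 2 : ℝ) := Real.rpow_pos_of_pos hmq _
    rw [show P / (r - m) = P / ((r - m) ^ (1 / 2 : ℝ) * (r - m) ^ (1 / 2 : ℝ)) by rw [← h3]]
    field_simp
  have hsub : Icc m T ⊆ Icc 0 T := Icc_subset_Icc_left hmI.1
  have step2 := gronwall_inv_sqrt (f := fun t => ‖B t * U t s‖) (a := m) (b := T) (S := T)
    (M := G * P * (m - s) ^ (-(1 / 2) : ℝ)) hMK (by linarith [hmI.1]) (by
      have := Real.rpow_nonneg (sub_pos.2 hsm).le (-(1 / 2) : ℝ)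
      positivity)
    (((hP.continuousOn.mono hsub).mul ((hU.continuousOn_fst hsI).mono hsub)).norm)
    (fun r hr => by
      have h1 := hP.norm_gen_mul_flow_mul_le hU hT hM1 hM 1 hsI hmI.1 hr.1.le hr.2
      simp only [mul_one] at h1
      refine h1.trans ?_
      gcongr
      rw [← mul_assoc]
      exact (step1 r hr).trans (le_of_eq (by ring))) t ⟨hmt, ht⟩
  refine step2.trans (le_of_eq ?_)
  have h1 : m - s = t - m := by rw [hm]; ring
  have h2 : 0 < t - m := sub_pos.2 hmt
  have h3 : (t - m) ^ (-(1 / 2) : ℝ) * (t - m) ^ (-(1 / 2) : ℝ) = (t - m)⁻¹ := by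
    rw [← Real.rpow_add h2, ← Real.rpow_neg_one]; norm_num
  have h4 : t - m = (t - s) / 2 := by rw [hm]; ring
  rw [h1, ← hG]
  calc G * (G * P * (t - m) ^ (-(1 / 2) : ℝ)) * (t - m) ^ (-(1 / 2) : ℝ)
      = G ^ 2 * P * ((t - m) ^ (-(1 / 2) : ℝ) * (t - m) ^ (-(1 / 2) : ℝ)) := by ring
    _ = _ := by
      have : t - s ≠ 0 := by linarith
      rw [h3, h4]; field_simp

end Bounds

end ParabolicFamily

end BoundedFamily

/-! ### Comparison of two families of bounded generators -/

section Comparison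

variable {𝔸 : Type*} [NormedRing 𝔸] [NormedAlgebra ℂ 𝔸] [CompleteSpace 𝔸]
variable {T c K M : ℝ} {B₁ B₂ C₁ C₂ : ℝ → 𝔸} {U₁ U₂ : ℝ → ℝ → 𝔸}

theorem div_sq_rpow_quarter {δ σ : ℝ} (hσ : 0 < σ) :
    (|δ| / σ ^ 2) ^ (1 / 4 : ℝ) = |δ| ^ (1 / 4 : ℝ) * σ ^ (-(1 / 2) : ℝ) := by
  rw [Real.div_rpow (abs_nonneg _) (by positivity), ← Real.rpow_natCast, ← Real.rpow_mul hσ.le,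
    div_eq_mul_inv, ← Real.rpow_neg hσ.le]
  norm_num

theorem ParabolicFamily.left_kernel_eq (hP : ParabolicFamily T c K B₁ C₁) {t τ : ℝ}
    (ht : t ∈ Icc 0 T) (σ : ℝ) :
    B₁ t * NormedSpace.exp (σ • B₁ t) * (1 - B₁ t * C₁ τ)
      = B₁ t * (B₁ t * NormedSpace.exp (σ • B₁ t)) * (C₁ t - C₁ τ) := by
  have h1 : 1 - B₁ t * C₁ τ = B₁ t * (C₁ t - C₁ τ) := by rw [mul_sub, hP.mul_inv t ht]
  rw [h1, ← mul_assoc, mul_assoc (B₁ t) _ (B₁ t), ← commute_exp_smul]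

/-- If the inverses of two families of generators differ by a constant multiple `δ` of the
identity, then the evolution systems, as operators on the domains of the generators, differ by
a positive power of `|δ|`. -/
theorem ParabolicFamily.norm_conj_flow_sub_le (hT : 0 ≤ T) (hM1 : 1 ≤ M)
    (hM : ∀ B : 𝔸, HalfPlaneBound c B → ∀ t : ℝ, 0 < t →
      ‖NormedSpace.exp (t • B)‖ ≤ M ∧ ‖B * NormedSpace.exp (t • B)‖ ≤ M / t)
    (hM' : ∀ B₁ B₂ C₁ C₂ : 𝔸, HalfPlaneBound c B₁ → HalfPlaneBound c B₂ → C₁ * B₁ = 1 →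
      B₁ * C₁ = 1 → C₂ * B₂ = 1 → B₂ * C₂ = 1 → ∀ δ : ℝ, C₁ - C₂ = δ • (1 : 𝔸) → ∀ t : ℝ, 0 < t →
      ‖B₁ * NormedSpace.exp (t • B₁) - B₂ * NormedSpace.exp (t • B₂)‖ ≤ M * |δ| / t ^ 2 ∧
      ‖B₁ * (B₁ * NormedSpace.exp (t • B₁)) - B₂ * (B₂ * NormedSpace.exp (t • B₂))‖
        ≤ M * |δ| / t ^ 3)
    (h₁ : ParabolicFamily T c K B₁ C₁) (h₂ : ParabolicFamily T c K B₂ C₂) (hU₁ : IsFlow T B₁ U₁)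
    (hU₂ : IsFlow T B₂ U₂) {δ : ℝ} (hδ : ∀ t ∈ Icc 0 T, C₁ t - C₂ t = δ • (1 : 𝔸))
    {M₁ : ℝ} (hM₁ : ∀ s t, 0 ≤ s → s ≤ t → t ≤ T → ‖B₂ t * (U₂ t s * C₂ s)‖ ≤ M₁)
    {s t : ℝ} (hs : 0 ≤ s) (hst : s < t) (ht : t ≤ T) :
    ‖B₁ t * (U₁ t s * C₁ s) - B₂ t * (U₂ t s * C₂ s)‖
      ≤ (1 + 2 * (M * K) * Real.exp (M * K * T) * T) *
        ((M * (K + T) + 2 * M * (1 + K * T) + 2 * (M * K ^ 2 + 2 * M * K) * M₁ * T) *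
          |δ| ^ (1 / 4 : ℝ)) * (t - s) ^ (-(1 / 2) : ℝ) := by
  have hK := h₁.nonneg hT
  have hMK : 0 ≤ M * K := by positivity
  have hM₁0 : 0 ≤ M₁ := (norm_nonneg _).trans (hM₁ s s hs le_rfl (hst.le.trans ht))
  have hsI : s ∈ Icc 0 T := ⟨hs, hst.le.trans ht⟩
  have hd0 : 0 ≤ |δ| ^ (1 / 4 : ℝ) := Real.rpow_nonneg (abs_nonneg _) _
  have hsubT : Icc s T ⊆ Icc 0 T := Icc_subset_Icc_left hs
  refine gronwall_inv_sqrt (f := fun t => ‖B₁ t * (U₁ t s * C₁ s) - B₂ t * (U₂ t s * C₂ s)‖)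
    (a := s) (b := T) hMK (by linarith) (by positivity)
    ((((h₁.continuousOn.mono hsubT).mul
      (((hU₁.continuousOn_fst hsI).mono hsubT).mul continuousOn_const)).sub
      ((h₂.continuousOn.mono hsubT).mul
      (((hU₂.continuousOn_fst hsI).mono hsubT).mul continuousOn_const))).norm)
    (fun t ht => ?_) t ⟨hst, ht⟩
  have htI : t ∈ Icc 0 T := ⟨hs.trans ht.1.le, ht.2⟩
  have hσ : 0 < t - s := sub_pos.2 ht.1
  have hsub : Icc s t ⊆ Icc 0 T := Icc_subset_Icc hs ht.2
  have pair : ∀ σ : ℝ, 0 < σ → _ := fun σ hσ => hM' (B₁ t) (B₂ t) (C₁ t) (C₂ t)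
    (h₁.halfPlane t htI) (h₂.halfPlane t htI) (h₁.inv_mul t htI) (h₁.mul_inv t htI)
    (h₂.inv_mul t htI) (h₂.mul_inv t htI) δ (hδ t htI) σ hσ
  -- The inhomogeneous terms of the left Duhamel formulas are bounded and differ by
  -- `O(|δ| (t - s)^(-2))`; the power `1/4` of this bound leaves an integrable singularity.
  have ha : ‖B₁ t * (NormedSpace.exp ((t - s) • B₁ t) * (U₁ s s * C₁ s))
      - B₂ t * (NormedSpace.exp ((t - s) • B₂ t) * (U₂ s s * C₂ s))‖
      ≤ (M * (K + T) + 2 * M * (1 + K * T)) * (|δ| ^ (1 / 4 : ℝ) * (t - s) ^ (-(1 / 2) : ℝ)) := by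
    rw [← div_sq_rpow_quarter hσ]
    have hx : ∀ {B C : ℝ → 𝔸} {U : ℝ → ℝ → 𝔸}, ParabolicFamily T c K B C → IsFlow T B U →
        ‖B t * (NormedSpace.exp ((t - s) • B t) * (U s s * C s))‖ ≤ M * (1 + K * T) := by
      intro B C U hP hU
      rw [hU.refl s hsI, one_mul, ← mul_assoc, commute_exp_smul, mul_assoc]
      refine (norm_mul_le _ _).trans ?_
      have h1 := (hM _ (hP.halfPlane t htI) _ hσ).1
      have h2 := hP.norm_mul_inv_le hsI htI
      gcongr
    refine le_mul_rpow_of_le_of_le (by positivity) (by positivity) (by norm_num) (by norm_num) ?_ ?_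
    · refine (norm_sub_le _ _).trans ((add_le_add (hx h₁ hU₁) (hx h₂ hU₂)).trans ?_)
      linarith [show 0 ≤ M * (K + T) by positivity]
    · have e : B₁ t * (NormedSpace.exp ((t - s) • B₁ t) * (U₁ s s * C₁ s))
          - B₂ t * (NormedSpace.exp ((t - s) • B₂ t) * (U₂ s s * C₂ s))
          = (B₁ t * NormedSpace.exp ((t - s) • B₁ t) - B₂ t * NormedSpace.exp ((t - s) • B₂ t))
              * C₁ s + δ • (B₂ t * NormedSpace.exp ((t - s) • B₂ t)) := by
        have : δ • (B₂ t * NormedSpace.exp ((t - s) • B₂ t))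
            = B₂ t * NormedSpace.exp ((t - s) • B₂ t) * (C₁ s - C₂ s) := by
          rw [hδ s hsI, mul_smul_comm, mul_one]
        rw [this, hU₁.refl s hsI, hU₂.refl s hsI]
        noncomm_ring
      rw [e]
      have hTσ : t - s ≤ T := by linarith [ht.2]
      calc _ ≤ M * |δ| / (t - s) ^ 2 * K + |δ| * (M / (t - s)) := by
            refine (norm_add_le _ _).trans (add_le_add ((norm_mul_le _ _).trans ?_) ?_)
            · exact mul_le_mul (pair _ hσ).1 (h₁.norm_inv_le s hsI) (norm_nonneg _) (by positivity)
            · rw [norm_smul, Real.norm_eq_abs]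
              gcongr
              exact (hM _ (h₂.halfPlane t htI) _ hσ).2
        _ = M * (K + (t - s)) * (|δ| / (t - s) ^ 2) := by field_simp
        _ ≤ _ := by
            gcongr
            linarith [show M * (t - s) ≤ M * T by gcongr, show 0 ≤ 2 * M * (1 + K * T) by positivity]
  -- the same interpolation for the difference of the kernels
  have hk : ∀ τ ∈ Ico s t, ‖B₁ t * NormedSpace.exp ((t - τ) • B₁ t) * (1 - B₁ t * C₁ τ)
      - B₂ t * NormedSpace.exp ((t - τ) • B₂ t) * (1 - B₂ t * C₂ τ)‖
      ≤ (M * K ^ 2 + 2 * M * K) * (|δ| ^ (1 / 4 : ℝ) * (t - τ) ^ (-(1 / 2) : ℝ)) := by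
    intro τ hτ
    have hτI : τ ∈ Icc 0 T := hsub ⟨hτ.1, hτ.2.le⟩
    have hσ : 0 < t - τ := sub_pos.2 hτ.2
    rw [← div_sq_rpow_quarter hσ]
    refine le_mul_rpow_of_le_of_le (by positivity) (by positivity) (by norm_num) (by norm_num) ?_ ?_
    · refine (norm_sub_le _ _).trans ((add_le_add
        (h₁.norm_left_kernel_le hT hM1 hM hτI htI hτ.2.le)
        (h₂.norm_left_kernel_le hT hM1 hM hτI htI hτ.2.le)).trans ?_)
      linarith [show 0 ≤ M * K ^ 2 by positivity]
    · have hΔ : C₂ t - C₂ τ = C₁ t - C₁ τ := by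
        have e1 := hδ t htI
        have e2 := hδ τ hτI
        rw [← e2, sub_eq_sub_iff_add_eq_add] at e1
        rw [sub_eq_sub_iff_add_eq_add, add_comm, ← e1, add_comm]
      have hΔn : ‖C₁ t - C₁ τ‖ ≤ K * (K * (t - τ)) := by
        have : C₁ t - C₁ τ = -(C₁ t * (B₁ t * C₁ τ - 1)) := by
          rw [mul_sub, ← mul_assoc, h₁.inv_mul t htI]; noncomm_ring
        rw [this, norm_neg]
        have h3 := h₁.lip t htI τ hτI
        rw [abs_of_pos hσ] at h3
        exact (norm_mul_le _ _).trans (mul_le_mul (h₁.norm_inv_le t htI) h3 (norm_nonneg _) hK)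
      rw [h₁.left_kernel_eq htI, h₂.left_kernel_eq htI, hΔ, ← sub_mul]
      calc _ ≤ M * |δ| / (t - τ) ^ 3 * (K * (K * (t - τ))) :=
            (norm_mul_le _ _).trans (mul_le_mul (pair _ hσ).2 hΔn (norm_nonneg _) (by positivity))
        _ = M * K ^ 2 * (|δ| / (t - τ) ^ 2) := by field_simp
        _ ≤ _ := by
            gcongr
            linarith [show 0 ≤ 2 * M * K by positivity]
  have hc₁ := h₁.continuousOn_left_integrand hU₁ hsI hs ht.2 (C₁ s)
  have hc₂ := h₂.continuousOn_left_integrand hU₂ hsI hs ht.2 (C₂ s)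
  have hw : ContinuousOn (fun τ => ‖B₁ τ * (U₁ τ s * C₁ s) - B₂ τ * (U₂ τ s * C₂ s)‖) (Icc s t) :=
    (((h₁.continuousOn.mono hsub).mul
      (((hU₁.continuousOn_fst hsI).mono hsub).mul continuousOn_const)).sub
      ((h₂.continuousOn.mono hsub).mul
      (((hU₂.continuousOn_fst hsI).mono hsub).mul continuousOn_const))).norm
  rw [h₁.duhamel_left hU₁ hsI hs ht.1.le ht.2, h₂.duhamel_left hU₂ hsI hs ht.1.le ht.2,
    add_sub_add_comm, ← intervalIntegral.integral_sub (hc₁.intervalIntegrable_of_Icc ht.1.le)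
      (hc₂.intervalIntegrable_of_Icc ht.1.le)]
  have hI := integral_inv_sqrt' s t
  have hint : ‖∫ τ in s..t, (B₁ t * NormedSpace.exp ((t - τ) • B₁ t) * (1 - B₁ t * C₁ τ) *
        (B₁ τ * (U₁ τ s * C₁ s))
      - B₂ t * NormedSpace.exp ((t - τ) • B₂ t) * (1 - B₂ t * C₂ τ) *
        (B₂ τ * (U₂ τ s * C₂ s)))‖
      ≤ ∫ τ in s..t, (M * K * ‖B₁ τ * (U₁ τ s * C₁ s) - B₂ τ * (U₂ τ s * C₂ s)‖
        + ((M * K ^ 2 + 2 * M * K) * M₁ * |δ| ^ (1 / 4 : ℝ)) * (t - τ) ^ (-(1 / 2) : ℝ)) := by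
    refine intervalIntegral.norm_integral_le_of_norm_le ht.1.le ?_
      (((hw.intervalIntegrable_of_Icc ht.1.le).const_mul _).add (hI.1.const_mul _))
    filter_upwards [Measure.ae_ne volume t] with τ hne hτ
    have hτ1 : τ ∈ Ico s t := ⟨hτ.1.le, lt_of_le_of_ne hτ.2 hne⟩
    have hτI : τ ∈ Icc 0 T := hsub ⟨hτ1.1, hτ1.2.le⟩
    set k₁ := B₁ t * NormedSpace.exp ((t - τ) • B₁ t) * (1 - B₁ t * C₁ τ) with hk₁
    set k₂ := B₂ t * NormedSpace.exp ((t - τ) • B₂ t) * (1 - B₂ t * C₂ τ) with hk₂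
    set V₁ := B₁ τ * (U₁ τ s * C₁ s)
    set V₂ := B₂ τ * (U₂ τ s * C₂ s) with hV₂
    have e : k₁ * V₁ - k₂ * V₂ = k₁ * (V₁ - V₂) + (k₁ - k₂) * V₂ := by noncomm_ring
    rw [e]
    refine (norm_add_le _ _).trans (add_le_add ((norm_mul_le _ _).trans ?_)
      ((norm_mul_le _ _).trans ?_))
    · gcongr
      exact h₁.norm_left_kernel_le hT hM1 hM hτI htI hτ1.2.le
    · have hV := hM₁ s τ hs hτ1.1 hτI.2
      refine (mul_le_mul (hk τ hτ1) hV (norm_nonneg _) ?_).trans (le_of_eq (by ring))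
      have := Real.rpow_nonneg (sub_pos.2 hτ1.2).le (-(1 / 2) : ℝ)
      positivity
  rw [intervalIntegral.integral_add ((hw.intervalIntegrable_of_Icc ht.1.le).const_mul _)
    (hI.1.const_mul _), intervalIntegral.integral_const_mul, intervalIntegral.integral_const_mul,
    hI.2] at hint
  have hsq := sqrt_le_mul_inv_sqrt (x := t - s) (S := T) hσ (by linarith [ht.2])
  refine (norm_add_le _ _).trans ((add_le_add ha hint).trans ?_)
  have : (M * K ^ 2 + 2 * M * K) * M₁ * |δ| ^ (1 / 4 : ℝ) * (2 * (t - s) ^ (1 / 2 : ℝ))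
      ≤ (M * K ^ 2 + 2 * M * K) * M₁ * |δ| ^ (1 / 4 : ℝ) * (2 * (T * (t - s) ^ (-(1 / 2) : ℝ))) := by
    gcongr
  linarith

/-- The estimates that hold uniformly for all bounded families with the same constants. -/
theorem exists_flow_bounds (𝔸 : Type*) [NormedRing 𝔸] [NormedAlgebra ℂ 𝔸] [CompleteSpace 𝔸]
    (h1 : ‖(1 : 𝔸)‖ ≤ 1) {T : ℝ} (hT : 0 ≤ T) (c : ℝ) {K : ℝ} (hK : 0 ≤ K) : ∃ M : ℝ, 0 < M ∧
    (∀ (B C : ℝ → 𝔸) (U : ℝ → ℝ → 𝔸), ParabolicFamily T c K B C → IsFlow T B U →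
      ∀ s t, 0 ≤ s → s ≤ t → t ≤ T → ‖U t s‖ ≤ M ∧ ‖B t * (U t s * C s)‖ ≤ M ∧
        (s < t → ‖B t * U t s‖ ≤ M / (t - s))) ∧
    (∀ (B₁ B₂ C₁ C₂ : ℝ → 𝔸) (U₁ U₂ : ℝ → ℝ → 𝔸), ParabolicFamily T c K B₁ C₁ →
      ParabolicFamily T c K B₂ C₂ → IsFlow T B₁ U₁ → IsFlow T B₂ U₂ →
      ∀ δ : ℝ, (∀ t ∈ Icc 0 T, C₁ t - C₂ t = δ • (1 : 𝔸)) → ∀ s t, 0 ≤ s → s < t → t ≤ T →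
      ‖B₁ t * (U₁ t s * C₁ s) - B₂ t * (U₂ t s * C₂ s)‖
        ≤ M * |δ| ^ (1 / 4 : ℝ) * (t - s) ^ (-(1 / 2) : ℝ)) := by
  obtain ⟨M, hM1, hM, hM'⟩ := exists_exp_bounds 𝔸 h1 c
  set m₁ := (1 + M * K * Real.exp (M * K * T) * T) * M
  set m₂ := (1 + M * K * Real.exp (M * K * T) * T) * (M * (1 + K * T))
  set m₃ := 2 * (1 + 2 * (M * K) * Real.exp (M * K * T) * T) ^ 2 * (M ^ 2 * (1 + K * T))
  set m₄ := (1 + 2 * (M * K) * Real.exp (M * K * T) * T) *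
    (M * (K + T) + 2 * M * (1 + K * T) + 2 * (M * K ^ 2 + 2 * M * K) * m₂ * T)
  have p₁ : 0 ≤ m₁ := by positivity
  have p₂ : 0 ≤ m₂ := by positivity
  have p₃ : 0 ≤ m₃ := by positivity
  have p₄ : 0 ≤ m₄ := by positivity
  refine ⟨m₁ + m₂ + m₃ + m₄ + 1, by positivity, ?_, ?_⟩
  · intro B C U hP hU s t hs hst ht
    refine ⟨(hP.norm_flow_le hU hT hM1 hM hs hst ht).trans (by linarith),
      (hP.norm_conj_flow_le hU hT hM1 hM hs hst ht).trans (by linarith), fun h => ?_⟩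
    refine (hP.norm_gen_mul_flow_le hU hT hM1 hM hs h ht).trans ?_
    have : 0 < t - s := sub_pos.2 h
    gcongr
    linarith
  · intro B₁ B₂ C₁ C₂ U₁ U₂ h₁ h₂ hU₁ hU₂ δ hδ s t hs hst ht
    refine (h₁.norm_conj_flow_sub_le hT hM1 hM hM' h₂ hU₁ hU₂ hδ
      (fun s t hs hst ht => h₂.norm_conj_flow_le hU₂ hT hM1 hM hs hst ht) hs hst ht).trans ?_
    rw [← mul_assoc]
    have h5 := Real.rpow_nonneg (sub_pos.2 hst).le (-(1 / 2) : ℝ)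
    have h6 := Real.rpow_nonneg (abs_nonneg δ) (1 / 4 : ℝ)
    gcongr
    linarith

end Comparison

/-! ### Sectorial operators and their Yosida approximations -/

section Sectorial

variable {H : Type*} [NormedAddCommGroup H] [InnerProductSpace ℂ H] [CompleteSpace H]
variable {D : Submodule ℂ H}

theorem mem_fracPow_domain {L : D →ₗ[ℂ] H} {α : ℝ} {u : H} :
    u ∈ (fracPow L α).domain ↔ ∃ w, negFracPow L α w = u := by
  rw [fracPow, LinearPMap.inverse_domain]
  constructor
  · rintro ⟨w, hw⟩
    exact ⟨w, hw⟩
  · rintro ⟨w, hw⟩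
    exact ⟨⟨w, trivial⟩, hw⟩

theorem fracPow_eq_of_eq {L : D →ₗ[ℂ] H} {α : ℝ} (hinj : ∀ w, negFracPow L α w = 0 → w = 0)
    {u w : H} (huw : negFracPow L α w = u) (h : u ∈ (fracPow L α).domain) :
    fracPow L α ⟨u, h⟩ = w := by
  refine LinearPMap.inverse_apply_eq (f := ((negFracPow L α : H →L[ℂ] H) : H →ₗ[ℂ] H).toPMap ⊤)
    ?_ (x := ⟨w, trivial⟩) huw
  rw [LinearMap.ker_eq_bot']
  rintro ⟨m, hm⟩ h0
  exact Subtype.ext (hinj m h0)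

/-- A sectorial operator with bounded inverse; only the part of the sector in the right half plane
is recorded. -/
structure IsSectorialOp (c : ℝ) (L : D →ₗ[ℂ] H) : Prop where
  zero : ∃ R : H →L[ℂ] H, IsResolventOf L 0 R
  halfPlane : ∀ z : ℂ, 0 < z.re → ∃ R : H →L[ℂ] H, IsResolventOf L z R ∧ ‖R‖ ≤ c / ‖z‖

theorem isResolventOf_presolvent {L : D →ₗ[ℂ] H} {z : ℂ} (h : ∃ R : H →L[ℂ] H, IsResolventOf L z R) :
    IsResolventOf L z (presolvent L z) := by
  rw [presolvent, dif_pos h]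
  exact h.choose_spec

theorem IsResolventOf.unique {L : D →ₗ[ℂ] H} {z : ℂ} {R R' : H →L[ℂ] H} (h : IsResolventOf L z R)
    (h' : IsResolventOf L z R') : R = R' := by
  ext y
  obtain ⟨m, hm⟩ := h'.1 y
  have := h.2 ⟨R' y, m⟩
  rwa [hm] at this

theorem IsResolventOf.sub_eq {L : D →ₗ[ℂ] H} {z w : ℂ} {R R' : H →L[ℂ] H} (h : IsResolventOf L z R)
    (h' : IsResolventOf L w R') : R - R' = (w - z) • (R * R') := by
  ext y
  obtain ⟨m, hm⟩ := h'.1 y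
  have h1 : R (z • R' y - L ⟨R' y, m⟩) = R' y := h.2 ⟨R' y, m⟩
  have h2 : z • R' y - L ⟨R' y, m⟩ = y - (w - z) • R' y := by
    rw [sub_smul]
    nth_rewrite 3 [← hm]
    abel
  rw [h2, map_sub, map_smul] at h1
  change R y - R' y = (w - z) • R (R' y)
  rw [sub_eq_iff_eq_add] at h1 ⊢
  rw [h1, add_comm]

/-- The Yosida approximation `ν² R(ν) - ν` of a sectorial operator. -/
noncomputable def yosida (L : D →ₗ[ℂ] H) (ν : ℝ) : H →L[ℂ] H :=
  ν • (ν • presolvent L (ν : ℂ) - 1)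

/-- The inverse of the Yosida approximation is the inverse of the operator, shifted by `-1 / ν`. -/
noncomputable def yosidaInv (L : D →ₗ[ℂ] H) (ν : ℝ) : H →L[ℂ] H :=
  -(presolvent L 0 + ν⁻¹ • (1 : H →L[ℂ] H))

namespace IsSectorialOp

variable {c : ℝ} {L : D →ₗ[ℂ] H} (hL : IsSectorialOp c L)
include hL

theorem resolvent_spec {z : ℂ} (hz : 0 < z.re) : IsResolventOf L z (presolvent L z) :=
  isResolventOf_presolvent ((hL.halfPlane z hz).imp fun _ h => h.1)

theorem resolvent_norm_le {z : ℂ} (hz : 0 < z.re) : ‖presolvent L z‖ ≤ c / ‖z‖ := by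
  obtain ⟨R, h1, h2⟩ := hL.halfPlane z hz
  rwa [(hL.resolvent_spec hz).unique h1]

theorem resolvent_norm_le_real {r : ℝ} (hr : 0 < r) : ‖presolvent L r‖ ≤ c / r := by
  have := hL.resolvent_norm_le (z := r) (by simpa using hr)
  rwa [Complex.norm_real, Real.norm_of_nonneg hr.le] at this

theorem nonneg : 0 ≤ c := by
  have := (norm_nonneg _).trans (hL.resolvent_norm_le_real one_pos)
  simpa using this

theorem inv_mem (y : H) : presolvent L 0 y ∈ D :=
  ((isResolventOf_presolvent hL.zero).1 y).1

theorem apply_inv (y : H) : L ⟨presolvent L 0 y, hL.inv_mem y⟩ = -y := by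
  obtain ⟨m, hm⟩ := (isResolventOf_presolvent hL.zero).1 y
  rw [zero_smul, zero_sub] at hm
  exact neg_eq_iff_eq_neg.1 hm

theorem inv_apply (x : D) : presolvent L 0 (L x) = -(x : H) := by
  have := (isResolventOf_presolvent hL.zero).2 x
  rw [zero_smul, zero_sub, map_neg] at this
  rw [← this, neg_neg]

theorem inv_injective {y : H} (h : presolvent L 0 y = 0) : y = 0 := by
  have h1 := hL.apply_inv y
  have h2 : (⟨presolvent L 0 y, hL.inv_mem y⟩ : D) = 0 := Subtype.ext h
  rw [h2, map_zero] at h1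
  exact neg_eq_zero.1 h1.symm

theorem resolvent_sub_inv {r : ℝ} (hr : 0 < r) :
    presolvent L r - presolvent L 0 = (-r) • (presolvent L r * presolvent L 0) := by
  rw [(hL.resolvent_spec (z := r) (by simpa using hr)).sub_eq (isResolventOf_presolvent hL.zero)]
  rw [zero_sub, ← Complex.ofReal_neg, Complex.coe_smul]

theorem resolvent_comm {z w : ℂ} (hz : 0 < z.re) (hw : 0 < w.re) :
    presolvent L z * presolvent L w = presolvent L w * presolvent L z := by
  by_cases h : z = w
  · rw [h]
  · have e1 := (hL.resolvent_spec hz).sub_eq (hL.resolvent_spec hw)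
    have e2 := (hL.resolvent_spec hw).sub_eq (hL.resolvent_spec hz)
    have h0 : w - z ≠ 0 := sub_ne_zero.2 (Ne.symm h)
    have e3 : (w - z) • (presolvent L z * presolvent L w)
        = (w - z) • (presolvent L w * presolvent L z) := by
      rw [← e1, ← neg_sub z w, neg_smul, ← e2, neg_sub]
    exact smul_right_injective _ h0 e3

/-- A sectorial operator in a Hilbert space is densely defined: the adjoints of the resolvents
are again a pseudo resolvent, with dense range, and `λ R(λ)^* → 1` strongly. -/
theorem dense : Dense (D : Set H) := by
  rw [Submodule.dense_iff_topologicalClosure_eq_top, Submodule.topologicalClosure_eq_top_iff,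
    Submodule.eq_bot_iff]
  intro x hx
  have hadj : ∀ r : ℝ, 0 < r → ContinuousLinearMap.adjoint (presolvent L (r : ℂ)) x = 0 := by
    intro r hr
    refine ext_inner_right ℂ fun y => ?_
    rw [ContinuousLinearMap.adjoint_inner_left, inner_zero_left]
    obtain ⟨m, -⟩ := (hL.resolvent_spec (z := r) (by simpa using hr)).1 y
    exact Submodule.inner_left_of_mem_orthogonal m hx
  have hbd : ∀ r : ℝ, 0 < r → ∀ u : H, ‖r • ContinuousLinearMap.adjoint (presolvent L (r : ℂ))
      (ContinuousLinearMap.adjoint (presolvent L (1 : ℂ)) u)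
      - ContinuousLinearMap.adjoint (presolvent L (1 : ℂ)) u‖ ≤ (c + c * c) / r * ‖u‖ := by
    intro r hr u
    have e := (hL.resolvent_spec (z := 1) (by simp)).sub_eq
      (hL.resolvent_spec (z := r) (by simpa using hr))
    set R₁ := presolvent L (1 : ℂ)
    set Rr := presolvent L (r : ℂ)
    have n1 : ‖R₁‖ ≤ c := by simpa using hL.resolvent_norm_le (z := 1) (by simp)
    have n2 : ‖Rr‖ ≤ c / r := hL.resolvent_norm_le_real hr
    have e2 : (r : ℂ) • (R₁ * Rr) - R₁ = R₁ * Rr - Rr := by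
      rw [sub_smul, one_smul] at e
      rw [eq_comm, sub_eq_iff_eq_add] at e
      rw [e]; abel
    have e3 : r • ContinuousLinearMap.adjoint Rr (ContinuousLinearMap.adjoint R₁ u)
        - ContinuousLinearMap.adjoint R₁ u = ContinuousLinearMap.adjoint (R₁ * Rr - Rr) u := by
      refine ext_inner_right ℂ fun y => ?_
      rw [ContinuousLinearMap.adjoint_inner_left, ← e2, inner_sub_left, ← Complex.coe_smul,
        inner_smul_left, ContinuousLinearMap.adjoint_inner_left,
        ContinuousLinearMap.adjoint_inner_left, ContinuousLinearMap.adjoint_inner_left]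
      change _ = inner ℂ u ((r : ℂ) • R₁ (Rr y) - R₁ y)
      rw [inner_sub_right, inner_smul_right, Complex.conj_ofReal]
    rw [e3]
    refine (ContinuousLinearMap.le_opNorm _ _).trans ?_
    gcongr
    rw [LinearIsometryEquiv.norm_map]
    calc ‖R₁ * Rr - Rr‖ ≤ ‖R₁‖ * ‖Rr‖ + ‖Rr‖ :=
          (norm_sub_le _ _).trans (by gcongr; exact norm_mul_le _ _)
      _ ≤ c * (c / r) + c / r := by have := hL.nonneg; gcongr
      _ = _ := by ring
  -- the range of `R(1)^*` is dense, because `R(1)` is injective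
  have hcl : x ∈ closure (Set.range (ContinuousLinearMap.adjoint (presolvent L (1 : ℂ)))) := by
    have h1 := ContinuousLinearMap.orthogonal_ker (presolvent L (1 : ℂ))
    have h2 : (presolvent L (1 : ℂ)).ker = ⊥ := by
      rw [LinearMap.ker_eq_bot']
      intro y hy
      obtain ⟨m, hm⟩ := (hL.resolvent_spec (z := 1) (by simp)).1 y
      have h3 : (⟨presolvent L 1 y, m⟩ : D) = 0 := Subtype.ext hy
      rw [h3, map_zero, sub_zero, one_smul] at hm
      rw [← hm]
      exact hy
    rw [h2, Submodule.bot_orthogonal_eq_top] at h1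
    have : x ∈ (ContinuousLinearMap.adjoint (presolvent L (1 : ℂ))).range.topologicalClosure := by
      rw [← h1]; trivial
    exact this
  by_contra hx0
  have hc := hL.nonneg
  have hpos : 0 < ‖x‖ := norm_pos_iff.2 hx0
  obtain ⟨_, ⟨u, rfl⟩, hu⟩ := Metric.mem_closure_iff.1 hcl (‖x‖ / (2 * (1 + c))) (by positivity)
  set v := ContinuousLinearMap.adjoint (presolvent L (1 : ℂ)) u with hv
  rw [dist_eq_norm] at hu
  have key : ∀ r : ℝ, 0 < r → ‖x‖ / 2 ≤ (c + c * c) / r * ‖u‖ := by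
    intro r hr
    have e : x = (x - v) - (r • ContinuousLinearMap.adjoint (presolvent L (r : ℂ)) v - v)
        - r • ContinuousLinearMap.adjoint (presolvent L (r : ℂ)) (x - v) := by
      rw [map_sub, hadj r hr, zero_sub, smul_neg]; abel
    have n : ‖r • ContinuousLinearMap.adjoint (presolvent L (r : ℂ)) (x - v)‖ ≤ c * ‖x - v‖ := by
      rw [norm_smul, Real.norm_of_nonneg hr.le]
      have h4 := (ContinuousLinearMap.adjoint (presolvent L (r : ℂ))).le_opNorm (x - v)
      rw [LinearIsometryEquiv.norm_map] at h4
      calc _ ≤ r * (c / r * ‖x - v‖) := by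
            gcongr
            exact h4.trans (by gcongr; exact hL.resolvent_norm_le_real hr)
        _ = _ := by field_simp
    have h5 : ‖x‖ ≤ ‖x - v‖ + (c + c * c) / r * ‖u‖ + c * ‖x - v‖ := by
      conv_lhs => rw [e]
      exact (norm_sub_le _ _).trans (add_le_add ((norm_sub_le _ _).trans
        (add_le_add le_rfl (hbd r hr u))) n)
    have h6 : (1 + c) * ‖x - v‖ ≤ ‖x‖ / 2 := by
      calc _ ≤ (1 + c) * (‖x‖ / (2 * (1 + c))) := by gcongr
        _ = _ := by field_simp
    linarith
  have hlim : Filter.Tendsto (fun r : ℝ => (c + c * c) / r * ‖u‖) Filter.atTop (nhds 0) := by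
    simpa using (Filter.Tendsto.const_div_atTop Filter.tendsto_id (c + c * c)).mul_const ‖u‖
  have := ge_of_tendsto hlim ((Filter.eventually_gt_atTop 0).mono key)
  linarith

theorem smul_resolvent_mul_inv {ν : ℝ} (hν : 0 < ν) :
    (ν • presolvent L (ν : ℂ) - 1) * presolvent L 0 = -presolvent L ν := by
  have := hL.resolvent_sub_inv hν
  rw [sub_mul, one_mul, smul_mul_assoc, neg_smul] at *
  rw [← neg_eq_iff_eq_neg] at this
  rw [← this]; abel

theorem resolvent_mul_inv_comm {ν : ℝ} (hν : 0 < ν) :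
    presolvent L (ν : ℂ) * presolvent L 0 = presolvent L 0 * presolvent L ν := by
  have e1 := hL.resolvent_sub_inv hν
  have e2 := (isResolventOf_presolvent hL.zero).sub_eq
    (hL.resolvent_spec (z := (ν : ℂ)) (by simpa using hν))
  rw [sub_zero, Complex.coe_smul] at e2
  have : ν • (presolvent L (ν : ℂ) * presolvent L 0) = ν • (presolvent L 0 * presolvent L ν) := by
    rw [← e2, ← neg_sub, e1, neg_smul, neg_neg]
  exact smul_right_injective _ hν.ne' this

theorem yosida_mul_inv {ν : ℝ} (hν : 0 < ν) : yosida L ν * yosidaInv L ν = 1 := by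
  have h := hL.smul_resolvent_mul_inv hν
  rw [yosida, yosidaInv, mul_neg, mul_add, smul_mul_assoc, h, mul_smul_comm, mul_one, smul_smul,
    inv_mul_cancel₀ hν.ne', one_smul, smul_neg]
  abel

theorem yosidaInv_mul {ν : ℝ} (hν : 0 < ν) : yosidaInv L ν * yosida L ν = 1 := by
  rw [← hL.yosida_mul_inv hν, yosida, yosidaInv]
  have h := hL.resolvent_mul_inv_comm hν
  simp only [neg_mul, mul_neg, add_mul, mul_add, sub_mul, mul_sub, smul_mul_assoc, mul_smul_comm,
    one_mul, mul_one, h]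
  module

/-- On the right half plane the resolvents of the Yosida approximations are bounded uniformly:
`w = z ν / (z + ν)` is in the right half plane as well, since `1 / w = 1 / z + 1 / ν`. -/
theorem yosida_halfPlane {ν : ℝ} (hν : 0 < ν) : HalfPlaneBound (1 + c) (yosida L ν) := by
  intro z hz
  have hzν : z + ν ≠ 0 := fun h => by
    have := congrArg Complex.re h
    simp at this
    linarith
  have hz0 : z ≠ 0 := fun h => by rw [h] at hz; simp at hz
  have hν0 : (ν : ℂ) ≠ 0 := by exact_mod_cast hν.ne'
  set w : ℂ := z * ν / (z + ν) with hw
  have hwi : w⁻¹ = z⁻¹ + (ν : ℂ)⁻¹ := by rw [hw]; field_simp; ring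
  have hw0 : 0 < w.re := by
    have h1 : 0 < (w⁻¹).re := by
      rw [hwi, ← Complex.ofReal_inv, Complex.add_re, Complex.ofReal_re, Complex.inv_re]
      have := Complex.normSq_pos.2 hz0
      positivity
    rw [Complex.inv_re] at h1
    by_contra h
    exact absurd h1 (not_lt.2 (div_nonpos_of_nonpos_of_nonneg (not_lt.1 h) (Complex.normSq_nonneg _)))
  have hνr : 0 < (ν : ℂ).re := by simpa using hν
  set S : H →L[ℂ] H := (z + ν)⁻¹ • (1 : H →L[ℂ] H) + (ν / (z + ν)) ^ 2 • presolvent L w with hS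
  have e := (hL.resolvent_spec hνr).sub_eq (hL.resolvent_spec hw0)
  have hcomm := hL.resolvent_comm hνr hw0
  have hY : algebraMap ℂ (H →L[ℂ] H) z - yosida L ν
      = (z + ν) • (1 : H →L[ℂ] H) - (ν ^ 2 : ℂ) • presolvent L (ν : ℂ) := by
    rw [yosida, Algebra.algebraMap_eq_smul_one, ← Complex.coe_smul, ← Complex.coe_smul, smul_sub,
      smul_smul, add_smul, pow_two]
    abel
  have hcoef : (w - ν) = -(ν ^ 2 / (z + ν)) := by rw [hw]; field_simp; ring
  rw [hcoef] at e
  set Q := presolvent L (ν : ℂ) * presolvent L w with hQ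
  have hw' : presolvent L w = presolvent L (ν : ℂ) + (ν ^ 2 / (z + ν)) • Q := by
    rw [neg_smul, sub_eq_iff_eq_add] at e
    rw [e]; abel
  have h1 : (algebraMap ℂ (H →L[ℂ] H) z - yosida L ν) * S = 1 := by
    have : (algebraMap ℂ (H →L[ℂ] H) z - yosida L ν) * S = 1 + ((z + ν) * (ν / (z + ν)) ^ 2) •
        presolvent L w - (ν ^ 2 * (z + ν)⁻¹) • presolvent L (ν : ℂ)
        - (ν ^ 2 * (ν / (z + ν)) ^ 2) • Q := by
      rw [hY, hS, sub_mul, mul_add, mul_add]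
      simp only [smul_mul_assoc, mul_smul_comm, one_mul, mul_one, smul_smul, ← hQ]
      match_scalars <;> field_simp
    rw [this, hw']
    match_scalars <;> field_simp <;> ring
  have h2 : S * (algebraMap ℂ (H →L[ℂ] H) z - yosida L ν) = 1 := by
    rw [← h1, hY, hS, sub_mul, mul_sub, mul_add, add_mul, add_mul, mul_add]
    simp only [smul_mul_assoc, mul_smul_comm, one_mul, mul_one, ← hcomm, ← hQ]
    module
  have hmem := spectrum.mem_resolventSet_of_left_right_inverse h1 h2
  have hRS : resolvent (yosida L ν) z = S := by
    have := resolvent_mul_self_sub hmem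
    calc _ = resolvent (yosida L ν) z * ((algebraMap ℂ (H →L[ℂ] H) z - yosida L ν) * S) := by
          rw [h1, mul_one]
      _ = S := by rw [← mul_assoc, this, one_mul]
  refine ⟨hmem, ?_⟩
  rw [hRS]
  have hc := hL.nonneg
  have hzn : 0 < ‖z‖ := norm_pos_iff.2 hz0
  have n1 : ‖z‖ ≤ ‖z + ν‖ := by
    rw [← sq_le_sq₀ (norm_nonneg _) (norm_nonneg _), ← Complex.normSq_eq_norm_sq,
      ← Complex.normSq_eq_norm_sq, Complex.normSq_apply, Complex.normSq_apply]
    simp only [Complex.add_re, Complex.ofReal_re, Complex.add_im, Complex.ofReal_im, add_zero]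
    nlinarith
  have n2 : ν ≤ ‖z + ν‖ := by
    have := Complex.re_le_norm (z + ν)
    simp only [Complex.add_re, Complex.ofReal_re] at this
    linarith
  have n3 : 0 < ‖z + ν‖ := norm_pos_iff.2 hzν
  have hwn : ‖w‖ = ‖z‖ * ν / ‖z + ν‖ := by
    rw [hw, norm_div, norm_mul, Complex.norm_real, Real.norm_of_nonneg hν.le]
  calc ‖S‖ ≤ ‖z + ν‖⁻¹ * 1 + (ν / ‖z + ν‖) ^ 2 * (c / ‖w‖) := by
        refine (norm_add_le _ _).trans (add_le_add ?_ ?_)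
        · rw [norm_smul, norm_inv]
          gcongr
          exact ContinuousLinearMap.norm_id_le
        · rw [norm_smul, norm_pow, norm_div, Complex.norm_real, Real.norm_of_nonneg hν.le]
          gcongr
          exact hL.resolvent_norm_le hw0
    _ = 1 / ‖z + ν‖ + ν / ‖z + ν‖ * (c / ‖z‖) := by
        rw [hwn]; field_simp
    _ ≤ 1 / ‖z‖ + 1 * (c / ‖z‖) := by
        gcongr
        exact (div_le_one n3).2 n2
    _ = _ := by ring

theorem smul_resolvent_sub_self {ν : ℝ} (hν : 0 < ν) (x : D) :
    ν • presolvent L (ν : ℂ) x - x = presolvent L (ν : ℂ) (L x) := by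
  have h := (hL.resolvent_spec (z := (ν : ℂ)) (by simpa using hν)).2 x
  rw [map_sub, map_smul, Complex.coe_smul] at h
  nth_rewrite 2 [← h]
  abel

theorem norm_smul_resolvent_le {ν : ℝ} (hν : 0 < ν) : ‖ν • presolvent L (ν : ℂ)‖ ≤ c := by
  rw [norm_smul, Real.norm_of_nonneg hν.le]
  calc _ ≤ ν * (c / ν) := by gcongr; exact hL.resolvent_norm_le_real hν
    _ = c := by field_simp

theorem yosida_apply {ν : ℝ} (hν : 0 < ν) (x : D) :
    yosida L ν x = (ν • presolvent L (ν : ℂ)) (L x) := by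
  have := hL.smul_resolvent_sub_self hν x
  change ν • (ν • presolvent L (ν : ℂ) x - x) = ν • presolvent L (ν : ℂ) (L x)
  rw [this]

end IsSectorialOp

/-- Strong convergence of uniformly bounded operators follows from convergence on a dense set. -/
theorem tendsto_apply_of_dense {E F : Type*} [NormedAddCommGroup E] [NormedSpace ℂ E]
    [NormedAddCommGroup F] [NormedSpace ℂ F] {ι : Type*} {l : Filter ι} {S : ι → E →L[ℂ] F}
    {S₀ : E →L[ℂ] F} {M : ℝ} (hS : ∀ i, ‖S i‖ ≤ M) {s : Set E} (hs : Dense s)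
    (h : ∀ x ∈ s, Filter.Tendsto (fun i => S i x) l (nhds (S₀ x))) (x : E) :
    Filter.Tendsto (fun i => S i x) l (nhds (S₀ x)) := by
  rw [Metric.tendsto_nhds]
  intro ε hε
  have hM : 0 ≤ max M 0 := le_max_right _ _
  obtain ⟨y, hy, hxy⟩ := Metric.mem_closure_iff.1 (hs x) (ε / (2 * (max M 0 + ‖S₀‖ + 1)))
    (by positivity)
  rw [dist_eq_norm] at hxy
  filter_upwards [Metric.tendsto_nhds.1 (h y hy) (ε / 2) (by positivity)] with i hi
  rw [dist_eq_norm] at hi ⊢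
  have e : S i x - S₀ x = S i (x - y) + (S i y - S₀ y) - S₀ (x - y) := by
    rw [map_sub, map_sub]; abel
  rw [e]
  have h1 : ‖S i (x - y)‖ ≤ max M 0 * ‖x - y‖ :=
    (S i).le_of_opNorm_le ((hS i).trans (le_max_left _ _)) _
  have h2 := S₀.le_opNorm (x - y)
  have h3 : (max M 0 + ‖S₀‖) * ‖x - y‖ ≤ ε / 2 := by
    calc _ ≤ (max M 0 + ‖S₀‖ + 1) * (ε / (2 * (max M 0 + ‖S₀‖ + 1))) :=
          mul_le_mul (by linarith) hxy.le (norm_nonneg _) (by positivity)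
      _ = ε / 2 := by field_simp
  calc _ ≤ ‖S i (x - y)‖ + ‖S i y - S₀ y‖ + ‖S₀ (x - y)‖ :=
        (norm_sub_le _ _).trans (add_le_add (norm_add_le _ _) le_rfl)
    _ < ε := by linarith

theorem IsSectorialOp.tendsto_smul_resolvent {c : ℝ} {L : D →ₗ[ℂ] H} (hL : IsSectorialOp c L)
    {ν : ℕ → ℝ} (hν : ∀ n, 0 < ν n) (hν' : Filter.Tendsto ν Filter.atTop Filter.atTop) (y : H) :
    Filter.Tendsto (fun n => (ν n • presolvent L (ν n : ℂ)) y) Filter.atTop (nhds y) := by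
  refine tendsto_apply_of_dense (S := fun n => ν n • presolvent L (ν n : ℂ))
    (S₀ := ContinuousLinearMap.id ℂ H) (M := c)
    (fun n => hL.norm_smul_resolvent_le (hν n)) hL.dense (fun x hx => ?_) y
  rw [tendsto_iff_norm_sub_tendsto_zero]
  have h0 : Filter.Tendsto (fun n => c / ν n * ‖L ⟨x, hx⟩‖) Filter.atTop (nhds 0) := by
    simpa using (hν'.const_div_atTop c).mul_const ‖L ⟨x, hx⟩‖
  refine squeeze_zero (fun _ => norm_nonneg _) (fun n => ?_) h0
  have e := hL.smul_resolvent_sub_self (hν n) ⟨x, hx⟩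
  change ‖ν n • presolvent L (ν n : ℂ) x - x‖ ≤ _
  rw [e]
  exact ContinuousLinearMap.le_of_opNorm_le _ (hL.resolvent_norm_le_real (hν n)) _

end Sectorial

/-! ### Uniformly sectorial families -/

section Family

variable {H : Type*} [NormedAddCommGroup H] [InnerProductSpace ℂ H] [CompleteSpace H]
variable {D : Submodule ℂ H}

/-- The part of the assumptions on `A(t)` which the construction of the evolution system uses:
uniform sectoriality in the half plane, uniformly bounded inverses, and the Lipschitz condition on
`t ↦ A(t)`, relative to `A(s)` for every `s`. -/
structure IsSectorialFamily (T c K : ℝ) (A : ℝ → D →ₗ[ℂ] H) : Prop where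
  sectorial : ∀ t ∈ Icc 0 T, IsSectorialOp c (A t)
  lip : ∀ s ∈ Icc 0 T, ∀ t ∈ Icc 0 T, ∀ x : D, ‖A t x - A s x‖ ≤ K * |t - s| * ‖A s x‖
  norm_inv_le : ∀ t ∈ Icc 0 T, ‖presolvent (A t) 0‖ ≤ K
  nonneg : 0 ≤ K

theorem negFracPow_one (L : D →ₗ[ℂ] H) : negFracPow L 1 = presolvent L 0 := by
  rw [negFracPow, if_neg one_ne_zero, if_pos rfl]

theorem IsSectorialOp.fracPow_one {c : ℝ} {L : D →ₗ[ℂ] H} (hL : IsSectorialOp c L) (x : D) :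
    ∃ h : (x : H) ∈ (fracPow L 1).domain, fracPow L 1 ⟨x, h⟩ = -L x := by
  have h1 : negFracPow L 1 (-L x) = x := by
    rw [negFracPow_one, map_neg, hL.inv_apply, neg_neg]
  refine ⟨mem_fracPow_domain.2 ⟨_, h1⟩, fracPow_eq_of_eq (fun w hw => ?_) h1 _⟩
  rw [negFracPow_one] at hw
  exact hL.inv_injective hw

theorem LinearPartAssumption.exists_isSectorialFamily {T : ℝ} (hT : 0 ≤ T) {A : ℝ → D →ₗ[ℂ] H}
    (hA : LinearPartAssumption T A) : ∃ c K, IsSectorialFamily T c K A := by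
  obtain ⟨c, hc, θ, hθ, hsec⟩ := hA.sectorial
  have hop : ∀ t ∈ Icc 0 T, IsSectorialOp c (A t) := fun t ht =>
    ⟨hA.invertible t ht, fun z hz => hsec t ht z
      ⟨fun h => by rw [h] at hz; simp at hz,
        (Complex.abs_arg_le_pi_div_two_iff.2 hz.le).trans hθ.1.le⟩⟩
  obtain ⟨K₁, hK₁, hlip⟩ := hA.lipschitz_right
  obtain ⟨K₂, hK₂, heq⟩ := hA.norm_equiv 1 ⟨zero_le_one, le_rfl⟩
  have h0 : (0 : ℝ) ∈ Icc 0 T := ⟨le_rfl, hT⟩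
  have hle : ∀ t ∈ Icc 0 T, ∀ x : D, ‖A 0 x‖ ≤ K₂ * ‖A t x‖ := by
    intro t ht x
    obtain ⟨m₀, e₀⟩ := (hop 0 h0).fracPow_one x
    obtain ⟨m, e⟩ := (hop t ht).fracPow_one x
    have := (heq t ht x m₀ m).1
    rwa [e₀, e, norm_neg, norm_neg, inv_mul_le_iff₀ hK₂] at this
  refine ⟨c, max (K₁ * K₂) (‖presolvent (A 0) 0‖ * K₂), hop, fun s hs t ht x => ?_, fun t ht => ?_,
    (by positivity : 0 ≤ K₁ * K₂).trans (le_max_left _ _)⟩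
  · calc ‖A t x - A s x‖ ≤ K₁ * |t - s| * ‖A 0 x‖ := hlip s hs t ht x
      _ ≤ K₁ * |t - s| * (K₂ * ‖A s x‖) := by gcongr; exact hle s hs x
      _ = K₁ * K₂ * |t - s| * ‖A s x‖ := by ring
      _ ≤ _ := by gcongr; exact le_max_left _ _
  · refine (ContinuousLinearMap.opNorm_le_bound _ (by positivity) fun y => ?_).trans
      (le_max_right _ _)
    have h1 := (hop 0 h0).inv_apply ⟨_, (hop t ht).inv_mem y⟩
    have h2 := hle t ht ⟨_, (hop t ht).inv_mem y⟩
    rw [(hop t ht).apply_inv, norm_neg] at h2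
    have h3 : ‖presolvent (A t) 0 y‖ = ‖presolvent (A 0) 0 (A 0 ⟨_, (hop t ht).inv_mem y⟩)‖ := by
      rw [h1, norm_neg]
    rw [h3, mul_assoc]
    exact ContinuousLinearMap.le_opNorm_of_le _ h2

namespace IsSectorialFamily

variable {T c K : ℝ} {A : ℝ → D →ₗ[ℂ] H} (hA : IsSectorialFamily T c K A)
include hA

theorem norm_apply_le {s t : ℝ} (hs : s ∈ Icc 0 T) (ht : t ∈ Icc 0 T) (x : D) :
    ‖A t x‖ ≤ (1 + K * T) * ‖A s x‖ := by
  have h1 : ‖A t x‖ ≤ ‖A s x‖ + ‖A t x - A s x‖ := by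
    simpa using norm_add_le (A s x) (A t x - A s x)
  have h2 := hA.lip s hs t ht x
  have h3 : |t - s| ≤ T := abs_sub_le_iff.2 ⟨by linarith [hs.1, ht.2], by linarith [hs.2, ht.1]⟩
  have h4 : K * |t - s| * ‖A s x‖ ≤ K * T * ‖A s x‖ := by
    have := hA.nonneg
    gcongr
  linarith

theorem continuousOn_apply (x : D) : ContinuousOn (fun t => A t x) (Icc 0 T) := by
  intro s hs
  rw [ContinuousWithinAt, tendsto_iff_norm_sub_tendsto_zero]
  have h0 : Filter.Tendsto (fun t => K * |t - s| * ‖A s x‖) (nhdsWithin s (Icc 0 T)) (nhds 0) := by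
    have : Continuous fun t => K * |t - s| * ‖A s x‖ := by fun_prop
    have := (this.tendsto s).mono_left (nhdsWithin_le_nhds (s := Icc 0 T))
    simpa using this
  refine squeeze_zero' (Filter.Eventually.of_forall fun _ => norm_nonneg _) ?_ h0
  filter_upwards [self_mem_nhdsWithin] with t ht using hA.lip s hs t ht x

/-- The Yosida approximations satisfy the assumptions uniformly in `ν ≥ 1`:
`A_ν(t) A_ν(s)⁻¹ - 1 = ν R(ν, A(t)) (A(t) - A(s)) A(s)⁻¹`. -/
theorem parabolicFamily {ν : ℝ} (hν : 1 ≤ ν) :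
    ParabolicFamily T (1 + c) (c * K + K + 1) (fun t => yosida (A t) ν)
      (fun t => yosidaInv (A t) ν) := by
  have hν0 : 0 < ν := by linarith
  have hK := hA.nonneg
  refine ⟨ContinuousLinearMap.norm_id_le, fun t ht => (hA.sectorial t ht).yosida_halfPlane hν0,
    fun t ht => (hA.sectorial t ht).yosida_mul_inv hν0,
    fun t ht => (hA.sectorial t ht).yosidaInv_mul hν0, fun t ht s hs => ?_, fun t ht => ?_⟩
  · have hc := (hA.sectorial t ht).nonneg
    refine ContinuousLinearMap.opNorm_le_bound _ (by positivity) fun y => ?_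
    have hm := (hA.sectorial s hs).inv_mem y
    have h1 : yosida (A t) ν * yosidaInv (A s) ν - 1
        = yosida (A t) ν * (presolvent (A t) 0 - presolvent (A s) 0) := by
      rw [← (hA.sectorial t ht).yosida_mul_inv hν0, ← mul_sub, yosidaInv, yosidaInv]
      congr 1; abel
    have h2 : (yosida (A t) ν * (presolvent (A t) 0 - presolvent (A s) 0)) y
        = -(ν • presolvent (A t) (ν : ℂ)) (A t ⟨_, hm⟩ - A s ⟨_, hm⟩) := by
      change yosida (A t) ν (presolvent (A t) 0 y - presolvent (A s) 0 y) = _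
      rw [map_sub, (hA.sectorial t ht).yosida_apply hν0 ⟨_, (hA.sectorial t ht).inv_mem y⟩,
        (hA.sectorial t ht).yosida_apply hν0 ⟨_, hm⟩, (hA.sectorial t ht).apply_inv,
        (hA.sectorial s hs).apply_inv, map_sub, neg_sub]
    have h3 := hA.lip s hs t ht ⟨_, hm⟩
    rw [(hA.sectorial s hs).apply_inv, norm_neg] at h3
    rw [h1, h2, norm_neg]
    calc _ ≤ c * ‖A t ⟨_, hm⟩ - A s ⟨_, hm⟩‖ :=
          ContinuousLinearMap.le_of_opNorm_le _ ((hA.sectorial t ht).norm_smul_resolvent_le hν0) _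
      _ ≤ c * (K * |t - s| * ‖y‖) := by
          gcongr
          rw [(hA.sectorial s hs).apply_inv]
          exact h3
      _ = c * K * |t - s| * ‖y‖ := by ring
      _ ≤ _ := by gcongr; linarith
  · have hc := (hA.sectorial t ht).nonneg
    change ‖-(presolvent (A t) 0 + ν⁻¹ • (1 : H →L[ℂ] H))‖ ≤ _
    rw [norm_neg]
    refine (norm_add_le _ _).trans ?_
    have h1 : ‖ν⁻¹ • (1 : H →L[ℂ] H)‖ ≤ 1 * 1 := by
      rw [norm_smul, Real.norm_of_nonneg (by positivity)]
      gcongr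
      · exact inv_le_one_of_one_le₀ hν
      · exact ContinuousLinearMap.norm_id_le
    have := hA.norm_inv_le t ht
    have : 0 ≤ c * K := by positivity
    linarith

end IsSectorialFamily

end Family

/-! ### Limits of operators and derivatives of integrals -/

section Limits

variable {E F : Type*} [NormedAddCommGroup E] [NormedSpace ℂ E] [NormedAddCommGroup F]
  [NormedSpace ℂ F]

/-- Uniformly bounded operators which converge on a dense set have a strong limit. -/
theorem exists_strong_limit [CompleteSpace F] {S : ℕ → E →L[ℂ] F} {M : ℝ} (hS : ∀ i, ‖S i‖ ≤ M)
    {s : Set E} (hs : Dense s)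
    (h : ∀ x ∈ s, ∃ y, Filter.Tendsto (fun i => S i x) Filter.atTop (nhds y)) :
    ∃ S₀ : E →L[ℂ] F, ‖S₀‖ ≤ M ∧
      ∀ x, Filter.Tendsto (fun i => S i x) Filter.atTop (nhds (S₀ x)) := by
  have hM : 0 ≤ M := (norm_nonneg _).trans (hS 0)
  have hc : ∀ x, CauchySeq fun i => S i x := by
    intro x
    rw [Metric.cauchySeq_iff']
    intro ε hε
    obtain ⟨y, hy, hxy⟩ := Metric.mem_closure_iff.1 (hs x) (ε / (3 * (M + 1))) (by positivity)
    obtain ⟨z, hz⟩ := h y hy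
    obtain ⟨N, hN⟩ := Metric.cauchySeq_iff'.1 hz.cauchySeq (ε / 3) (by positivity)
    refine ⟨N, fun n hn => ?_⟩
    have h1 := hN n hn
    rw [dist_eq_norm] at hxy h1 ⊢
    have e : S n x - S N x = S n (x - y) + (S n y - S N y) - S N (x - y) := by
      rw [map_sub, map_sub]; abel
    have h2 : ∀ i, ‖S i (x - y)‖ < ε / 3 := fun i => by
      calc _ ≤ M * ‖x - y‖ := (S i).le_of_opNorm_le (hS i) _
        _ ≤ (M + 1) * ‖x - y‖ := by gcongr; linarith
        _ < (M + 1) * (ε / (3 * (M + 1))) := by gcongr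
        _ = ε / 3 := by field_simp
    rw [e]
    calc _ ≤ ‖S n (x - y)‖ + ‖S n y - S N y‖ + ‖S N (x - y)‖ :=
          (norm_sub_le _ _).trans (add_le_add (norm_add_le _ _) le_rfl)
      _ < ε := by linarith [h2 n, h2 N]
  choose g hg using fun x => cauchySeq_tendsto_of_complete (hc x)
  let S₁ : E →ₗ[ℂ] F := linearMapOfTendsto g (fun n => (S n : E →ₗ[ℂ] F))
    (tendsto_pi_nhds.2 hg)
  have hb : ∀ x, ‖S₁ x‖ ≤ M * ‖x‖ := fun x =>
    le_of_tendsto (hg x).norm (Filter.Eventually.of_forall fun n => (S n).le_of_opNorm_le (hS n) x)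
  exact ⟨S₁.mkContinuous M hb, LinearMap.mkContinuous_norm_le _ hM _, hg⟩

theorem tendsto_apply_of_bounded {S : ℕ → E →L[ℂ] F} {S₀ : E →L[ℂ] F} {M : ℝ}
    (hS : ∀ i, ‖S i‖ ≤ M) {x : ℕ → E} {x₀ : E} (hx : Filter.Tendsto x Filter.atTop (nhds x₀))
    (h : Filter.Tendsto (fun i => S i x₀) Filter.atTop (nhds (S₀ x₀))) :
    Filter.Tendsto (fun i => S i (x i)) Filter.atTop (nhds (S₀ x₀)) := by
  have h1 : Filter.Tendsto (fun i => S i (x i - x₀)) Filter.atTop (nhds 0) := by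
    refine squeeze_zero_norm (a := fun i => M * ‖x i - x₀‖)
      (fun i => (S i).le_of_opNorm_le (hS i) _) ?_
    simpa using (tendsto_iff_norm_sub_tendsto_zero.1 hx).const_mul M
  have := h1.add h
  rw [zero_add] at this
  refine this.congr fun i => ?_
  rw [map_sub, sub_add_cancel]

theorem tendsto_apply_of_tendsto {S : ℕ → E →L[ℂ] F} {S₀ : E →L[ℂ] F}
    (hS : Filter.Tendsto S Filter.atTop (nhds S₀)) {x : ℕ → E} {x₀ : E}
    (hx : Filter.Tendsto x Filter.atTop (nhds x₀)) :
    Filter.Tendsto (fun i => S i (x i)) Filter.atTop (nhds (S₀ x₀)) :=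
  (isBoundedBilinearMap_apply.continuous.tendsto (S₀, x₀)).comp (hS.prodMk_nhds hx)

/-- One-sided version of the fundamental theorem of calculus on a compact interval. -/
theorem hasDerivWithinAt_of_eq_integral {E : Type*} [NormedAddCommGroup E] [NormedSpace ℝ E]
    [CompleteSpace E] {f g : ℝ → E} {a b : ℝ} (hab : a ≤ b) (hg : ContinuousOn g (Icc a b))
    (hf : ∀ r ∈ Icc a b, f r = f a + ∫ τ in a..r, g τ) {t : ℝ} (ht : t ∈ Icc a b) :
    HasDerivWithinAt f (g t) (Icc a b) t := by
  have hc : Continuous fun τ => g (projIcc a b hab τ) :=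
    (continuousOn_iff_continuous_domRestrict.1 hg).comp continuous_projIcc
  have h1 := (intervalIntegral.integral_hasDerivAt_right (hc.intervalIntegrable a t)
    (hc.stronglyMeasurableAtFilter _ _) hc.continuousAt).const_add (f a)
  rw [projIcc_of_mem hab ht] at h1
  have hr : ∀ r ∈ Icc a b, f r = f a + ∫ τ in a..r, g (projIcc a b hab τ) := by
    intro r hr
    rw [hf r hr]
    congr 1
    refine intervalIntegral.integral_congr fun τ hτ => ?_
    rw [uIcc_of_le hr.1] at hτ
    have : τ ∈ Icc a b := ⟨hτ.1, hτ.2.trans hr.2⟩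
    simp only [projIcc_of_mem hab this]
  exact h1.hasDerivWithinAt.congr hr (hr t ht)

end Limits

/-! ### The evolution system as the limit of the Yosida approximations -/

section Construction

open Filter Topology

variable {H : Type*} [NormedAddCommGroup H] [InnerProductSpace ℂ H] [CompleteSpace H]
variable {D : Submodule ℂ H}

/-- The Yosida approximation of `L` with parameter `n + 1`. -/
noncomputable def yosidaSeq (L : D →ₗ[ℂ] H) (n : ℕ) : H →L[ℂ] H := yosida L (n + 1)

/-- The inverse of `yosidaSeq L n`. -/
noncomputable def yosidaSeqInv (L : D →ₗ[ℂ] H) (n : ℕ) : H →L[ℂ] H := yosidaInv L (n + 1)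

namespace IsSectorialOp

variable {c : ℝ} {L : D →ₗ[ℂ] H} (hL : IsSectorialOp c L)
include hL

theorem norm_yosidaSeq_apply_le (n : ℕ) (x : D) : ‖yosidaSeq L n x‖ ≤ c * ‖L x‖ := by
  rw [yosidaSeq, hL.yosida_apply (by positivity)]
  exact ContinuousLinearMap.le_of_opNorm_le _ (hL.norm_smul_resolvent_le (by positivity)) _

theorem tendsto_yosidaSeq (x : D) : Tendsto (fun n => yosidaSeq L n x) atTop (𝓝 (L x)) := by
  have h := hL.tendsto_smul_resolvent (ν := fun n : ℕ => (n : ℝ) + 1) (fun n => by positivity)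
    (tendsto_atTop_add_const_right _ _ tendsto_natCast_atTop_atTop) (L x)
  refine h.congr fun n => ?_
  rw [yosidaSeq, hL.yosida_apply (by positivity)]

theorem yosidaSeqInv_mul (n : ℕ) : yosidaSeqInv L n * yosidaSeq L n = 1 :=
  hL.yosidaInv_mul (by positivity)

theorem yosidaSeq_mul_inv (n : ℕ) : yosidaSeq L n * yosidaSeqInv L n = 1 :=
  hL.yosida_mul_inv (by positivity)

end IsSectorialOp

theorem tendsto_yosidaSeqInv (L : D →ₗ[ℂ] H) :
    Tendsto (yosidaSeqInv L) atTop (𝓝 (-presolvent L 0)) := by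
  have h : Tendsto (fun n : ℕ => -(presolvent L 0 + ((n : ℝ) + 1)⁻¹ • (1 : H →L[ℂ] H))) atTop
      (𝓝 (-(presolvent L 0 + (0 : ℝ) • (1 : H →L[ℂ] H)))) :=
    ((tendsto_inv_atTop_zero.comp (tendsto_atTop_add_const_right _ (1 : ℝ)
      tendsto_natCast_atTop_atTop)).smul_const _).const_add _ |>.neg
  rwa [zero_smul, add_zero] at h

/-- The flows `W n` of the Yosida approximations of `A(t)`, with the uniform estimates and the
limits, as `n → ∞`, of the conjugated flows, of the flows and of `A_n(t) W_n(t, s)`. -/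
structure YosidaLimit (T M : ℝ) (A : ℝ → D →ₗ[ℂ] H) (W : ℕ → ℝ → ℝ → H →L[ℂ] H)
    (V U Z : ℝ → ℝ → H →L[ℂ] H) : Prop where
  flow : ∀ n, IsFlow T (fun t => yosidaSeq (A t) n) (W n)
  norm_flow : ∀ n s t, 0 ≤ s → s ≤ t → t ≤ T → ‖W n t s‖ ≤ M
  norm_conj : ∀ n s t, 0 ≤ s → s ≤ t → t ≤ T →
    ‖yosidaSeq (A t) n * (W n t s * yosidaSeqInv (A s) n)‖ ≤ M
  norm_gen : ∀ n s t, 0 ≤ s → s < t → t ≤ T → ‖yosidaSeq (A t) n * W n t s‖ ≤ M / (t - s)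
  norm_conj_sub : ∀ n s t, 0 ≤ s → s < t → t ≤ T →
    ‖yosidaSeq (A t) n * (W n t s * yosidaSeqInv (A s) n) - V t s‖
      ≤ M * ((n : ℝ) + 1)⁻¹ ^ (1 / 4 : ℝ) * (t - s) ^ (-(1 / 2) : ℝ)
  tendsto_conj : ∀ s t, 0 ≤ s → s ≤ t → t ≤ T →
    Tendsto (fun n => yosidaSeq (A t) n * (W n t s * yosidaSeqInv (A s) n)) atTop (𝓝 (V t s))
  norm_limit : ∀ s t, 0 ≤ s → s ≤ t → t ≤ T → ‖U t s‖ ≤ M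
  tendsto_flow : ∀ s t, 0 ≤ s → s ≤ t → t ≤ T → ∀ x,
    Tendsto (fun n => W n t s x) atTop (𝓝 (U t s x))
  norm_limit_gen : ∀ s t, 0 ≤ s → s < t → t ≤ T → ‖Z t s‖ ≤ M / (t - s)
  tendsto_gen : ∀ s t, 0 ≤ s → s < t → t ≤ T → ∀ x,
    Tendsto (fun n => (yosidaSeq (A t) n * W n t s) x) atTop (𝓝 (Z t s x))

theorem IsSectorialFamily.exists_yosidaLimit {T c K : ℝ} (hT : 0 ≤ T) {A : ℝ → D →ₗ[ℂ] H}
    (hA : IsSectorialFamily T c K A) : ∃ M W V U Z, 0 < M ∧ YosidaLimit T M A W V U Z := by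
  have hc := (hA.sectorial 0 ⟨le_rfl, hT⟩).nonneg
  have hK := hA.nonneg
  have hpar : ∀ n : ℕ, ParabolicFamily T (1 + c) (c * K + K + 1) (fun t => yosidaSeq (A t) n)
      (fun t => yosidaSeqInv (A t) n) := fun n =>
    hA.parabolicFamily (ν := (n : ℝ) + 1) (by linarith [n.cast_nonneg (α := ℝ)])
  choose W hW using fun n => exists_isFlow hT (hpar n).continuousOn
  obtain ⟨M, hM, hb, hcomp⟩ := exists_flow_bounds (H →L[ℂ] H) ContinuousLinearMap.norm_id_le hT
    (1 + c) (by positivity : 0 ≤ c * K + K + 1)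
  set Vn : ℕ → ℝ → ℝ → H →L[ℂ] H := fun n t s =>
    yosidaSeq (A t) n * (W n t s * yosidaSeqInv (A s) n) with hVn
  have hcmp : ∀ n p : ℕ, ∀ s t, 0 ≤ s → s < t → t ≤ T → ‖Vn n t s - Vn p t s‖
      ≤ M * |((p : ℝ) + 1)⁻¹ - ((n : ℝ) + 1)⁻¹| ^ (1 / 4 : ℝ) * (t - s) ^ (-(1 / 2) : ℝ) := by
    intro n p
    refine hcomp _ _ _ _ _ _ (hpar n) (hpar p) (hW n) (hW p) _ fun t _ => ?_
    rw [yosidaSeqInv, yosidaSeqInv, yosidaInv, yosidaInv]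
    module
  have hinv : Tendsto (fun n : ℕ => ((n : ℝ) + 1)⁻¹) atTop (𝓝 0) :=
    tendsto_inv_atTop_zero.comp (tendsto_atTop_add_const_right _ (1 : ℝ)
      tendsto_natCast_atTop_atTop)
  have hVex : ∀ t s, ∃ V : H →L[ℂ] H, 0 ≤ s → s ≤ t → t ≤ T →
      Tendsto (fun n => Vn n t s) atTop (𝓝 V) := by
    intro t s
    by_cases h : 0 ≤ s ∧ s ≤ t ∧ t ≤ T
    · obtain ⟨h0, h1, h2⟩ := h
      rcases h1.eq_or_lt with rfl | h1
      · have hs : s ∈ Icc 0 T := ⟨h0, h2⟩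
        refine ⟨1, fun _ _ _ => tendsto_const_nhds.congr fun n => ?_⟩
        simp only [hVn]
        rw [(hW n).refl s hs, one_mul, (hA.sectorial s hs).yosidaSeq_mul_inv]
      · have hC : CauchySeq fun n => Vn n t s := by
          refine cauchySeq_of_le_tendsto_0' (b := fun n : ℕ =>
            M * ((n : ℝ) + 1)⁻¹ ^ (1 / 4 : ℝ) * (t - s) ^ (-(1 / 2) : ℝ)) (fun n p hnp => ?_) ?_
          · rw [dist_eq_norm]
            refine (hcmp n p s t h0 h1 h2).trans ?_
            have : ((p : ℝ) + 1)⁻¹ ≤ ((n : ℝ) + 1)⁻¹ := by gcongr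
            rw [abs_sub_comm, abs_of_nonneg (by linarith)]
            have h3 : 0 ≤ (t - s) ^ (-(1 / 2) : ℝ) := Real.rpow_nonneg (by linarith) _
            have h4 : 0 ≤ ((p : ℝ) + 1)⁻¹ := by positivity
            gcongr
            · linarith
          · have := ((hinv.rpow_const (p := 1 / 4) (Or.inr (by norm_num))).const_mul M).mul_const
              ((t - s) ^ (-(1 / 2) : ℝ))
            rwa [Real.zero_rpow (by norm_num), mul_zero, zero_mul] at this
        obtain ⟨V, hV⟩ := cauchySeq_tendsto_of_complete hC
        exact ⟨V, fun _ _ _ => hV⟩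
    · exact ⟨0, fun h0 h1 h2 => absurd ⟨h0, h1, h2⟩ h⟩
  choose V hV using hVex
  have hdist : ∀ (n : ℕ) s t, 0 ≤ s → s < t → t ≤ T → ‖Vn n t s - V t s‖
      ≤ M * ((n : ℝ) + 1)⁻¹ ^ (1 / 4 : ℝ) * (t - s) ^ (-(1 / 2) : ℝ) := by
    intro n s t h0 h1 h2
    have e1 := (tendsto_const_nhds (x := Vn n t s)).sub (hV t s h0 h1.le h2) |>.norm
    have e2 := (((hinv.sub (tendsto_const_nhds (x := ((n : ℝ) + 1)⁻¹))).abs.rpow_const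
      (p := 1 / 4) (Or.inr (by norm_num))).const_mul M).mul_const ((t - s) ^ (-(1 / 2) : ℝ))
    rw [zero_sub, abs_neg, abs_of_nonneg (by positivity)] at e2
    exact le_of_tendsto_of_tendsto' e1 e2 fun p => hcmp n p s t h0 h1 h2
  -- `W_n(t, s) A_n(s)⁻¹ = A_n(t)⁻¹ V_n(t, s)` converges, and `A(s)⁻¹` has dense range
  have hUex : ∀ t s, ∃ U : H →L[ℂ] H, 0 ≤ s → s ≤ t → t ≤ T →
      ‖U‖ ≤ M ∧ ∀ x, Tendsto (fun n => W n t s x) atTop (𝓝 (U x)) := by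
    intro t s
    by_cases h : 0 ≤ s ∧ s ≤ t ∧ t ≤ T
    · obtain ⟨h0, h1, h2⟩ := h
      have hs : s ∈ Icc 0 T := ⟨h0, h1.trans h2⟩
      have ht : t ∈ Icc 0 T := ⟨h0.trans h1, h2⟩
      obtain ⟨U, hU⟩ := exists_strong_limit (S := fun n => W n t s)
        (fun n => (hb _ _ _ (hpar n) (hW n) s t h0 h1 h2).1) (hA.sectorial s hs).dense (by
          intro x hx
          refine ⟨(-presolvent (A t) 0 * V t s) (A s ⟨x, hx⟩), ?_⟩
          have e := tendsto_apply_of_tendsto ((tendsto_yosidaSeqInv (A t)).mul (hV t s h0 h1 h2))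
            ((hA.sectorial s hs).tendsto_yosidaSeq ⟨x, hx⟩)
          refine e.congr fun n => ?_
          have e1 : (yosidaSeqInv (A t) n * Vn n t s) * yosidaSeq (A s) n = W n t s := by
            simp only [hVn]
            rw [← mul_assoc (yosidaSeqInv (A t) n), (hA.sectorial t ht).yosidaSeqInv_mul, one_mul,
              mul_assoc, (hA.sectorial s hs).yosidaSeqInv_mul, mul_one]
          exact congrArg (fun S : H →L[ℂ] H => S x) e1)
      exact ⟨U, fun _ _ _ => hU⟩
    · exact ⟨0, fun h0 h1 h2 => absurd ⟨h0, h1, h2⟩ h⟩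
  choose U hU using hUex
  have hZex : ∀ t s, ∃ Z : H →L[ℂ] H, 0 ≤ s → s < t → t ≤ T → ‖Z‖ ≤ M / (t - s) ∧
      ∀ x, Tendsto (fun n => (yosidaSeq (A t) n * W n t s) x) atTop (𝓝 (Z x)) := by
    intro t s
    by_cases h : 0 ≤ s ∧ s < t ∧ t ≤ T
    · obtain ⟨h0, h1, h2⟩ := h
      have hs : s ∈ Icc 0 T := ⟨h0, h1.le.trans h2⟩
      obtain ⟨Z, hZ⟩ := exists_strong_limit (S := fun n => yosidaSeq (A t) n * W n t s)
        (fun n => (hb _ _ _ (hpar n) (hW n) s t h0 h1.le h2).2.2 h1)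
        (hA.sectorial s hs).dense (by
          intro x hx
          refine ⟨V t s (A s ⟨x, hx⟩), ?_⟩
          refine (tendsto_apply_of_tendsto (hV t s h0 h1.le h2)
            ((hA.sectorial s hs).tendsto_yosidaSeq ⟨x, hx⟩)).congr fun n => ?_
          have e1 : Vn n t s * yosidaSeq (A s) n = yosidaSeq (A t) n * W n t s := by
            simp only [hVn]
            rw [mul_assoc, mul_assoc, (hA.sectorial s hs).yosidaSeqInv_mul, mul_one]
          exact congrArg (fun S : H →L[ℂ] H => S x) e1)
      exact ⟨Z, fun _ _ _ => hZ⟩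
    · exact ⟨0, fun h0 h1 h2 => absurd ⟨h0, h1, h2⟩ h⟩
  choose Z hZ using hZex
  exact ⟨M, W, V, U, Z, hM, hW, fun n s t h0 h1 h2 => (hb _ _ _ (hpar n) (hW n) s t h0 h1 h2).1,
    fun n s t h0 h1 h2 => (hb _ _ _ (hpar n) (hW n) s t h0 h1 h2).2.1,
    fun n s t h0 h1 h2 => (hb _ _ _ (hpar n) (hW n) s t h0 h1.le h2).2.2 h1, hdist,
    fun s t => hV t s, fun s t h0 h1 h2 => (hU t s h0 h1 h2).1,
    fun s t h0 h1 h2 => (hU t s h0 h1 h2).2, fun s t h0 h1 h2 => (hZ t s h0 h1 h2).1,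
    fun s t h0 h1 h2 => (hZ t s h0 h1 h2).2⟩

end Construction

section Construction

open Filter Topology

variable {H : Type*} [NormedAddCommGroup H] [InnerProductSpace ℂ H] [CompleteSpace H]
variable {D : Submodule ℂ H}

theorem hasDerivAt_apply {S : ℝ → H →L[ℂ] H} {S' : H →L[ℂ] H} {t : ℝ} (h : HasDerivAt S S' t)
    (v : H) : HasDerivAt (fun r => S r v) (S' v) t :=
  ((ContinuousLinearMap.apply ℂ H v).restrictScalars ℝ).hasFDerivAt.comp_hasDerivAt t h

namespace YosidaLimit

variable {T c K M : ℝ} {A : ℝ → D →ₗ[ℂ] H} {W : ℕ → ℝ → ℝ → H →L[ℂ] H}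
  {V U Z : ℝ → ℝ → H →L[ℂ] H} (hY : YosidaLimit T M A W V U Z) (hA : IsSectorialFamily T c K A)
include hY

theorem refl {s : ℝ} (hs : s ∈ Icc 0 T) : U s s = ContinuousLinearMap.id ℂ H := by
  ext x
  refine tendsto_nhds_unique (hY.tendsto_flow s s hs.1 le_rfl hs.2 x)
    (tendsto_const_nhds.congr fun n => ?_)
  rw [(hY.flow n).refl s hs]; rfl

theorem comp {s r t : ℝ} (hs : 0 ≤ s) (hsr : s ≤ r) (hrt : r ≤ t) (ht : t ≤ T) :
    (U t r).comp (U r s) = U t s := by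
  ext x
  have h1 := tendsto_apply_of_bounded (fun n => hY.norm_flow n r t (hs.trans hsr) hrt ht)
    (hY.tendsto_flow s r hs hsr (hrt.trans ht) x) (hY.tendsto_flow r t (hs.trans hsr) hrt ht _)
  refine tendsto_nhds_unique h1 ((hY.tendsto_flow s t hs (hsr.trans hrt) ht x).congr fun n => ?_)
  rw [← (hY.flow n).comp s ⟨hs, by linarith⟩ r ⟨by linarith, by linarith⟩ t ⟨by linarith, ht⟩]
  rfl

theorem norm_conj_limit {s t : ℝ} (hs : 0 ≤ s) (hst : s ≤ t) (ht : t ≤ T) : ‖V t s‖ ≤ M :=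
  le_of_tendsto (hY.tendsto_conj s t hs hst ht).norm
    (Eventually.of_forall fun n => hY.norm_conj n s t hs hst ht)

include hA

theorem flow_apply_eq {s t : ℝ} (hs : 0 ≤ s) (hst : s ≤ t) (ht : t ≤ T) (x : D) :
    U t s x = -presolvent (A t) 0 (V t s (A s x)) := by
  have hs' : s ∈ Icc 0 T := ⟨hs, hst.trans ht⟩
  refine tendsto_nhds_unique (hY.tendsto_flow s t hs hst ht x) ?_
  refine (tendsto_apply_of_tendsto ((tendsto_yosidaSeqInv (A t)).mul
    (hY.tendsto_conj s t hs hst ht))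
    ((hA.sectorial s hs').tendsto_yosidaSeq x)).congr fun n => ?_
  have e1 : (yosidaSeqInv (A t) n * (yosidaSeq (A t) n * (W n t s * yosidaSeqInv (A s) n)))
      * yosidaSeq (A s) n = W n t s := by
    rw [← mul_assoc (yosidaSeqInv (A t) n), (hA.sectorial t ⟨hs.trans hst, ht⟩).yosidaSeqInv_mul,
      one_mul, mul_assoc, (hA.sectorial s hs').yosidaSeqInv_mul, mul_one]
  exact congrArg (fun S : H →L[ℂ] H => S x) e1

theorem flow_apply_eq_of_lt {s t : ℝ} (hs : 0 ≤ s) (hst : s < t) (ht : t ≤ T) (v : H) :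
    U t s v = -presolvent (A t) 0 (Z t s v) := by
  refine tendsto_nhds_unique (hY.tendsto_flow s t hs hst.le ht v) ?_
  refine (tendsto_apply_of_tendsto (tendsto_yosidaSeqInv (A t))
    (hY.tendsto_gen s t hs hst ht v)).congr fun n => ?_
  have e1 : yosidaSeqInv (A t) n * (yosidaSeq (A t) n * W n t s) = W n t s := by
    rw [← mul_assoc, (hA.sectorial t ⟨hs.trans hst.le, ht⟩).yosidaSeqInv_mul, one_mul]
  exact congrArg (fun S : H →L[ℂ] H => S v) e1

theorem exists_mem_apply_eq {t : ℝ} (ht : t ∈ Icc 0 T) {u y : H}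
    (h : u = -presolvent (A t) 0 y) : ∃ m : u ∈ D, A t ⟨u, m⟩ = y := by
  rw [← map_neg] at h
  subst h
  exact ⟨(hA.sectorial t ht).inv_mem _, by rw [(hA.sectorial t ht).apply_inv, neg_neg]⟩

/-- `A(t) U(t, s) = V(t, m) A(m) U(m, s)`, where `V(t, m) = A(t) U(t, m) A(m)⁻¹`; this transfers the
norm continuity of `V(·, m)` to `A(t) U(t, s)`. -/
theorem flow_mul {s m t : ℝ} (hs : 0 ≤ s) (hsm : s < m) (hmt : m ≤ t) (ht : t ≤ T) :
    Z t s = V t m * Z m s := by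
  ext v
  refine tendsto_nhds_unique (hY.tendsto_gen s t hs (hsm.trans_le hmt) ht v) ?_
  refine (tendsto_apply_of_tendsto (hY.tendsto_conj m t (hs.trans hsm.le) hmt ht)
    (hY.tendsto_gen s m hs hsm (hmt.trans ht) v)).congr fun n => ?_
  have hm : m ∈ Icc 0 T := ⟨hs.trans hsm.le, hmt.trans ht⟩
  have e1 : (yosidaSeq (A t) n * (W n t m * yosidaSeqInv (A m) n)) *
      (yosidaSeq (A m) n * W n m s) = yosidaSeq (A t) n * W n t s := by
    rw [← (hY.flow n).comp s ⟨hs, by linarith⟩ m hm t ⟨by linarith, ht⟩, mul_assoc, mul_assoc,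
      ← mul_assoc (yosidaSeqInv (A m) n), (hA.sectorial m hm).yosidaSeqInv_mul, one_mul]
  exact congrArg (fun S : H →L[ℂ] H => S v) e1

theorem continuousOn_yosidaSeq (n : ℕ) : ContinuousOn (fun t => yosidaSeq (A t) n) (Icc 0 T) :=
  (hA.parabolicFamily (ν := (n : ℝ) + 1) (by linarith [n.cast_nonneg (α := ℝ)])).continuousOn

/-- The conjugated flows converge uniformly as long as `t - m` is bounded below. -/
theorem continuousOn_conj_limit {m t₀ : ℝ} (hm : 0 ≤ m) (hmt : m < t₀) :
    ContinuousOn (fun t => V t m) (Icc t₀ T) := by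
  have hu : TendstoUniformlyOn
      (fun (n : ℕ) t => yosidaSeq (A t) n * (W n t m * yosidaSeqInv (A m) n))
      (fun t => V t m) atTop (Icc t₀ T) := by
    rw [Metric.tendstoUniformlyOn_iff]
    intro ε hε
    have hinv : Tendsto (fun n : ℕ => ((n : ℝ) + 1)⁻¹) atTop (𝓝 0) :=
      tendsto_inv_atTop_zero.comp (tendsto_atTop_add_const_right _ (1 : ℝ)
        tendsto_natCast_atTop_atTop)
    have h0 := ((hinv.rpow_const (p := 1 / 4) (Or.inr (by norm_num))).const_mul |M|).mul_const
      ((t₀ - m) ^ (-(1 / 2) : ℝ))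
    rw [Real.zero_rpow (by norm_num), mul_zero, zero_mul] at h0
    filter_upwards [h0.eventually_lt_const hε] with n hn t ht
    rw [dist_comm, dist_eq_norm]
    refine ((hY.norm_conj_sub n m t hm (hmt.trans_le ht.1) ht.2).trans ?_).trans_lt hn
    have h3 : (t - m) ^ (-(1 / 2) : ℝ) ≤ (t₀ - m) ^ (-(1 / 2) : ℝ) :=
      Real.rpow_le_rpow_of_nonpos (by linarith) (by linarith [ht.1]) (by norm_num)
    have h4 : 0 ≤ (t - m) ^ (-(1 / 2) : ℝ) := Real.rpow_nonneg (by linarith [ht.1]) _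
    gcongr
    exact le_abs_self M
  refine hu.continuousOn (Frequently.of_forall fun n => ?_)
  by_cases hT : m ≤ T
  · have hsub : Icc t₀ T ⊆ Icc 0 T := Icc_subset_Icc_left (by linarith)
    exact ((hY.continuousOn_yosidaSeq hA n).mono hsub).mul
      ((((hY.flow n).continuousOn_fst ⟨hm, hT⟩).mono hsub).mul continuousOn_const)
  · rw [Icc_eq_empty (by linarith)]
    exact continuousOn_empty _

theorem continuousOn_gen {s t₀ : ℝ} (hs : 0 ≤ s) (hst : s < t₀) :
    ContinuousOn (fun t => Z t s) (Icc t₀ T) := by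
  have h := (hY.continuousOn_conj_limit hA (m := (s + t₀) / 2) (by linarith)
    (by linarith : _ < t₀)).mul (continuousOn_const (c := Z ((s + t₀) / 2) s))
  exact h.congr fun t ht => hY.flow_mul hA hs (by linarith) (by linarith [ht.1]) ht.2

theorem eq_add_integral_gen {s t₀ t : ℝ} (hs : 0 ≤ s) (hst : s < t₀) (htt : t₀ ≤ t) (ht : t ≤ T) :
    U t s = U t₀ s + ∫ τ in t₀..t, Z τ s := by
  have hsub : Icc t₀ t ⊆ Icc 0 T := Icc_subset_Icc (by linarith) ht
  have hsm : s ∈ Icc 0 T := ⟨hs, by linarith⟩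
  ext v
  have hint : IntervalIntegrable (fun τ => Z τ s) volume t₀ t :=
    ((hY.continuousOn_gen hA hs hst).mono (Icc_subset_Icc_right ht)).intervalIntegrable_of_Icc htt
  have hev : (∫ τ in t₀..t, Z τ s) v = ∫ τ in t₀..t, Z τ s v :=
    ((ContinuousLinearMap.apply ℂ H v).intervalIntegral_comp_comm hint).symm
  rw [add_apply, hev]
  have hcn : ∀ n, ContinuousOn (fun τ => (yosidaSeq (A τ) n * W n τ s) v) (Icc t₀ t) := fun n =>
    (((hY.continuousOn_yosidaSeq hA n).mono hsub).mul
      (((hY.flow n).continuousOn_fst hsm).mono hsub)).clm_apply continuousOn_const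
  have h1 : Tendsto (fun n => W n t₀ s v + ∫ τ in t₀..t, (yosidaSeq (A τ) n * W n τ s) v) atTop
      (𝓝 (U t₀ s v + ∫ τ in t₀..t, Z τ s v)) := by
    refine (hY.tendsto_flow s t₀ hs hst.le (htt.trans ht) v).add ?_
    refine intervalIntegral.tendsto_integral_filter_of_dominated_convergence
      (fun _ => |M| / (t₀ - s) * ‖v‖) (Eventually.of_forall fun n => ?_)
      (Eventually.of_forall fun n => ?_) intervalIntegrable_const ?_
    · rw [uIoc_of_le htt]
      exact ((hcn n).mono Ioc_subset_Icc_self).aestronglyMeasurable measurableSet_Ioc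
    · refine Eventually.of_forall fun τ hτ => ?_
      rw [uIoc_of_le htt] at hτ
      refine (ContinuousLinearMap.le_of_opNorm_le _
        (hY.norm_gen n s τ hs (hst.trans hτ.1) (hτ.2.trans ht)) v).trans ?_
      have : 0 < t₀ - s := by linarith
      gcongr
      · exact le_abs_self M
      · exact hτ.1.le
    · refine Eventually.of_forall fun τ hτ => ?_
      rw [uIoc_of_le htt] at hτ
      exact hY.tendsto_gen s τ hs (hst.trans hτ.1) (hτ.2.trans ht) v
  refine tendsto_nhds_unique (hY.tendsto_flow s t hs (hst.le.trans htt) ht v) (h1.congr fun n => ?_)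
  have h2 := intervalIntegral.integral_eq_sub_of_hasDerivAt_of_le htt
    (f := fun τ => W n τ s v) (f' := fun τ => (yosidaSeq (A τ) n * W n τ s) v)
    ((((hY.flow n).continuousOn_fst hsm).mono hsub).clm_apply continuousOn_const)
    (fun τ hτ => by
      have := hasDerivAt_apply ((hY.flow n).deriv_fst s hsm τ (hsub (Ioo_subset_Icc_self hτ))) v
      simpa using this) ((hcn n).intervalIntegrable_of_Icc htt)
  rw [h2]; abel

/-- On `D` the approximations are Lipschitz continuous in both variables, uniformly in `n`. -/
theorem exists_lipschitz (hM : 0 ≤ M) (x : D) : ∃ L, 0 ≤ L ∧ ∀ s t s' t', 0 ≤ s → s ≤ t → t ≤ T →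
    0 ≤ s' → s' ≤ t' → t' ≤ T → ‖U t s x - U t' s' x‖ ≤ L * (2 * |t - t'| + |s - s'|) := by
  by_cases hT : 0 ≤ T
  swap
  · exact ⟨0, le_rfl, fun s t s' t' h0 h1 h2 => absurd ((h0.trans h1).trans h2) hT⟩
  have h0T : (0 : ℝ) ∈ Icc 0 T := ⟨le_rfl, hT⟩
  have hc := (hA.sectorial 0 h0T).nonneg
  have hK := hA.nonneg
  set L := M * (c * ((1 + K * T) * ‖A 0 x‖)) with hL
  have hB : ∀ n, ∀ s ∈ Icc 0 T, ‖yosidaSeq (A s) n x‖ ≤ c * ((1 + K * T) * ‖A 0 x‖) := fun n s hs =>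
    ((hA.sectorial s hs).norm_yosidaSeq_apply_le n x).trans
      (by gcongr; exact hA.norm_apply_le h0T hs x)
  have hfst : ∀ s t t', 0 ≤ s → s ≤ t → t ≤ t' → t' ≤ T → ‖U t' s x - U t s x‖ ≤ L * |t - t'| := by
    intro s t t' h0 h1 h2 h3
    have hs : s ∈ Icc 0 T := ⟨h0, by linarith⟩
    refine le_of_tendsto ((hY.tendsto_flow s t' h0 (h1.trans h2) h3 x).sub
      (hY.tendsto_flow s t h0 h1 (h2.trans h3) x)).norm (Eventually.of_forall fun n => ?_)
    have := norm_image_sub_le_of_norm_deriv_le_segment' (f := fun r => W n r s x)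
      (f' := fun r => (yosidaSeq (A r) n * W n r s) x) (C := L) (a := t) (b := t')
      (fun r hr => by
        have := hasDerivAt_apply ((hY.flow n).deriv_fst s hs r ⟨by linarith [hr.1], by linarith [hr.2]⟩) (x : H)
        simpa using this.hasDerivWithinAt) (fun r hr => by
        have e : yosidaSeq (A r) n * W n r s
            = yosidaSeq (A r) n * (W n r s * yosidaSeqInv (A s) n) * yosidaSeq (A s) n := by
          rw [mul_assoc, mul_assoc, (hA.sectorial s hs).yosidaSeqInv_mul, mul_one]
        have hr' : r ∈ Icc 0 T := ⟨by linarith [hr.1], by linarith [hr.2]⟩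
        rw [e]
        exact ContinuousLinearMap.le_of_opNorm_le_of_le
          (yosidaSeq (A r) n * (W n r s * yosidaSeqInv (A s) n)) (hY.norm_conj n s r h0 (h1.trans hr.1) hr'.2) (hB n s hs)) t' ⟨h2, le_rfl⟩
    rwa [abs_sub_comm, abs_of_nonneg (by linarith)]
  have hsnd : ∀ s s' t, 0 ≤ s → s ≤ s' → s' ≤ t → t ≤ T →
      ‖U t s' x - U t s x‖ ≤ L * |s - s'| := by
    intro s s' t h0 h1 h2 h3
    have ht : t ∈ Icc 0 T := ⟨by linarith, h3⟩
    refine le_of_tendsto ((hY.tendsto_flow s' t (h0.trans h1) h2 h3 x).sub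
      (hY.tendsto_flow s t h0 (h1.trans h2) h3 x)).norm (Eventually.of_forall fun n => ?_)
    have := norm_image_sub_le_of_norm_deriv_le_segment' (f := fun r => W n t r x)
      (f' := fun r => (-(W n t r * yosidaSeq (A r) n)) x) (C := L) (a := s) (b := s')
      (fun r hr => by
        have := hasDerivAt_apply ((hY.flow n).deriv_snd r ⟨by linarith [hr.1], by linarith [hr.2]⟩ t ht) (x : H)
        simpa using this.hasDerivWithinAt) (fun r hr => by
        rw [neg_apply, norm_neg]
        exact ContinuousLinearMap.le_of_opNorm_le_of_le (W n t r)
          (hY.norm_flow n r t (h0.trans hr.1) (by linarith [hr.2]) h3)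
          (hB n r ⟨by linarith [hr.1], by linarith [hr.2]⟩)) s' ⟨h1, le_rfl⟩
    rwa [abs_sub_comm, abs_of_nonneg (by linarith)]
  have hfst' : ∀ s t t', 0 ≤ s → s ≤ t → s ≤ t' → t ≤ T → t' ≤ T →
      ‖U t s x - U t' s x‖ ≤ L * |t - t'| := by
    intro s t t' h0 h1 h1' h2 h2'
    rcases le_total t t' with h | h
    · rw [norm_sub_rev]; exact hfst s t t' h0 h1 h h2'
    · rw [abs_sub_comm]; exact hfst s t' t h0 h1' h h2
  have hsnd' : ∀ s s' t, 0 ≤ s → 0 ≤ s' → s ≤ t → s' ≤ t → t ≤ T →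
      ‖U t s x - U t s' x‖ ≤ L * |s - s'| := by
    intro s s' t h0 h0' h1 h1' h2
    rcases le_total s s' with h | h
    · rw [norm_sub_rev]; exact hsnd s s' t h0 h h1' h2
    · rw [abs_sub_comm]; exact hsnd s' s t h0' h h1 h2
  have hL0 : 0 ≤ L := by positivity
  refine ⟨L, hL0, fun s t s' t' h0 h1 h2 h0' h1' h2' => ?_⟩
  -- pass through the points `(max t t', s)` and `(max t t', s')` of the triangle
  have k1 := le_max_left t t'
  have k2 := le_max_right t t'
  have k3 : max t t' ≤ T := max_le h2 h2'
  have e1 := hfst' s t (max t t') h0 h1 (h1.trans k1) h2 k3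
  have e2 := hsnd' s s' (max t t') h0 h0' (h1.trans k1) (h1'.trans k2) k3
  have e3 := hfst' s' (max t t') t' h0' (h1'.trans k2) h1' k3 h2'
  have e4 : |t - max t t'| + |max t t' - t'| ≤ 2 * |t - t'| := by
    rcases le_total t t' with h | h
    · rw [max_eq_right h, sub_self, abs_zero]; linarith [abs_nonneg (t - t')]
    · rw [max_eq_left h, sub_self, abs_zero]; linarith [abs_nonneg (t - t')]
  calc ‖U t s x - U t' s' x‖
      = ‖(U t s x - U (max t t') s x) + (U (max t t') s x - U (max t t') s' x)
        + (U (max t t') s' x - U t' s' x)‖ := by congr 1; abel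
    _ ≤ L * |t - max t t'| + L * |s - s'| + L * |max t t' - t'| :=
        (norm_add₃_le ..).trans (by gcongr)
    _ = L * ((|t - max t t'| + |max t t' - t'|) + |s - s'|) := by ring
    _ ≤ _ := by gcongr

/-- Joint strong continuity: Lipschitz continuity on the dense subspace `D`, and uniform bounds. -/
theorem strongly_continuous (hM : 0 ≤ M) (hT : 0 ≤ T) (v : H) :
    ContinuousOn (fun p : ℝ × ℝ => U p.1 p.2 v) {p | 0 ≤ p.2 ∧ p.2 ≤ p.1 ∧ p.1 ≤ T} := by
  have hx : ∀ x : D, ContinuousOn (fun p : ℝ × ℝ => U p.1 p.2 x)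
      {p | 0 ≤ p.2 ∧ p.2 ≤ p.1 ∧ p.1 ≤ T} := by
    intro x p hp
    obtain ⟨L, hL, h⟩ := hY.exists_lipschitz hA hM x
    rw [ContinuousWithinAt, tendsto_iff_norm_sub_tendsto_zero]
    have hlim : Tendsto (fun q : ℝ × ℝ => L * (2 * |q.1 - p.1| + |q.2 - p.2|))
        (𝓝[{p | 0 ≤ p.2 ∧ p.2 ≤ p.1 ∧ p.1 ≤ T}] p) (𝓝 0) := by
      have hc : Continuous fun q : ℝ × ℝ => L * (2 * |q.1 - p.1| + |q.2 - p.2|) := by fun_prop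
      simpa using (hc.tendsto p).mono_left nhdsWithin_le_nhds
    refine squeeze_zero' (Eventually.of_forall fun _ => norm_nonneg _) ?_ hlim
    filter_upwards [self_mem_nhdsWithin] with q hq
    exact h _ _ _ _ hq.1 hq.2.1 hq.2.2 hp.1 hp.2.1 hp.2.2
  refine continuousOn_of_uniform_approx_of_continuousOn fun u hu => ?_
  obtain ⟨ε, hε, hεu⟩ := Metric.mem_uniformity_dist.1 hu
  obtain ⟨x, hxD, hvx⟩ := Metric.mem_closure_iff.1
    ((hA.sectorial 0 ⟨le_rfl, hT⟩).dense v) (ε / (M + 1)) (by positivity)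
  refine ⟨_, hx ⟨x, hxD⟩, fun p hp => hεu ?_⟩
  rw [dist_eq_norm] at hvx ⊢
  rw [← map_sub]
  calc _ ≤ M * ‖v - x‖ := ContinuousLinearMap.le_of_opNorm_le _
        (hY.norm_limit _ _ hp.1 hp.2.1 hp.2.2) _
    _ ≤ (M + 1) * ‖v - x‖ := by gcongr; linarith
    _ < (M + 1) * (ε / (M + 1)) := by gcongr
    _ = ε := by field_simp

theorem continuousOn_apply_generator (hM : 0 ≤ M) (hT : 0 ≤ T) {t : ℝ} (ht : t ≤ T) (x : D) :
    ContinuousOn (fun s => U t s (A s x)) (Icc 0 t) := by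
  intro s hs
  have h1 : Tendsto (fun r => U t r (A s x)) (𝓝[Icc 0 t] s) (𝓝 (U t s (A s x))) := by
    have := ((hY.strongly_continuous hA hM hT (A s x)).comp (f := fun r : ℝ => (t, r))
      (s := Icc 0 t) (by fun_prop) (fun r hr => ⟨hr.1, hr.2, ht⟩)) s hs
    exact this
  have h2 : Tendsto (fun r => U t r (A r x - A s x)) (𝓝[Icc 0 t] s) (𝓝 0) := by
    have h3 := ((hA.continuousOn_apply x s ⟨hs.1, hs.2.trans ht⟩).mono
      (Icc_subset_Icc_right ht : Icc 0 t ⊆ Icc 0 T))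
    have h4 := (tendsto_iff_norm_sub_tendsto_zero.1 h3).const_mul M
    rw [mul_zero] at h4
    refine squeeze_zero_norm' ?_ h4
    filter_upwards [self_mem_nhdsWithin] with r hr
    exact ContinuousLinearMap.le_of_opNorm_le _ (hY.norm_limit r t hr.1 hr.2 ht) _
  have h3 := h2.add h1
  rw [zero_add] at h3
  exact h3.congr fun r => by rw [map_sub, sub_add_cancel]

theorem eq_sub_integral_apply_generator (hT : 0 ≤ T) {s t : ℝ} (hs : 0 ≤ s)
    (hst : s ≤ t) (ht : t ≤ T) (x : D) :
    U t s x = U t 0 x + ∫ τ in (0 : ℝ)..s, -(U t τ (A τ x)) := by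
  have htm : t ∈ Icc 0 T := ⟨hs.trans hst, ht⟩
  have h0T : (0 : ℝ) ∈ Icc 0 T := ⟨le_rfl, hT⟩
  have hsub : Icc 0 s ⊆ Icc 0 T := Icc_subset_Icc_right (hst.trans ht)
  have hc := (hA.sectorial 0 h0T).nonneg
  have hK := hA.nonneg
  have hcn : ∀ n, ContinuousOn (fun τ => (-(W n t τ * yosidaSeq (A τ) n)) x) (Icc 0 s) := fun n =>
    ((((hY.flow n).continuousOn_snd htm).mono hsub).mul
      ((hY.continuousOn_yosidaSeq hA n).mono hsub)).neg.clm_apply continuousOn_const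
  have h1 : Tendsto (fun n => W n t 0 x + ∫ τ in (0 : ℝ)..s, (-(W n t τ * yosidaSeq (A τ) n)) x)
      atTop (𝓝 (U t 0 x + ∫ τ in (0 : ℝ)..s, -(U t τ (A τ x)))) := by
    refine (hY.tendsto_flow 0 t le_rfl htm.1 ht x).add ?_
    refine intervalIntegral.tendsto_integral_filter_of_dominated_convergence
      (fun _ => M * (c * ((1 + K * T) * ‖A 0 x‖))) (Eventually.of_forall fun n => ?_)
      (Eventually.of_forall fun n => ?_) intervalIntegrable_const ?_
    · rw [uIoc_of_le hs]
      exact ((hcn n).mono Ioc_subset_Icc_self).aestronglyMeasurable measurableSet_Ioc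
    · refine Eventually.of_forall fun τ hτ => ?_
      rw [uIoc_of_le hs] at hτ
      have hτ' := hsub (Ioc_subset_Icc_self hτ)
      rw [neg_apply, norm_neg]
      exact ContinuousLinearMap.le_of_opNorm_le_of_le (W n t τ)
        (hY.norm_flow n τ t hτ'.1 (hτ.2.trans hst) ht)
        (((hA.sectorial τ hτ').norm_yosidaSeq_apply_le n x).trans
          (by gcongr; exact hA.norm_apply_le h0T hτ' x))
    · refine Eventually.of_forall fun τ hτ => ?_
      rw [uIoc_of_le hs] at hτ
      have hτ' := hsub (Ioc_subset_Icc_self hτ)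
      have := tendsto_apply_of_bounded
        (fun n => hY.norm_flow n τ t hτ'.1 (hτ.2.trans hst) ht)
        ((hA.sectorial τ hτ').tendsto_yosidaSeq x)
        (hY.tendsto_flow τ t hτ'.1 (hτ.2.trans hst) ht _)
      exact this.neg
  refine tendsto_nhds_unique (hY.tendsto_flow s t hs hst ht x) (h1.congr fun n => ?_)
  have h2 := intervalIntegral.integral_eq_sub_of_hasDerivAt_of_le hs
    (f := fun τ => W n t τ x) (f' := fun τ => (-(W n t τ * yosidaSeq (A τ) n)) x)
    ((((hY.flow n).continuousOn_snd htm).mono hsub).clm_apply continuousOn_const)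
    (fun τ hτ => by
      have := hasDerivAt_apply ((hY.flow n).deriv_snd τ (hsub (Ioo_subset_Icc_self hτ)) t htm) (x : H)
      simpa using this) ((hcn n).intervalIntegrable_of_Icc hs)
  rw [h2]; abel

theorem isEvolutionSystemOf (hM : 0 < M) (hT : 0 ≤ T) : IsEvolutionSystemOf T A U where
  refl s hs := hY.refl hs
  comp s r t h0 h1 h2 h3 := hY.comp h0 h1 h2 h3
  strongly_continuous := hY.strongly_continuous hA hM.le hT
  bounds := by
    refine ⟨M, hM, hY.norm_limit, fun s t h0 h1 h2 v => ?_, fun s t h0 h1 h2 x => ?_⟩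
    · obtain ⟨m, h⟩ := hY.exists_mem_apply_eq hA ⟨h0.trans h1.le, h2⟩
        (hY.flow_apply_eq_of_lt hA h0 h1 h2 v)
      exact ⟨m, h ▸ ContinuousLinearMap.le_of_opNorm_le _ (hY.norm_limit_gen s t h0 h1 h2) v⟩
    · obtain ⟨m, h⟩ := hY.exists_mem_apply_eq hA ⟨h0.trans h1, h2⟩
        (hY.flow_apply_eq hA h0 h1 h2 x)
      exact ⟨m, h ▸ ContinuousLinearMap.le_of_opNorm_le _ (hY.norm_conj_limit h0 h1 h2) _⟩
  deriv_fst := by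
    refine ⟨Z, fun s hs => ⟨fun t ht => ?_, fun t ht => ⟨?_, fun v => ?_⟩⟩⟩
    · have h1 := hY.continuousOn_gen hA hs.1 (t₀ := (s + t) / 2) (by linarith [ht.1]) t
        ⟨by linarith [ht.1], ht.2⟩
      refine h1.mono_of_mem_nhdsWithin ?_
      filter_upwards [self_mem_nhdsWithin,
        mem_nhdsWithin_of_mem_nhds (Ioi_mem_nhds (by linarith [ht.1] : (s + t) / 2 < t))]
        with r hr hr' using ⟨le_of_lt hr', hr.2⟩
    · have hst : s < (s + t) / 2 := by linarith [ht.1]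
      have h1 := hasDerivWithinAt_of_eq_integral (f := fun r => U r s) (a := (s + t) / 2) (b := T)
        (by linarith [ht.1, ht.2]) (hY.continuousOn_gen hA hs.1 hst)
        (fun r hr => hY.eq_add_integral_gen hA hs.1 hst hr.1 hr.2) (t := t)
        ⟨by linarith [ht.1], ht.2⟩
      refine h1.mono_of_mem_nhdsWithin ?_
      filter_upwards [self_mem_nhdsWithin,
        mem_nhdsWithin_of_mem_nhds (Ioi_mem_nhds (by linarith [ht.1] : (s + t) / 2 < t))]
        with r hr hr' using ⟨le_of_lt hr', hr.2⟩
    · obtain ⟨m, h⟩ := hY.exists_mem_apply_eq hA ⟨hs.1.trans ht.1.le, ht.2⟩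
        (hY.flow_apply_eq_of_lt hA hs.1 ht.1 ht.2 v)
      exact ⟨m, h.symm⟩
  deriv_snd t ht x := by
    have hc := hY.continuousOn_apply_generator hA hM.le hT ht.2 x
    refine ⟨hc.mono Ico_subset_Icc_self, fun s hs => ?_⟩
    exact hasDerivWithinAt_of_eq_integral (f := fun r => U t r x) ht.1.le hc.neg
      (fun r hr => hY.eq_sub_integral_apply_generator hA hT hr.1 hr.2 ht.2 x) hs

end YosidaLimit

theorem IsSectorialFamily.exists_isEvolutionSystemOf {T c K : ℝ} (hT : 0 ≤ T)
    {A : ℝ → D →ₗ[ℂ] H} (hA : IsSectorialFamily T c K A) : ∃ U, IsEvolutionSystemOf T A U := by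
  obtain ⟨M, W, V, U, Z, hM, hY⟩ := hA.exists_yosidaLimit hT
  exact ⟨U, hY.isEvolutionSystemOf hA hM hT⟩

end Construction

/-! ### Uniqueness of the evolution system and mild solutions -/

section Mild

open Filter Topology

variable {H : Type*} [NormedAddCommGroup H] [InnerProductSpace ℂ H] [CompleteSpace H]
variable {D : Submodule ℂ H} {T : ℝ} {A : ℝ → D →ₗ[ℂ] H} {U : ℝ → ℝ → H →L[ℂ] H}

namespace IsEvolutionSystemOf

theorem exists_norm_le (hU : IsEvolutionSystemOf T A U) :
    ∃ K₀ > 0, ∀ s t : ℝ, 0 ≤ s → s ≤ t → t ≤ T → ‖U t s‖ ≤ K₀ :=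
  let ⟨K₀, h, h', _⟩ := hU.bounds
  ⟨K₀, h, h'⟩

theorem continuousOn_apply (hU : IsEvolutionSystemOf T A U) {X : Type*} [TopologicalSpace X]
    {a b : X → ℝ} {g : X → H} {S : Set X} (ha : ContinuousOn a S) (hb : ContinuousOn b S)
    (hg : ContinuousOn g S) (h : ∀ x ∈ S, 0 ≤ b x ∧ b x ≤ a x ∧ a x ≤ T) :
    ContinuousOn (fun x => U (a x) (b x) (g x)) S := by
  obtain ⟨K₀, hK, hb'⟩ := hU.exists_norm_le
  intro x hx
  have h1 : Tendsto (fun r => U (a r) (b r) (g x)) (𝓝[S] x) (𝓝 (U (a x) (b x) (g x))) :=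
    ((hU.strongly_continuous (g x)).comp (ha.prodMk hb) h) x hx
  have h2 : Tendsto (fun r => U (a r) (b r) (g r - g x)) (𝓝[S] x) (𝓝 0) := by
    have h4 := (tendsto_iff_norm_sub_tendsto_zero.1 (hg x hx)).const_mul K₀
    rw [mul_zero] at h4
    refine squeeze_zero_norm' ?_ h4
    filter_upwards [self_mem_nhdsWithin] with r hr
    exact ContinuousLinearMap.le_of_opNorm_le _ (hb' _ _ (h r hr).1 (h r hr).2.1 (h r hr).2.2) _
  have h3 := h2.add h1
  rw [zero_add] at h3
  exact h3.congr fun r => by rw [map_sub, sub_add_cancel]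

theorem hasDerivAt_apply (hU : IsEvolutionSystemOf T A U) {t τ : ℝ} (hτ : τ ∈ Ioo 0 t)
    (ht : t ≤ T) {y : ℝ → H} {y' : H} (hy : HasDerivAt y y' τ) (hm : y τ ∈ D) :
    HasDerivAt (fun r => U t r (y r)) (U t τ (y' - A τ ⟨y τ, hm⟩)) τ := by
  have h1 : HasDerivAt (fun r => U t r (y τ)) (-(U t τ (A τ ⟨y τ, hm⟩))) τ :=
    ((hU.deriv_snd t ⟨hτ.1.trans hτ.2, ht⟩ ⟨y τ, hm⟩).2 τ (Ioo_subset_Icc_self hτ)).hasDerivAt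
      (Icc_mem_nhds hτ.1 hτ.2)
  have h2 : HasDerivAt (fun r => U t r (y r - y τ)) (U t τ y') τ := by
    rw [hasDerivAt_iff_tendsto_slope]
    obtain ⟨K₀, hK, hb'⟩ := hU.exists_norm_le
    have hIoo : ∀ᶠ r in 𝓝[≠] τ, r ∈ Ioo 0 t :=
      mem_nhdsWithin_of_mem_nhds (Ioo_mem_nhds hτ.1 hτ.2)
    have h3 : Tendsto (fun r => U t r y') (𝓝[≠] τ) (𝓝 (U t τ y')) := by
      have := (hU.continuousOn_apply (S := Ioo 0 t) (a := fun _ => t) (b := fun r => r)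
        continuousOn_const continuousOn_id (continuousOn_const (c := y'))
        (fun r hr => ⟨hr.1.le, hr.2.le, ht⟩)).continuousAt (Ioo_mem_nhds hτ.1 hτ.2)
      exact this.tendsto.mono_left nhdsWithin_le_nhds
    have h4 : Tendsto (fun r => U t r (slope y τ r - y')) (𝓝[≠] τ) (𝓝 0) := by
      have h4 := (tendsto_iff_norm_sub_tendsto_zero.1 (hasDerivAt_iff_tendsto_slope.1 hy)).const_mul
        K₀
      rw [mul_zero] at h4
      refine squeeze_zero_norm' ?_ h4
      filter_upwards [hIoo] with r hr
      exact ContinuousLinearMap.le_of_opNorm_le _ (hb' _ _ hr.1.le hr.2.le ht) _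
    have h5 := h4.add h3
    rw [zero_add] at h5
    refine h5.congr fun r => ?_
    rw [map_sub, sub_add_cancel, slope_def_module, slope_def_module, sub_self, map_zero, sub_zero]
    exact (ContinuousLinearMap.map_smul_of_tower _ _ _)
  have h3 := h2.add h1
  rw [← sub_eq_add_neg, ← map_sub] at h3
  refine h3.congr_of_eventuallyEq (Eventually.of_forall fun r => ?_)
  change U t r (y r) = U t r (y r - y τ) + U t r (y τ)
  rw [map_sub, sub_add_cancel]

/-- Variation of constants: a strong solution of `y' = A y + g` on `(s, t)`, continuous on
`[s, t]`, is given by the evolution system. -/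
theorem eq_add_integral (hU : IsEvolutionSystemOf T A U) {s t : ℝ} (hs : 0 ≤ s) (hst : s ≤ t)
    (ht : t ≤ T) {y g : ℝ → H} (hy : ContinuousOn y (Icc s t))
    (hd : ∀ τ ∈ Ioo s t, ∃ m : y τ ∈ D, HasDerivAt y (A τ ⟨y τ, m⟩ + g τ) τ)
    (hg : IntervalIntegrable (fun τ => U t τ (g τ)) volume s t) :
    y t = U t s (y s) + ∫ τ in s..t, U t τ (g τ) := by
  have h := intervalIntegral.integral_eq_sub_of_hasDerivAt_of_le hst
    (f := fun τ => U t τ (y τ)) (f' := fun τ => U t τ (g τ))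
    (hU.continuousOn_apply continuousOn_const continuousOn_id hy
      fun τ hτ => ⟨hs.trans hτ.1, hτ.2, ht⟩)
    (fun τ hτ => by
      obtain ⟨m, h⟩ := hd τ hτ
      simpa using hU.hasDerivAt_apply ⟨hs.trans_lt hτ.1, hτ.2⟩ ht h m) hg
  rw [h, hU.refl t ⟨hs.trans hst, ht⟩]
  simp

theorem eq_of_hasDerivAt (hU : IsEvolutionSystemOf T A U) {s t : ℝ} (hs : 0 ≤ s) (hst : s ≤ t)
    (ht : t ≤ T) {y : ℝ → H} (hy : ContinuousOn y (Icc s t))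
    (hd : ∀ τ ∈ Ioo s t, ∃ m : y τ ∈ D, HasDerivAt y (A τ ⟨y τ, m⟩) τ) : y t = U t s (y s) := by
  have h := hU.eq_add_integral hs hst ht (g := fun _ => 0) hy (by simpa using hd) (by simp)
  simpa using h

theorem continuousOn_fst (hU : IsEvolutionSystemOf T A U) {s : ℝ} (hs : 0 ≤ s) (v : H) :
    ContinuousOn (fun τ => U τ s v) (Icc s T) :=
  hU.continuousOn_apply continuousOn_id continuousOn_const continuousOn_const
    fun _ hτ => ⟨hs, hτ.1, hτ.2⟩

theorem exists_hasDerivAt_fst (hU : IsEvolutionSystemOf T A U) {s τ : ℝ} (hs : 0 ≤ s)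
    (hτ : τ ∈ Ioo s T) (v : H) :
    ∃ m : U τ s v ∈ D, HasDerivAt (fun r => U r s v) (A τ ⟨U τ s v, m⟩) τ := by
  obtain ⟨V, hV⟩ := hU.deriv_fst
  obtain ⟨-, h⟩ := hV s ⟨hs, hτ.1.trans hτ.2⟩
  obtain ⟨h1, h2⟩ := h τ (Ioo_subset_Ioc_self hτ)
  obtain ⟨m, h2⟩ := h2 v
  exact ⟨m, h2 ▸ _root_.hasDerivAt_apply (h1.hasDerivAt (Icc_mem_nhds hτ.1 hτ.2)) v⟩

theorem unique (hU : IsEvolutionSystemOf T A U) {V : ℝ → ℝ → H →L[ℂ] H}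
    (hV : IsEvolutionSystemOf T A V) {s t : ℝ} (hs : 0 ≤ s) (hst : s ≤ t) (ht : t ≤ T) :
    V t s = U t s := by
  ext v
  have h := hU.eq_of_hasDerivAt hs hst ht (y := fun τ => V τ s v)
    ((hV.continuousOn_fst hs v).mono (Icc_subset_Icc_right ht))
    fun τ hτ => hV.exists_hasDerivAt_fst hs ⟨hτ.1, hτ.2.trans_le ht⟩ v
  rw [hV.refl s ⟨hs, hst.trans ht⟩] at h
  exact h

end IsEvolutionSystemOf

variable {F : ℝ → H → H} {K₄ : ℝ}

theorem continuousOn_nonlinearity (hF : ∀ s ∈ Icc 0 T, ∀ t ∈ Icc 0 T, ∀ u v : H,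
    ‖F t u - F s v‖ ≤ K₄ * (|t - s| + ‖u - v‖)) {u : ℝ → H} (hu : ContinuousOn u (Icc 0 T)) :
    ContinuousOn (fun s => F s (u s)) (Icc 0 T) := by
  intro s hs
  rw [ContinuousWithinAt, tendsto_iff_norm_sub_tendsto_zero]
  have h1 : Tendsto (fun r => |r - s|) (𝓝[Icc 0 T] s) (𝓝 0) := by
    have : Continuous fun r : ℝ => |r - s| := by fun_prop
    simpa using (this.tendsto s).mono_left (nhdsWithin_le_nhds (s := Icc 0 T))
  have h2 := (h1.add (tendsto_iff_norm_sub_tendsto_zero.1 (hu s hs))).const_mul K₄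
  rw [add_zero, mul_zero] at h2
  refine squeeze_zero' (Eventually.of_forall fun _ => norm_nonneg _) ?_ h2
  filter_upwards [self_mem_nhdsWithin] with r hr using hF s hs r hr _ _

namespace IsEvolutionSystemOf

theorem exists_isMildSolution (hU : IsEvolutionSystemOf T A U) (hT : 0 ≤ T) (hK₄ : 0 ≤ K₄)
    (hF : ∀ s ∈ Icc 0 T, ∀ t ∈ Icc 0 T, ∀ u v : H, ‖F t u - F s v‖ ≤ K₄ * (|t - s| + ‖u - v‖))
    (u₀ : H) : ∃ u, IsMildSolution T U F u₀ u := by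
  obtain ⟨K₀, hK₀, hb⟩ := hU.exists_norm_le
  have hint : ∀ u : ℝ → H, ContinuousOn u (Icc 0 T) → ∀ t ∈ Icc 0 T,
      ContinuousOn (fun s => U t s (F s (u s))) (Icc 0 t) := fun u hu t ht =>
    hU.continuousOn_apply continuousOn_const continuousOn_id
      ((continuousOn_nonlinearity hF hu).mono (Icc_subset_Icc_right ht.2))
      fun s hs => ⟨hs.1, hs.2, ht.2⟩
  obtain ⟨u, hu, h⟩ := exists_volterra_fixedPoint (T := T) (L := K₀ * K₄) hT (by positivity)
    (fun u t => U t 0 u₀ + ∫ s in (0 : ℝ)..t, U t s (F s (u s))) (fun u hu => by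
      refine (hU.continuousOn_fst le_rfl u₀).add ?_
      -- extend the integrand to a continuous function on the plane
      have hFu : Continuous fun s : ℝ => F (projIcc 0 T hT s) (u (projIcc 0 T hT s)) :=
        (continuousOn_iff_continuous_domRestrict.1
          (continuousOn_nonlinearity hF hu.continuousOn)).comp continuous_projIcc
      have hp : Continuous fun s : ℝ => (projIcc 0 T hT s : ℝ) :=
        continuous_subtype_val.comp continuous_projIcc
      have hc : Continuous fun t : ℝ => ∫ s in (0 : ℝ)..t, U (projIcc 0 T hT t)
          (min (projIcc 0 T hT s : ℝ) (projIcc 0 T hT t)) (F (projIcc 0 T hT s)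
            (u (projIcc 0 T hT s))) := by
        refine intervalIntegral.continuous_parametric_intervalIntegral_of_continuous
          (s := fun t => t) (a₀ := 0) ?_ continuous_id
        rw [← continuousOn_univ]
        exact hU.continuousOn_apply (hp.comp continuous_fst).continuousOn
          ((hp.comp continuous_snd).min (hp.comp continuous_fst)).continuousOn
          (hFu.comp continuous_snd).continuousOn fun p _ =>
            ⟨le_min (projIcc 0 T hT p.2).2.1 (projIcc 0 T hT p.1).2.1, min_le_right _ _,
              (projIcc 0 T hT p.1).2.2⟩
      refine hc.continuousOn.congr fun t ht => intervalIntegral.integral_congr fun s hs => ?_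
      rw [uIcc_of_le ht.1] at hs
      have hs' : s ∈ Icc 0 T := ⟨hs.1, hs.2.trans ht.2⟩
      simp only [projIcc_of_mem hT ht, projIcc_of_mem hT hs', min_eq_left hs.2]) (by
      intro u v hu hv t ht
      have hu' := (hint u hu.continuousOn t ht).intervalIntegrable_of_Icc (μ := volume) ht.1
      have hv' := (hint v hv.continuousOn t ht).intervalIntegrable_of_Icc (μ := volume) ht.1
      rw [add_sub_add_left_eq_sub, ← intervalIntegral.integral_sub hu' hv',
        ← intervalIntegral.integral_const_mul]
      refine intervalIntegral.norm_integral_le_of_norm_le ht.1 (Eventually.of_forall fun s hs => ?_)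
        ((by fun_prop : Continuous fun s => K₀ * K₄ * ‖u s - v s‖).intervalIntegrable _ _)
      have hs' : s ∈ Icc 0 T := ⟨hs.1.le, hs.2.trans ht.2⟩
      rw [← map_sub, mul_assoc]
      have := hF s hs' s hs' (u s) (v s)
      rw [sub_self, abs_zero, zero_add] at this
      exact ContinuousLinearMap.le_of_opNorm_le_of_le _ (hb s t hs'.1 hs.2 ht.2) this)
  refine ⟨u, hu.continuousOn, ?_, fun t ht => ?_, fun t ht => h t (Ioc_subset_Icc_self ht)⟩
  · rw [h 0 ⟨le_rfl, hT⟩, hU.refl 0 ⟨le_rfl, hT⟩]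
    simp
  · exact (hint u hu.continuousOn t (Ioc_subset_Icc_self ht)).intervalIntegrable_of_Icc ht.1.le

theorem mildSolution_unique (hU : IsEvolutionSystemOf T A U) (hK₄ : 0 ≤ K₄)
    (hF : ∀ s ∈ Icc 0 T, ∀ t ∈ Icc 0 T, ∀ u v : H, ‖F t u - F s v‖ ≤ K₄ * (|t - s| + ‖u - v‖))
    {u₀ : H} {u w : ℝ → H} (hu : IsMildSolution T U F u₀ u) (hw : IsMildSolution T U F u₀ w) :
    EqOn w u (Icc 0 T) := by
  obtain ⟨K₀, hK₀, hb⟩ := hU.exists_norm_le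
  have hg := gronwall_const (f := fun t => ‖w t - u t‖) (a := 0) (b := T) (L := K₀ * K₄)
    (S := T) (M := 0) (by positivity) (by simp) le_rfl (hw.continuousOn.sub hu.continuousOn).norm
    (fun t ht => by
      rw [zero_add, hw.eq t ht, hu.eq t ht, add_sub_add_left_eq_sub,
        ← intervalIntegral.integral_sub (hw.integrable t ht) (hu.integrable t ht),
        ← intervalIntegral.integral_const_mul]
      have hc : ContinuousOn (fun s => K₀ * K₄ * ‖w s - u s‖) (Icc 0 t) :=
        continuousOn_const.mul
          ((hw.continuousOn.sub hu.continuousOn).norm.mono (Icc_subset_Icc_right ht.2))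
      refine intervalIntegral.norm_integral_le_of_norm_le ht.1.le
        (Eventually.of_forall fun s hs => ?_) (hc.intervalIntegrable_of_Icc ht.1.le)
      have hs' : s ∈ Icc 0 T := ⟨hs.1.le, hs.2.trans ht.2⟩
      rw [← map_sub, mul_assoc]
      have := hF s hs' s hs' (w s) (u s)
      rw [sub_self, abs_zero, zero_add] at this
      exact ContinuousLinearMap.le_of_opNorm_le_of_le _ (hb s t hs'.1 hs.2 ht.2) this)
  intro t ht
  rcases ht.1.eq_or_lt with rfl | h0
  · rw [hw.initial, hu.initial]
  · have := hg t ⟨h0, ht.2⟩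
    rw [mul_zero] at this
    exact sub_eq_zero.1 (norm_le_zero_iff.1 this)

/-- By Gronwall's inequality `F(t, u(t))` grows at most linearly in `u₀`, along mild solutions. -/
theorem exists_mildSolution_bound (hU : IsEvolutionSystemOf T A U) (hT : 0 ≤ T) (hK₄ : 0 ≤ K₄)
    (hF : ∀ s ∈ Icc 0 T, ∀ t ∈ Icc 0 T, ∀ u v : H, ‖F t u - F s v‖ ≤ K₄ * (|t - s| + ‖u - v‖)) :
    ∃ C, 0 ≤ C ∧ ∀ u₀ u, IsMildSolution T U F u₀ u → ∀ t ∈ Icc 0 T,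
      ‖F t (u t)‖ ≤ C * (1 + ‖u₀‖) := by
  obtain ⟨K₀, hK₀, hb⟩ := hU.exists_norm_le
  have h0T : (0 : ℝ) ∈ Icc 0 T := ⟨le_rfl, hT⟩
  set N := ‖F 0 0‖ + K₄ * T with hN
  have hFn : ∀ s ∈ Icc 0 T, ∀ v, ‖F s v‖ ≤ N + K₄ * ‖v‖ := by
    intro s hs v
    have h1 := hF 0 h0T s hs v 0
    rw [sub_zero, sub_zero, abs_of_nonneg hs.1] at h1
    have h2 : ‖F s v‖ ≤ ‖F s v - F 0 0‖ + ‖F 0 0‖ := by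
      simpa using norm_add_le (F s v - F 0 0) (F 0 0)
    have h3 : K₄ * s ≤ K₄ * T := by gcongr; exact hs.2
    linarith
  have hN0 : 0 ≤ N := by positivity
  set C₁ := 1 + K₀ * K₄ * Real.exp (K₀ * K₄ * T) * T with hC₁
  have hC₁0 : 1 ≤ C₁ := by
    have : 0 ≤ K₀ * K₄ * Real.exp (K₀ * K₄ * T) * T := by positivity
    linarith
  refine ⟨N + K₄ * (C₁ * (K₀ + K₀ * N * T + 1)), by positivity, fun u₀ u hu t ht => ?_⟩
  have hg := gronwall_const (f := fun t => ‖u t‖) (a := 0) (b := T) (L := K₀ * K₄)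
    (S := T) (M := K₀ * ‖u₀‖ + K₀ * N * T) (by positivity) (by simp) (by positivity)
    hu.continuousOn.norm
    (fun t ht => by
      have hc : ContinuousOn (fun s => K₀ * K₄ * ‖u s‖) (Icc 0 t) :=
        continuousOn_const.mul (hu.continuousOn.norm.mono (Icc_subset_Icc_right ht.2))
      have hi := hc.intervalIntegrable_of_Icc (μ := volume) ht.1.le
      have h1 : ‖∫ s in (0 : ℝ)..t, U t s (F s (u s))‖
          ≤ ∫ s in (0 : ℝ)..t, (K₀ * N + K₀ * K₄ * ‖u s‖) := by
        refine intervalIntegral.norm_integral_le_of_norm_le ht.1.le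
          (Eventually.of_forall fun s hs => ?_) (intervalIntegrable_const.add hi)
        have hs' : s ∈ Icc 0 T := ⟨hs.1.le, hs.2.trans ht.2⟩
        rw [mul_assoc, ← mul_add]
        exact ContinuousLinearMap.le_of_opNorm_le_of_le _ (hb s t hs'.1 hs.2 ht.2) (hFn s hs' _)
      rw [intervalIntegral.integral_add intervalIntegrable_const hi,
        intervalIntegral.integral_const, intervalIntegral.integral_const_mul, sub_zero,
        smul_eq_mul] at h1
      have h2 : t * (K₀ * N) ≤ K₀ * N * T := by
        rw [mul_comm]; gcongr; exact ht.2
      have h3 := (U t 0).le_of_opNorm_le (hb 0 t le_rfl ht.1.le ht.2) u₀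
      rw [hu.eq t ht]
      linarith [norm_add_le (U t 0 u₀) (∫ s in (0 : ℝ)..t, U t s (F s (u s)))])
  have hut : ‖u t‖ ≤ C₁ * ((K₀ + K₀ * N * T + 1) * (1 + ‖u₀‖)) := by
    have h5 : K₀ * ‖u₀‖ + K₀ * N * T ≤ (K₀ + K₀ * N * T + 1) * (1 + ‖u₀‖) := by
      have : 0 ≤ K₀ * N * T * ‖u₀‖ := by positivity
      linarith [norm_nonneg u₀]
    have h6 : ‖u₀‖ ≤ (K₀ + K₀ * N * T + 1) * (1 + ‖u₀‖) := by
      have : 0 ≤ (K₀ + K₀ * N * T) * (1 + ‖u₀‖) := by positivity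
      linarith
    rcases ht.1.eq_or_lt with rfl | h0
    · rw [hu.initial]
      exact h6.trans (le_mul_of_one_le_left (by positivity) hC₁0)
    · exact (hg t ⟨h0, ht.2⟩).trans (by gcongr)
  calc ‖F t (u t)‖ ≤ N + K₄ * ‖u t‖ := hFn t ht _
    _ ≤ N * (1 + ‖u₀‖) + K₄ * (C₁ * ((K₀ + K₀ * N * T + 1) * (1 + ‖u₀‖))) := by
        gcongr
        exact le_mul_of_one_le_right hN0 (by linarith [norm_nonneg u₀])
    _ = _ := by ring

end IsEvolutionSystemOf

end Mild

/-! ### Fractional powers -/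

section Fractional

open Filter Topology

variable {H : Type*} [NormedAddCommGroup H] [InnerProductSpace ℂ H] [CompleteSpace H]
variable {D : Submodule ℂ H}

/-- Balakrishnan's integral `∫₀^∞ r^(-α) (r - L)⁻¹ dr`. -/
noncomputable def balakrishnan (L : D →ₗ[ℂ] H) (α : ℝ) : H →L[ℂ] H :=
  ∫ r in Ioi (0 : ℝ), (r ^ (-α) : ℝ) • presolvent L (r : ℂ)

theorem negFracPow_eq {L : D →ₗ[ℂ] H} {α : ℝ} (hα : α ∈ Ioo (0 : ℝ) 1) :
    negFracPow L α = (Real.sin (Real.pi * α) / Real.pi) • balakrishnan L α := by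
  rw [negFracPow, if_neg hα.1.ne', if_neg hα.2.ne, balakrishnan]

namespace IsSectorialOp

variable {c : ℝ} {L : D →ₗ[ℂ] H} (hL : IsSectorialOp c L)
include hL

theorem norm_resolvent_le_const {r : ℝ} (hr : 0 < r) :
    ‖presolvent L (r : ℂ)‖ ≤ (1 + c) * ‖presolvent L 0‖ := by
  have h := hL.resolvent_sub_inv hr
  rw [sub_eq_iff_eq_add] at h
  rw [h, neg_smul, ← smul_neg, smul_neg, ← smul_mul_assoc]
  refine (norm_add_le _ _).trans ?_
  rw [norm_neg]
  have h1 : ‖(r • presolvent L (r : ℂ)) * presolvent L 0‖ ≤ c * ‖presolvent L 0‖ :=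
    (norm_mul_le _ _).trans (by gcongr; exact hL.norm_smul_resolvent_le hr)
  linarith

theorem norm_resolvent_sub_le {r s : ℝ} (hr : 0 < r) (hs : 0 < s) :
    ‖presolvent L (r : ℂ) - presolvent L (s : ℂ)‖
      ≤ ((1 + c) * ‖presolvent L 0‖) ^ 2 * |r - s| := by
  rw [(hL.resolvent_spec (z := r) (by simpa using hr)).sub_eq
    (hL.resolvent_spec (z := s) (by simpa using hs)), ← Complex.ofReal_sub, Complex.coe_smul,
    norm_smul, Real.norm_eq_abs, abs_sub_comm, mul_comm, pow_two]
  have hc := hL.nonneg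
  gcongr
  exact (norm_mul_le _ _).trans (mul_le_mul (hL.norm_resolvent_le_const hr)
    (hL.norm_resolvent_le_const hs) (norm_nonneg _) (by positivity))

theorem continuousOn_resolvent : ContinuousOn (fun r : ℝ => presolvent L (r : ℂ)) (Ioi 0) :=
  (LipschitzOnWith.of_dist_le_mul
    (K := ⟨((1 + c) * ‖presolvent L 0‖) ^ 2, sq_nonneg _⟩) fun r hr s hs => by
      rw [dist_eq_norm, dist_eq_norm]
      exact hL.norm_resolvent_sub_le hr hs).continuousOn

theorem continuousOn_rpow_smul_resolvent (p : ℝ) :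
    ContinuousOn (fun r : ℝ => (r ^ p : ℝ) • presolvent L (r : ℂ)) (Ioi 0) :=
  (continuousOn_id.rpow_const fun _ hr => Or.inl (ne_of_gt hr)).smul hL.continuousOn_resolvent

theorem integrableOn_balakrishnan {α : ℝ} (hα : α ∈ Ioo (0 : ℝ) 1) :
    IntegrableOn (fun r : ℝ => (r ^ (-α) : ℝ) • presolvent L (r : ℂ)) (Ioi 0) := by
  have hm := hL.continuousOn_rpow_smul_resolvent (-α)
  have hc := hL.nonneg
  rw [← Ioc_union_Ioi_eq_Ioi zero_le_one]
  refine IntegrableOn.union ?_ ?_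
  · have h1 : IntegrableOn (fun r : ℝ => r ^ (-α)) (Ioc 0 1) :=
      (intervalIntegrable_iff_integrableOn_Ioc_of_le zero_le_one).1
        (intervalIntegral.intervalIntegrable_rpow' (by linarith [hα.2]))
    refine Integrable.mono' (h1.mul_const ((1 + c) * ‖presolvent L 0‖))
      ((hm.mono Ioc_subset_Ioi_self).aestronglyMeasurable measurableSet_Ioc)
      (ae_restrict_of_forall_mem measurableSet_Ioc fun r hr => ?_)
    rw [norm_smul, Real.norm_of_nonneg (Real.rpow_nonneg hr.1.le _)]
    exact mul_le_mul_of_nonneg_left (hL.norm_resolvent_le_const hr.1) (Real.rpow_nonneg hr.1.le _)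
  · have h1 : IntegrableOn (fun r : ℝ => r ^ (-α - 1)) (Ioi 1) :=
      integrableOn_Ioi_rpow_of_lt (by linarith [hα.1]) one_pos
    refine Integrable.mono' (h1.mul_const c)
      ((hm.mono (Ioi_subset_Ioi zero_le_one)).aestronglyMeasurable measurableSet_Ioi)
      (ae_restrict_of_forall_mem measurableSet_Ioi fun r hr => ?_)
    have hr0 : 0 < r := zero_lt_one.trans hr
    rw [norm_smul, Real.norm_of_nonneg (Real.rpow_nonneg hr0.le _), Real.rpow_sub_one hr0.ne']
    calc _ ≤ r ^ (-α) * (c / r) :=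
          mul_le_mul_of_nonneg_left (hL.resolvent_norm_le_real hr0) (Real.rpow_nonneg hr0.le _)
      _ = _ := by ring

/-- A Frullani integral: `∫₀^∞ R(r) R(r σ) dr = (log σ / (σ - 1)) (-L)⁻¹`. By the resolvent
identity the integrand is the derivative of `r ↦ (σ - 1)⁻¹ ∫_{rσ}^r R(ρ) dρ / ρ`. -/
theorem integral_resolvent_mul_resolvent {σ : ℝ} (hσ : 0 < σ) (hσ1 : σ ≠ 1)
    (hi : IntegrableOn (fun r : ℝ => presolvent L (r : ℂ) * presolvent L ((r * σ : ℝ) : ℂ))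
      (Ioi 0)) :
    ∫ r in Ioi (0 : ℝ), presolvent L (r : ℂ) * presolvent L ((r * σ : ℝ) : ℂ)
      = (Real.log σ / (σ - 1)) • presolvent L 0 := by
  set R : ℝ → H →L[ℂ] H := fun r => presolvent L (r : ℂ) with hR
  set G := presolvent L 0 with hG
  have hc := hL.nonneg
  set g : ℝ → H →L[ℂ] H := fun ρ => ρ⁻¹ • R ρ with hg
  have hgc : ContinuousOn g (Ioi 0) :=
    (continuousOn_inv₀.mono fun r hr => ne_of_gt hr).smul hL.continuousOn_resolvent
  have hgi : ∀ a b, 0 < a → 0 < b → IntervalIntegrable g volume a b := fun a b ha hb =>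
    (hgc.mono fun r hr => (lt_min ha hb).trans_le hr.1).intervalIntegrable
  have hQ : ∀ r, 0 < r → HasDerivAt (fun x => ∫ ρ in (1 : ℝ)..x, g ρ) (g r) r := fun r hr =>
    intervalIntegral.integral_hasDerivAt_right (hgi 1 r one_pos hr)
      (hgc.stronglyMeasurableAtFilter isOpen_Ioi r hr) (hgc.continuousAt (Ioi_mem_nhds hr))
  set P : ℝ → H →L[ℂ] H := fun r => ∫ ρ in (r * σ)..r, g ρ with hP
  have hPd : ∀ r, 0 < r → HasDerivAt P ((σ - 1) • (R r * R (r * σ))) r := by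
    intro r hr
    have hrσ : 0 < r * σ := mul_pos hr hσ
    have h1 := (hQ r hr).sub ((hQ (r * σ) hrσ).scomp r ((hasDerivAt_id r).mul_const σ))
    have h2 : P =ᶠ[𝓝 r] ((fun x => ∫ ρ in (1 : ℝ)..x, g ρ) -
        (fun x => ∫ ρ in (1 : ℝ)..x, g ρ) ∘ fun y => id y * σ) := by
      filter_upwards [Ioi_mem_nhds hr] with x hx
      exact (intervalIntegral.integral_interval_sub_left (hgi 1 x one_pos hx)
        (hgi 1 (x * σ) one_pos (mul_pos hx hσ))).symm
    refine (h1.congr_of_eventuallyEq h2).congr_deriv ?_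
    have e := (hL.resolvent_spec (z := (r : ℂ)) (by simpa using hr)).sub_eq
      (hL.resolvent_spec (z := ((r * σ : ℝ) : ℂ)) (by simpa using hrσ))
    rw [← Complex.ofReal_sub, Complex.coe_smul] at e
    change r⁻¹ • R r - (1 * σ) • (r * σ)⁻¹ • R (r * σ) = _
    have e2 : (1 * σ) • (r * σ)⁻¹ • R (r * σ) = r⁻¹ • R (r * σ) := by
      rw [smul_smul]; congr 1; field_simp
    rw [e2, ← smul_sub]
    change r⁻¹ • (presolvent L (r : ℂ) - presolvent L ((r * σ : ℝ) : ℂ)) = _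
    rw [e, smul_smul]
    congr 1; field_simp
  have hP0 : Tendsto P (𝓝[>] 0) (𝓝 ((-Real.log σ) • G)) := by
    rw [tendsto_iff_norm_sub_tendsto_zero]
    have hlim : Tendsto (fun r : ℝ => (1 + c) * ‖G‖ * ‖G‖ * |r - r * σ|) (𝓝[>] 0) (𝓝 0) := by
      have hc' : Continuous fun r : ℝ => (1 + c) * ‖G‖ * ‖G‖ * |r - r * σ| := by fun_prop
      simpa using (hc'.tendsto 0).mono_left nhdsWithin_le_nhds
    refine squeeze_zero' (Eventually.of_forall fun _ => norm_nonneg _) ?_ hlim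
    filter_upwards [self_mem_nhdsWithin] with r hr
    have hr : 0 < r := hr
    have hrσ : 0 < r * σ := mul_pos hr hσ
    have hii : IntervalIntegrable (fun ρ : ℝ => ρ⁻¹ • G) volume (r * σ) r :=
      ((continuousOn_inv₀.mono fun x hx =>
        ((lt_min hrσ hr).trans_le hx.1).ne').smul continuousOn_const).intervalIntegrable
    have e : (-Real.log σ) • G = ∫ ρ in (r * σ)..r, ρ⁻¹ • G := by
      rw [intervalIntegral.integral_smul_const, integral_inv_of_pos hrσ hr]
      congr 1
      rw [Real.log_div hr.ne' hrσ.ne', Real.log_mul hr.ne' hσ.ne']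
      ring
    rw [e, ← intervalIntegral.integral_sub (hgi _ _ hrσ hr) hii]
    refine intervalIntegral.norm_integral_le_of_norm_le_const fun ρ hρ => ?_
    have hρ0 : 0 < ρ := (lt_min hrσ hr).trans hρ.1
    have e3 : g ρ - ρ⁻¹ • G = -(R ρ * G) := by
      rw [hg]
      simp only
      rw [← smul_sub, hR, hG]
      simp only
      rw [hL.resolvent_sub_inv hρ0, smul_smul, mul_neg, inv_mul_cancel₀ hρ0.ne', neg_smul, one_smul]
    rw [e3, norm_neg]
    exact (norm_mul_le _ _).trans (by gcongr; exact hL.norm_resolvent_le_const hρ0)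
  have hPinf : Tendsto P atTop (𝓝 0) := by
    set m := min σ 1 with hm
    have hm0 : 0 < m := lt_min hσ one_pos
    have hlim : Tendsto (fun r : ℝ => c * |1 - σ| / m ^ 2 / r) atTop (𝓝 0) :=
      tendsto_const_nhds.div_atTop tendsto_id
    refine squeeze_zero_norm' ?_ hlim
    filter_upwards [eventually_gt_atTop 0] with r hr
    have h := intervalIntegral.norm_integral_le_of_norm_le_const (f := g) (a := r * σ) (b := r)
      (C := c / (r * m) ^ 2) fun ρ hρ => by
        have hρm : r * m < ρ := by
          refine lt_of_eq_of_lt ?_ hρ.1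
          rw [hm, mul_min_of_nonneg _ _ hr.le, mul_one]
        have hρ0 : 0 < ρ := (by positivity : 0 < r * m).trans hρm
        rw [hg, norm_smul, norm_inv, Real.norm_of_nonneg hρ0.le]
        calc _ ≤ ρ⁻¹ * (c / ρ) := by gcongr; exact hL.resolvent_norm_le_real hρ0
          _ = c / ρ ^ 2 := by field_simp
          _ ≤ _ := by gcongr
    refine h.trans_eq ?_
    rw [show r - r * σ = r * (1 - σ) by ring, abs_mul, abs_of_pos hr]
    field_simp
  have hmain := integral_Ioi_of_hasDerivAt_of_tendsto (a := 0)
    (f := Function.update P 0 ((-Real.log σ) • G)) (f' := fun r => (σ - 1) • (R r * R (r * σ)))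
    (m := 0) (by
      rw [continuousWithinAt_update_same, Ici_sdiff_left]
      exact hP0) (fun r hr => (hPd r hr).congr_of_eventuallyEq (by
        filter_upwards [Ioi_mem_nhds hr] with x hx
        exact Function.update_of_ne (ne_of_gt hx) _ _)) (hi.smul (σ - 1)) (hPinf.congr' (by
        filter_upwards [eventually_gt_atTop 0] with x hx
        exact (Function.update_of_ne (ne_of_gt hx) _ _).symm))
  rw [Function.update_self, integral_smul, zero_sub, ← neg_smul, neg_neg] at hmain
  have h1 : σ - 1 ≠ 0 := sub_ne_zero.2 hσ1
  rw [div_eq_inv_mul, ← smul_smul, ← hmain, smul_smul, inv_mul_cancel₀ h1, one_smul]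

/-- The integral `k = ∫₀^∞ σ^(α-1) log σ / (σ - 1) dσ` appears after the substitution `s = r σ` in
the double integral for the product. -/
theorem balakrishnan_mul {α : ℝ} (hα : α ∈ Ioo (0 : ℝ) 1) (hG : presolvent L 0 ≠ 0) :
    ∃ k : ℝ, k ≠ 0 ∧ balakrishnan L α * balakrishnan L (1 - α) = k • presolvent L 0 := by
  have hα' : 1 - α ∈ Ioo (0 : ℝ) 1 := ⟨by linarith [hα.2], by linarith [hα.1]⟩
  set R : ℝ → H →L[ℂ] H := fun r => presolvent L (r : ℂ) with hR
  set a : ℝ → H →L[ℂ] H := fun r => r ^ (-α) • R r with ha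
  set b : ℝ → H →L[ℂ] H := fun s => s ^ (-(1 - α)) • R s with hb
  have hai : IntegrableOn a (Ioi 0) := hL.integrableOn_balakrishnan hα
  have hbi : IntegrableOn b (Ioi 0) := hL.integrableOn_balakrishnan hα'
  set f : ℝ → ℝ → H →L[ℂ] H := fun r σ => σ ^ (α - 1) • (R r * R (r * σ)) with hf
  have hfab : ∀ r, 0 < r → ∀ σ, 0 < σ → f r σ = r • (a r * b (r * σ)) := by
    intro r hr σ hσ
    simp only [hf, ha, hb]
    rw [smul_mul_assoc, mul_smul_comm, smul_smul, smul_smul, Real.mul_rpow hr.le hσ.le]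
    congr 1
    have h1 : r ^ (-α) * r ^ (-(1 - α)) = r⁻¹ := by
      rw [← Real.rpow_add hr, ← Real.rpow_neg_one]
      congr 1; ring
    rw [neg_sub] at h1 ⊢
    calc σ ^ (α - 1) = r * r⁻¹ * σ ^ (α - 1) := by rw [mul_inv_cancel₀ hr.ne', one_mul]
      _ = _ := by rw [← h1]; ring
  have hab : ∀ r, 0 < r → IntegrableOn (fun σ => b (r * σ)) (Ioi 0) := fun r hr => by
    rw [integrableOn_Ioi_comp_mul_left_iff b 0 hr, mul_zero]
    exact hbi
  have hfi : ∀ r, 0 < r → IntegrableOn (f r) (Ioi 0) := fun r hr =>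
    IntegrableOn.congr_fun (((hab r hr).const_mul' (a r)).smul r)
      (fun σ hσ => (hfab r hr σ hσ).symm) measurableSet_Ioi
  have hfint : ∀ r, 0 < r → ∫ σ in Ioi (0 : ℝ), f r σ = a r * balakrishnan L (1 - α) := by
    intro r hr
    rw [setIntegral_congr_fun measurableSet_Ioi fun σ hσ => hfab r hr σ hσ, integral_smul,
      integral_const_mul_of_integrable (hab r hr), integral_comp_mul_left_Ioi b 0 hr, mul_zero,
      mul_smul_comm, smul_smul, mul_inv_cancel₀ hr.ne', one_smul]
    rfl
  have hfnorm : ∀ r, 0 < r → ∫ σ in Ioi (0 : ℝ), ‖f r σ‖ ≤ ‖a r‖ * ∫ s in Ioi (0 : ℝ), ‖b s‖ := by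
    intro r hr
    have h1 : ∫ σ in Ioi (0 : ℝ), ‖f r σ‖ ≤ ∫ σ in Ioi (0 : ℝ), r * ‖a r‖ * ‖b (r * σ)‖ := by
      refine setIntegral_mono_on (hfi r hr).norm ((hab r hr).norm.const_mul _) measurableSet_Ioi
        fun σ hσ => ?_
      rw [hfab r hr σ hσ, norm_smul, Real.norm_of_nonneg hr.le, mul_assoc]
      gcongr
      exact norm_mul_le _ _
    refine h1.trans_eq ?_
    rw [integral_const_mul, integral_comp_mul_left_Ioi (fun s => ‖b s‖) 0 hr, mul_zero, smul_eq_mul]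
    field_simp
  have hmeas : AEStronglyMeasurable (Function.uncurry f)
      ((volume.restrict (Ioi 0)).prod (volume.restrict (Ioi (0 : ℝ)))) := by
    rw [Measure.prod_restrict]
    refine ContinuousOn.aestronglyMeasurable ?_ (measurableSet_Ioi.prod measurableSet_Ioi)
    refine ContinuousOn.smul (continuousOn_snd.rpow_const fun p hp => Or.inl (ne_of_gt hp.2)) ?_
    exact (hL.continuousOn_resolvent.comp continuousOn_fst fun p hp => hp.1).mul
      (hL.continuousOn_resolvent.comp (continuousOn_fst.mul continuousOn_snd)
        fun p hp => mem_Ioi.2 (mul_pos (mem_Ioi.1 hp.1) (mem_Ioi.1 hp.2)))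
  have hint : Integrable (Function.uncurry f)
      ((volume.restrict (Ioi 0)).prod (volume.restrict (Ioi (0 : ℝ)))) := by
    rw [integrable_prod_iff hmeas]
    refine ⟨ae_restrict_of_forall_mem measurableSet_Ioi fun r hr => hfi r hr, ?_⟩
    refine Integrable.mono' (hai.norm.mul_const (∫ s in Ioi (0 : ℝ), ‖b s‖))
      hmeas.norm.integral_prod_right' (ae_restrict_of_forall_mem measurableSet_Ioi fun r hr => ?_)
    rw [Real.norm_of_nonneg (integral_nonneg fun _ => norm_nonneg _)]
    exact hfnorm r hr
  have hswap := integral_integral_swap hint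
  rw [setIntegral_congr_fun measurableSet_Ioi fun r hr => hfint r hr,
    integral_mul_const_of_integrable hai] at hswap
  have hne : ∀ᵐ σ ∂(volume.restrict (Ioi (0 : ℝ))), σ ≠ 1 :=
    ae_restrict_of_ae (Measure.ae_ne volume 1)
  have hae : ∀ᵐ σ ∂(volume.restrict (Ioi (0 : ℝ))),
      ∫ r in Ioi (0 : ℝ), f r σ = (σ ^ (α - 1) * (Real.log σ / (σ - 1))) • presolvent L 0 := by
    filter_upwards [hint.prod_left_ae, ae_restrict_mem measurableSet_Ioi, hne] with σ h1 hσ hσ1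
    have hσ : 0 < σ := hσ
    have h2 : IntegrableOn (fun r : ℝ => R r * R (r * σ)) (Ioi 0) := by
      have h3 := h1.smul (σ ^ (α - 1))⁻¹
      refine h3.congr (Eventually.of_forall fun r => ?_)
      simp only [Function.uncurry, hf]
      change (σ ^ (α - 1))⁻¹ • σ ^ (α - 1) • (R r * R (r * σ)) = _
      rw [smul_smul, inv_mul_cancel₀ (Real.rpow_pos_of_pos hσ _).ne', one_smul]
    simp only [hf]
    rw [integral_smul, ← smul_smul]
    congr 1
    exact hL.integral_resolvent_mul_resolvent hσ hσ1 h2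
  have hki : IntegrableOn (fun σ : ℝ => σ ^ (α - 1) * (Real.log σ / (σ - 1))) (Ioi 0) :=
    (integrable_smul_const hG).1 (hint.integral_prod_right.congr hae)
  refine ⟨∫ σ in Ioi (0 : ℝ), σ ^ (α - 1) * (Real.log σ / (σ - 1)), ?_, ?_⟩
  · have hpos : ∀ σ : ℝ, 0 < σ → σ ≠ 1 → 0 < σ ^ (α - 1) * (Real.log σ / (σ - 1)) := by
      intro σ hσ hσ1
      refine mul_pos (Real.rpow_pos_of_pos hσ _) ?_
      rcases lt_or_gt_of_ne hσ1 with h | h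
      · exact div_pos_of_neg_of_neg (Real.log_neg hσ h) (by linarith)
      · exact div_pos (Real.log_pos h) (by linarith)
    refine ne_of_gt ((setIntegral_pos_iff_support_of_nonneg_ae ?_ hki).2 ?_)
    · filter_upwards [ae_restrict_mem measurableSet_Ioi, hne] with σ hσ hσ1 using (hpos σ hσ hσ1).le
    · have hsub : Ioo (0 : ℝ) 1 ⊆
          Function.support (fun σ : ℝ => σ ^ (α - 1) * (Real.log σ / (σ - 1))) ∩ Ioi 0 :=
        fun σ hσ => ⟨(hpos σ hσ.1 hσ.2.ne).ne', hσ.1⟩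
      refine lt_of_lt_of_le ?_ (measure_mono hsub)
      simp
  · refine hswap.trans ?_
    rw [integral_congr_ae hae, integral_smul_const]

end IsSectorialOp

end Fractional

section FractionalDomain

open Filter Topology

variable {H : Type*} [NormedAddCommGroup H] [InnerProductSpace ℂ H] [CompleteSpace H]
variable {D : Submodule ℂ H}

theorem sin_pi_mul_div_pi_pos {α : ℝ} (hα : α ∈ Ioo (0 : ℝ) 1) :
    0 < Real.sin (Real.pi * α) / Real.pi :=
  div_pos (Real.sin_pos_of_pos_of_lt_pi (mul_pos Real.pi_pos hα.1)
    (by nlinarith [Real.pi_pos, hα.2])) Real.pi_pos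

namespace IsSectorialOp

variable {c : ℝ} {L : D →ₗ[ℂ] H} (hL : IsSectorialOp c L)
include hL

/-- Injectivity makes `fracPow L α` the genuine inverse of `negFracPow L α`. -/
theorem negFracPow_injective {α : ℝ} (hα : α ∈ Ioo (0 : ℝ) 1) {w : H}
    (hw : negFracPow L α w = 0) : w = 0 := by
  by_cases hG : presolvent L 0 = 0
  · exact hL.inv_injective (by rw [hG]; rfl)
  obtain ⟨k, hk, e⟩ := hL.balakrishnan_mul (α := 1 - α) ⟨by linarith [hα.2], by linarith [hα.1]⟩ hG
  rw [sub_sub_cancel] at e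
  rw [negFracPow_eq hα] at hw
  change (Real.sin (Real.pi * α) / Real.pi) • balakrishnan L α w = 0 at hw
  have h1 : balakrishnan L α w = 0 :=
    (smul_eq_zero.1 hw).resolve_left (sin_pi_mul_div_pi_pos hα).ne'
  have h2 : (balakrishnan L (1 - α) * balakrishnan L α) w = 0 := by
    change balakrishnan L (1 - α) (balakrishnan L α w) = 0
    rw [h1, map_zero]
  rw [e] at h2
  change k • presolvent L 0 w = 0 at h2
  exact hL.inv_injective ((smul_eq_zero.1 h2).resolve_left hk)

theorem commute_negFracPow {S : H →L[ℂ] H}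
    (hS : ∀ r : ℝ, 0 < r → S * presolvent L (r : ℂ) = presolvent L (r : ℂ) * S) {α : ℝ}
    (hα : α ∈ Ioo (0 : ℝ) 1) : S * negFracPow L α = negFracPow L α * S := by
  have hi := hL.integrableOn_balakrishnan hα
  rw [negFracPow_eq hα, mul_smul_comm, smul_mul_assoc, balakrishnan,
    ← integral_const_mul_of_integrable hi, ← integral_mul_const_of_integrable hi]
  congr 1
  refine setIntegral_congr_fun measurableSet_Ioi fun r hr => ?_
  rw [mul_smul_comm, smul_mul_assoc, hS r hr]

/-- The estimate behind the moment inequality: the part of Balakrishnan's integral over `(0, μ)` is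
controlled by `x` and the part over `(μ, ∞)` by `L x`. -/
theorem norm_balakrishnan_apply_le {α : ℝ} (hα : α ∈ Ioo (0 : ℝ) 1) (x : D) {μ : ℝ} (hμ : 0 < μ) :
    ‖balakrishnan L (1 - α) (L x)‖
      ≤ (1 + c) / α * (μ ^ α * ‖(x : H)‖) + c / (1 - α) * (μ ^ (α - 1) * ‖L x‖) := by
  have hα' : 1 - α ∈ Ioo (0 : ℝ) 1 := ⟨by linarith [hα.2], by linarith [hα.1]⟩
  have hc := hL.nonneg
  have hi := hL.integrableOn_balakrishnan hα'
  have hiv : IntegrableOn (fun r : ℝ => (r ^ (-(1 - α)) : ℝ) • presolvent L (r : ℂ) (L x)) (Ioi 0) :=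
    (ContinuousLinearMap.apply ℂ H (L x)).integrable_comp hi
  have e : balakrishnan L (1 - α) (L x)
      = ∫ r in Ioi (0 : ℝ), (r ^ (-(1 - α)) : ℝ) • presolvent L (r : ℂ) (L x) :=
    ((ContinuousLinearMap.apply ℂ H (L x)).integral_comp_comm hi).symm
  have hsplit : Ioi (0 : ℝ) = Ioc 0 μ ∪ Ioi μ := (Ioc_union_Ioi_eq_Ioi hμ.le).symm
  rw [e, hsplit, setIntegral_union (Ioc_disjoint_Ioi le_rfl) measurableSet_Ioi
    (hiv.mono_set Ioc_subset_Ioi_self) (hiv.mono_set (Ioi_subset_Ioi hμ.le)), neg_sub]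
  refine (norm_add_le _ _).trans (add_le_add ?_ ?_)
  · have h1 : IntervalIntegrable (fun r : ℝ => r ^ (α - 1) * ((1 + c) * ‖(x : H)‖)) volume 0 μ :=
      (intervalIntegral.intervalIntegrable_rpow' (by linarith [hα.1])).mul_const _
    rw [← intervalIntegral.integral_of_le hμ.le]
    refine (intervalIntegral.norm_integral_le_of_norm_le hμ.le
      (Eventually.of_forall fun r hr => ?_) h1).trans_eq ?_
    · rw [norm_smul, Real.norm_of_nonneg (Real.rpow_nonneg hr.1.le _)]
      refine mul_le_mul_of_nonneg_left ?_ (Real.rpow_nonneg hr.1.le _)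
      rw [← hL.smul_resolvent_sub_self hr.1]
      refine (norm_sub_le _ _).trans ?_
      have := (r • presolvent L (r : ℂ)).le_of_opNorm_le (hL.norm_smul_resolvent_le hr.1) (x : H)
      change ‖r • presolvent L (r : ℂ) (x : H)‖ ≤ _ at this
      linarith
    · rw [intervalIntegral.integral_mul_const, integral_rpow (Or.inl (by linarith [hα.1])),
        sub_add_cancel, Real.zero_rpow hα.1.ne', sub_zero]
      ring
  · have h1 : IntegrableOn (fun r : ℝ => r ^ (α - 2) * (c * ‖L x‖)) (Ioi μ) :=
      (integrableOn_Ioi_rpow_of_lt (by linarith [hα.2]) hμ).mul_const _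
    refine (norm_integral_le_of_norm_le h1
      (ae_restrict_of_forall_mem measurableSet_Ioi fun r hr => ?_)).trans_eq ?_
    · have hr0 : 0 < r := hμ.trans hr
      rw [norm_smul, Real.norm_of_nonneg (Real.rpow_nonneg hr0.le _)]
      calc _ ≤ r ^ (α - 1) * (c / r * ‖L x‖) :=
            mul_le_mul_of_nonneg_left (ContinuousLinearMap.le_of_opNorm_le _
              (hL.resolvent_norm_le_real hr0) _) (Real.rpow_nonneg hr0.le _)
        _ = r ^ (α - 1) / r * (c * ‖L x‖) := by ring
        _ = _ := by rw [← Real.rpow_sub_one hr0.ne']; congr 2; ring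
    · rw [integral_mul_const, integral_Ioi_rpow_of_lt (by linarith [hα.2]) hμ]
      have h2 : α - 2 + 1 = -(1 - α) := by ring
      have h3 : 1 - α ≠ 0 := hα'.1.ne'
      rw [h2, neg_sub, div_eq_mul_inv, show α - 1 = -(1 - α) by ring, inv_neg]
      ring

/-- On `D` the operator `(-L)^α` is `L` followed by a bounded operator, and it obeys a moment
inequality. -/
theorem exists_fracPow_on_domain {α : ℝ} (hα : α ∈ Ioo (0 : ℝ) 1) :
    ∃ (S : H →L[ℂ] H) (C : ℝ), 0 ≤ C ∧ ∀ x : D, negFracPow L α (S (L x)) = x ∧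
      ∀ μ : ℝ, 0 < μ → ‖S (L x)‖ ≤ C * (μ ^ α * ‖(x : H)‖ + μ ^ (α - 1) * ‖L x‖) := by
  by_cases hG : presolvent L 0 = 0
  · refine ⟨0, 0, le_rfl, fun x => ⟨?_, fun μ hμ => by simp⟩⟩
    rw [hL.inv_injective (y := (x : H)) (by rw [hG]; rfl)]
    exact map_zero _
  obtain ⟨k, hk, e⟩ := hL.balakrishnan_mul hα hG
  have hs := sin_pi_mul_div_pi_pos hα
  set q := Real.sin (Real.pi * α) / Real.pi with hq
  have hc := hL.nonneg
  have hα1 : 0 < 1 - α := by linarith [hα.2]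
  have hα0 := hα.1
  set C₁ := (1 + c) / α + c / (1 - α) with hC₁
  refine ⟨(-(q * k)⁻¹) • balakrishnan L (1 - α), |(q * k)⁻¹| * C₁, by positivity,
    fun x => ⟨?_, fun μ hμ => ?_⟩⟩
  · have h1 : balakrishnan L α (balakrishnan L (1 - α) (L x)) = k • presolvent L 0 (L x) :=
      congrArg (fun S : H →L[ℂ] H => S (L x)) e
    rw [hL.inv_apply] at h1
    rw [negFracPow_eq hα]
    change q • balakrishnan L α ((-(q * k)⁻¹) • balakrishnan L (1 - α) (L x)) = x
    rw [ContinuousLinearMap.map_smul_of_tower, h1, smul_neg, smul_neg, smul_neg, smul_smul,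
      smul_smul, ← neg_smul]
    have h2 : -(q * -(q * k)⁻¹ * k) = 1 := by field_simp
    rw [h2, one_smul]
  · change ‖(-(q * k)⁻¹) • balakrishnan L (1 - α) (L x)‖ ≤ _
    rw [norm_smul, Real.norm_eq_abs, abs_neg, mul_assoc]
    gcongr
    refine (hL.norm_balakrishnan_apply_le hα x hμ).trans ?_
    have hx1 : 0 ≤ μ ^ α * ‖(x : H)‖ := by positivity
    have hx2 : 0 ≤ μ ^ (α - 1) * ‖L x‖ := by positivity
    have h1 : 0 ≤ (1 + c) / α := by positivity
    have h2 : 0 ≤ c / (1 - α) := by positivity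
    rw [hC₁, add_mul, mul_add, mul_add]
    have := mul_nonneg h1 hx2
    have := mul_nonneg h2 hx1
    linarith

/-- Integrals of functions with values in `D` whose graph norm blows up like `1 / (t - τ)` belong
to the domain of `(-L)^α`, for `α < 1`: by the moment inequality `(-L)^α ψ(τ)` grows at most like
`(t - τ)^(-α)`. -/
theorem exists_negFracPow_eq_integral {α : ℝ} (hα : α ∈ Ioo (0 : ℝ) 1) (T : ℝ) :
    ∃ C, 0 ≤ C ∧ ∀ t ∈ Ioc 0 T, ∀ (ψ : ℝ → H) (N : ℝ), ContinuousOn ψ (Ioo 0 t) →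
      (∀ τ ∈ Ioo 0 t, ∃ m : ψ τ ∈ D, ‖ψ τ‖ ≤ N ∧ ‖L ⟨ψ τ, m⟩‖ ≤ N / (t - τ)) →
      ∃ w, negFracPow L α w = ∫ τ in (0 : ℝ)..t, ψ τ ∧ ‖w‖ ≤ C * N := by
  obtain ⟨S, C, hC, hS⟩ := hL.exists_fracPow_on_domain hα
  have hα1 : 0 < 1 - α := by linarith [hα.2]
  by_cases hT : 0 < T
  swap
  · exact ⟨0, le_rfl, fun t ht => absurd (ht.1.trans_le ht.2) hT⟩
  refine ⟨2 * C * (T ^ (1 - α) / (1 - α)), by positivity, fun t ht ψ N hψ h => ?_⟩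
  have hN : 0 ≤ N := by
    obtain ⟨m, h1, -⟩ := h (t / 2) ⟨by linarith [ht.1], by linarith [ht.1]⟩
    exact (norm_nonneg _).trans h1
  classical
  set φ : ℝ → H := fun τ => if m : ψ τ ∈ D then L ⟨ψ τ, m⟩ else 0 with hφ
  have hφm : AEStronglyMeasurable φ (volume.restrict (Ioo 0 t)) := by
    -- the Yosida approximations exhibit `L ψ` as a limit of continuous functions
    refine aestronglyMeasurable_of_tendsto_ae atTop (f := fun n τ => yosidaSeq L n (ψ τ))
      (fun n => ((yosidaSeq L n).continuous.comp_continuousOn hψ).aestronglyMeasurable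
        measurableSet_Ioo) (ae_restrict_of_forall_mem measurableSet_Ioo fun τ hτ => ?_)
    obtain ⟨m, -⟩ := h τ hτ
    simp only [hφ, dif_pos m]
    exact hL.tendsto_yosidaSeq ⟨ψ τ, m⟩
  have hb : ∀ τ ∈ Ioo 0 t, negFracPow L α (S (φ τ)) = ψ τ ∧
      ‖S (φ τ)‖ ≤ 2 * C * N * (t - τ) ^ (-α) := by
    intro τ hτ
    obtain ⟨m, h1, h2⟩ := h τ hτ
    have e : φ τ = L ⟨ψ τ, m⟩ := by simp only [hφ, dif_pos m]
    rw [e]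
    refine ⟨(hS ⟨ψ τ, m⟩).1, ?_⟩
    have htτ : 0 < t - τ := by linarith [hτ.2]
    -- `μ = 1 / (t - τ)` balances the two terms of the moment inequality
    refine ((hS ⟨ψ τ, m⟩).2 (t - τ)⁻¹ (by positivity)).trans ?_
    have e1 : ((t - τ)⁻¹) ^ α = (t - τ) ^ (-α) := by
      rw [Real.inv_rpow htτ.le, Real.rpow_neg htτ.le]
    have e2 : ((t - τ)⁻¹) ^ (α - 1) = (t - τ) ^ (-α) * (t - τ) := by
      rw [Real.inv_rpow htτ.le, ← Real.rpow_neg htτ.le, neg_sub,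
        ← Real.rpow_add_one htτ.ne', neg_add_eq_sub]
    rw [e1, e2]
    have h3 : 0 ≤ (t - τ) ^ (-α) := Real.rpow_nonneg htτ.le _
    calc C * ((t - τ) ^ (-α) * ‖ψ τ‖ + (t - τ) ^ (-α) * (t - τ) * ‖L ⟨ψ τ, m⟩‖)
        ≤ C * ((t - τ) ^ (-α) * N + (t - τ) ^ (-α) * (t - τ) * (N / (t - τ))) := by gcongr
      _ = _ := by field_simp; ring
  have hint : IntervalIntegrable (fun τ => 2 * C * N * (t - τ) ^ (-α)) volume 0 t := by
    have h1 : IntervalIntegrable (fun τ : ℝ => τ ^ (-α)) volume 0 t :=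
      intervalIntegral.intervalIntegrable_rpow' (by linarith)
    have h2 := (h1.comp_sub_left t).symm
    rw [sub_self, sub_zero] at h2
    exact h2.const_mul _
  have hae : ∀ᵐ τ ∂volume, τ ∈ Ioc 0 t → ‖S (φ τ)‖ ≤ 2 * C * N * (t - τ) ^ (-α) := by
    filter_upwards [Measure.ae_ne volume t] with τ hne hτ
    exact (hb τ ⟨hτ.1, lt_of_le_of_ne hτ.2 hne⟩).2
  have hSi : IntervalIntegrable (fun τ => S (φ τ)) volume 0 t := by
    rw [intervalIntegrable_iff_integrableOn_Ioc_of_le ht.1.le] at hint ⊢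
    have hm : AEStronglyMeasurable (fun τ => S (φ τ)) (volume.restrict (Ioc 0 t)) := by
      rw [← restrict_Ioo_eq_restrict_Ioc]
      exact S.continuous.comp_aestronglyMeasurable hφm
    exact Integrable.mono' hint hm ((ae_restrict_iff' measurableSet_Ioc).2 hae)
  refine ⟨∫ τ in (0 : ℝ)..t, S (φ τ), ?_, ?_⟩
  · rw [← ContinuousLinearMap.intervalIntegral_comp_comm _ hSi]
    refine intervalIntegral.integral_congr_ae ?_
    filter_upwards [Measure.ae_ne volume t] with τ hne hτ
    rw [uIoc_of_le ht.1.le] at hτ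
    exact (hb τ ⟨hτ.1, lt_of_le_of_ne hτ.2 hne⟩).1
  · refine (intervalIntegral.norm_integral_le_of_norm_le ht.1.le hae hint).trans ?_
    rw [intervalIntegral.integral_const_mul,
      intervalIntegral.integral_comp_sub_left (fun τ : ℝ => τ ^ (-α)) t, sub_self, sub_zero,
      integral_rpow (Or.inl (by linarith)), neg_add_eq_sub, Real.zero_rpow hα1.ne', sub_zero]
    calc 2 * C * N * (t ^ (1 - α) / (1 - α)) ≤ 2 * C * N * (T ^ (1 - α) / (1 - α)) := by
          have := ht.1.le
          gcongr
          exact ht.2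
      _ = _ := by ring

end IsSectorialOp

end FractionalDomain

/-! ### Space regularity of mild solutions -/

section Regularity

open Filter Topology

variable {H : Type*} [NormedAddCommGroup H] [InnerProductSpace ℂ H] [CompleteSpace H]
variable {D : Submodule ℂ H} {T c K : ℝ} {A : ℝ → D →ₗ[ℂ] H}

theorem IsSectorialFamily.const (hA : IsSectorialFamily T c K A) (hT : 0 ≤ T) :
    IsSectorialFamily T c K (fun _ => A 0) :=
  ⟨fun _ _ => hA.sectorial 0 ⟨le_rfl, hT⟩, fun s _ t _ x => by
    rw [sub_self, norm_zero]
    have := hA.nonneg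
    positivity, fun _ _ => hA.norm_inv_le 0 ⟨le_rfl, hT⟩, hA.nonneg⟩

theorem IsSectorialFamily.continuousOn_apply_of_continuousOn (hA : IsSectorialFamily T c K A)
    {S : Set ℝ} (hS : S ⊆ Icc 0 T) {x : ℝ → D} (hx : ContinuousOn (fun τ => A 0 (x τ)) S) :
    ContinuousOn (fun τ => A τ (x τ)) S := by
  intro s hs
  have hT : (0 : ℝ) ∈ Icc 0 T := ⟨le_rfl, (hS hs).1.trans (hS hs).2⟩
  have h1 : Tendsto (fun τ => A τ (x s)) (𝓝[S] s) (𝓝 (A s (x s))) :=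
    ((hA.continuousOn_apply (x s)) s (hS hs)).mono hS
  have h2 : Tendsto (fun τ => A τ (x τ - x s)) (𝓝[S] s) (𝓝 0) := by
    have h3 := (tendsto_iff_norm_sub_tendsto_zero.1 (hx s hs)).const_mul (1 + K * T)
    rw [mul_zero] at h3
    refine squeeze_zero_norm' ?_ h3
    filter_upwards [self_mem_nhdsWithin] with τ hτ
    rw [← map_sub]
    exact hA.norm_apply_le hT (hS hτ) _
  have h3 := h2.add h1
  rw [zero_add] at h3
  exact h3.congr fun τ => by rw [map_sub, sub_add_cancel]

/-- The semigroup generated by `L` commutes with the resolvents of `L`. -/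
theorem IsEvolutionSystemOf.mul_resolvent {L : D →ₗ[ℂ] H} (hL : IsSectorialOp c L)
    {W : ℝ → ℝ → H →L[ℂ] H} (hW : IsEvolutionSystemOf T (fun _ => L) W) {t : ℝ}
    (ht : t ∈ Icc 0 T) {r : ℝ} (hr : 0 < r) :
    W t 0 * presolvent L (r : ℂ) = presolvent L (r : ℂ) * W t 0 := by
  ext v
  have hsp := hL.resolvent_spec (z := (r : ℂ)) (by simpa using hr)
  have h := hW.eq_of_hasDerivAt le_rfl ht.1 ht.2 (y := fun τ => presolvent L (r : ℂ) (W τ 0 v))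
    ((presolvent L (r : ℂ)).continuous.comp_continuousOn
      ((hW.continuousOn_fst le_rfl v).mono (Icc_subset_Icc_right ht.2))) fun τ hτ => by
    obtain ⟨m, hd⟩ := hW.exists_hasDerivAt_fst le_rfl ⟨hτ.1, hτ.2.trans_le ht.2⟩ v
    obtain ⟨m', h'⟩ := hsp.1 (W τ 0 v)
    refine ⟨m', ?_⟩
    have e : L ⟨presolvent L (r : ℂ) (W τ 0 v), m'⟩ = presolvent L (r : ℂ) (L ⟨W τ 0 v, m⟩) := by
      have h2 := hsp.2 ⟨W τ 0 v, m⟩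
      rw [map_sub, map_smul] at h2
      have h3 : (r : ℂ) • presolvent L (r : ℂ) (W τ 0 v)
          = W τ 0 v + L ⟨presolvent L (r : ℂ) (W τ 0 v), m'⟩ := sub_eq_iff_eq_add.1 h'
      rw [h3, add_sub_assoc] at h2
      exact sub_eq_zero.1 (left_eq_add.1 h2.symm)
    rw [e]
    exact ((presolvent L (r : ℂ)).restrictScalars ℝ).hasFDerivAt.comp_hasDerivAt τ hd
  rw [hW.refl 0 ⟨le_rfl, ht.1.trans ht.2⟩] at h
  exact h.symm

theorem intervalIntegrable_of_continuousOn_of_norm_le {E : Type*} [NormedAddCommGroup E]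
    {f : ℝ → E} {a b M : ℝ} (hab : a ≤ b) (hf : ContinuousOn f (Ioo a b))
    (hM : ∀ τ ∈ Ioo a b, ‖f τ‖ ≤ M) : IntervalIntegrable f volume a b := by
  rw [intervalIntegrable_iff_integrableOn_Ioo_of_le hab]
  exact Integrable.mono' (integrableOn_const (by simp))
    (hf.aestronglyMeasurable measurableSet_Ioo)
    (ae_restrict_of_forall_mem measurableSet_Ioo hM)

/-- The evolution system is a perturbation of the semigroup `W` generated by `A(0)`; on `(0, T)`
the perturbation `(A(τ) - A(0)) W(τ, 0) u₀` is bounded, since the factor `τ` from the Lipschitz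
condition balances the singularity of `A(0) W(τ, 0)`. -/
theorem IsEvolutionSystemOf.exists_perturbation (hA : IsSectorialFamily T c K A) (hT : 0 ≤ T)
    {U W : ℝ → ℝ → H →L[ℂ] H} (hU : IsEvolutionSystemOf T A U)
    (hW : IsEvolutionSystemOf T (fun _ => A 0) W) :
    ∃ C, 0 ≤ C ∧ ∀ u₀ : H, ∃ g : ℝ → H, ContinuousOn g (Ioo 0 T) ∧
      (∀ τ ∈ Ioo 0 T, ‖g τ‖ ≤ C * ‖u₀‖) ∧ ∀ t ∈ Icc 0 T,
        IntervalIntegrable (fun τ => U t τ (g τ)) volume 0 t ∧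
        U t 0 u₀ = W t 0 u₀ + ∫ τ in (0 : ℝ)..t, U t τ (g τ) := by
  obtain ⟨K₀, hK₀, hb⟩ := hU.exists_norm_le
  obtain ⟨K₁, hK₁, -, hb₁, -⟩ := hW.bounds
  have h0T : (0 : ℝ) ∈ Icc 0 T := ⟨le_rfl, hT⟩
  have hK := hA.nonneg
  refine ⟨K * K₁, by positivity, fun u₀ => ?_⟩
  classical
  set x : ℝ → D := fun τ => if m : W τ 0 u₀ ∈ D then ⟨W τ 0 u₀, m⟩ else 0 with hx
  have hxe : ∀ τ (m : W τ 0 u₀ ∈ D), x τ = ⟨W τ 0 u₀, m⟩ := fun τ m => by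
    simp only [hx, dif_pos m]
  have hx0 : ContinuousOn (fun τ => A 0 (x τ)) (Ioo 0 T) := by
    by_cases hT0 : 0 < T
    swap
    · rw [Ioo_eq_empty hT0]; exact continuousOn_empty _
    obtain ⟨V, hV⟩ := hW.deriv_fst
    obtain ⟨h1, h2⟩ := hV 0 ⟨le_rfl, hT0⟩
    refine ((h1.mono Ioo_subset_Ioc_self).clm_apply (continuousOn_const (c := u₀))).congr
      fun τ hτ => ?_
    obtain ⟨m, h3⟩ := (h2 τ (Ioo_subset_Ioc_self hτ)).2 u₀
    rw [hxe τ m]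
    exact h3.symm
  have hgb : ∀ τ ∈ Ioo 0 T, ‖A τ (x τ) - A 0 (x τ)‖ ≤ K * K₁ * ‖u₀‖ := by
    intro τ hτ
    obtain ⟨m, h1⟩ := hb₁ 0 τ le_rfl hτ.1 hτ.2.le u₀
    have h2 := hA.lip 0 h0T τ (Ioo_subset_Icc_self hτ) (x τ)
    rw [hxe τ m] at h2 ⊢
    rw [sub_zero] at h1 h2
    rw [abs_of_pos hτ.1] at h2
    calc _ ≤ K * τ * ‖A 0 ⟨W τ 0 u₀, m⟩‖ := h2
      _ ≤ K * τ * (K₁ / τ * ‖u₀‖) := by have := hτ.1; gcongr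
      _ = _ := by have := hτ.1.ne'; field_simp
  have hgc : ContinuousOn (fun τ => A τ (x τ) - A 0 (x τ)) (Ioo 0 T) :=
    (hA.continuousOn_apply_of_continuousOn Ioo_subset_Icc_self hx0).sub hx0
  refine ⟨fun τ => A τ (x τ) - A 0 (x τ), hgc, hgb, fun t ht => ?_⟩
  have hsub : Ioo 0 t ⊆ Ioo 0 T := Ioo_subset_Ioo_right ht.2
  have hint : IntervalIntegrable (fun τ => U t τ (A τ (x τ) - A 0 (x τ))) volume 0 t :=
    intervalIntegrable_of_continuousOn_of_norm_le ht.1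
      (hU.continuousOn_apply continuousOn_const continuousOn_id (hgc.mono hsub)
        fun τ hτ => ⟨hτ.1.le, hτ.2.le, ht.2⟩)
      fun τ hτ => ContinuousLinearMap.le_of_opNorm_le_of_le _
        (hb τ t hτ.1.le hτ.2.le ht.2) (hgb τ (hsub hτ))
  refine ⟨hint, ?_⟩
  have h := hU.eq_add_integral le_rfl ht.1 ht.2 (y := fun τ => W τ 0 u₀)
    (g := fun τ => -(A τ (x τ) - A 0 (x τ)))
    ((hW.continuousOn_fst le_rfl u₀).mono (Icc_subset_Icc_right ht.2)) (fun τ hτ => by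
      obtain ⟨m, h1⟩ := hW.exists_hasDerivAt_fst le_rfl (hsub hτ) u₀
      refine ⟨m, h1.congr_deriv ?_⟩
      rw [hxe τ m]
      abel) (by simp only [map_neg]; exact hint.neg)
  simp only [map_neg, intervalIntegral.integral_neg] at h
  rw [h, hW.refl 0 h0T]
  simp

/-- Space regularity for exponents in `(0, 1)`: `u(t)` is `W(t, 0) u₀`, which commutes with the
fractional powers, plus an integral `∫ U(t, τ) h(τ) dτ` with bounded `h`. -/
theorem IsEvolutionSystemOf.exists_regularity_bound (hA : IsSectorialFamily T c K A) (hT : 0 ≤ T)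
    {U : ℝ → ℝ → H →L[ℂ] H} (hU : IsEvolutionSystemOf T A U) {F : ℝ → H → H} {K₄ : ℝ}
    (hK₄ : 0 ≤ K₄)
    (hF : ∀ s ∈ Icc 0 T, ∀ t ∈ Icc 0 T, ∀ u v : H, ‖F t u - F s v‖ ≤ K₄ * (|t - s| + ‖u - v‖))
    {α : ℝ} (hα : α ∈ Ioo (0 : ℝ) 1) : ∃ C, ∀ w₀ u,
      IsMildSolution T U F (negFracPow (A 0) α w₀) u → ∀ t ∈ Icc 0 T,
        ∃ w, negFracPow (A 0) α w = u t ∧ ‖w‖ ≤ C * (1 + ‖w₀‖) := by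
  have h0T : (0 : ℝ) ∈ Icc 0 T := ⟨le_rfl, hT⟩
  have hA0 := hA.sectorial 0 h0T
  obtain ⟨W, hW⟩ := (hA.const hT).exists_isEvolutionSystemOf hT
  obtain ⟨K₀, hK₀, hb, hb', -⟩ := hU.bounds
  obtain ⟨K₁, hK₁, hb₁⟩ := hW.exists_norm_le
  obtain ⟨C₁, hC₁, hp⟩ := hU.exists_perturbation hA hT hW
  obtain ⟨C₂, hC₂, hmild⟩ := hU.exists_mildSolution_bound hT hK₄ hF
  obtain ⟨C₃, hC₃, hfrac⟩ := hA0.exists_negFracPow_eq_integral hα T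
  have hK := hA.nonneg
  set B := negFracPow (A 0) α with hB
  set q := (1 + K * T) * K₀ with hq
  have hq0 : 0 ≤ q := by positivity
  have hKq : K₀ ≤ q := by
    have : 0 ≤ K * T * K₀ := by positivity
    linarith [add_mul 1 (K * T) K₀]
  refine ⟨1 + K₁ + C₃ * (q * ((C₁ + C₂) * (1 + ‖B‖))), fun w₀ u hu t ht => ?_⟩
  rcases ht.1.eq_or_lt with rfl | h0
  · refine ⟨w₀, hu.initial.symm, ?_⟩
    have : 0 ≤ (K₁ + C₃ * (q * ((C₁ + C₂) * (1 + ‖B‖)))) * (1 + ‖w₀‖) := by positivity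
    linarith
  have ht' : t ∈ Ioc 0 T := ⟨h0, ht.2⟩
  have hsub : Ioo 0 t ⊆ Ioo 0 T := Ioo_subset_Ioo_right ht.2
  obtain ⟨g, hgc, hgb, hg⟩ := hp (B w₀)
  obtain ⟨hgi, hge⟩ := hg t ht
  set h : ℝ → H := fun τ => g τ + F τ (u τ) with hh
  have hBw : ‖B w₀‖ ≤ ‖B‖ * ‖w₀‖ := B.le_opNorm w₀
  have hhb : ∀ τ ∈ Ioo 0 t, ‖h τ‖ ≤ (C₁ + C₂) * (1 + ‖B‖) * (1 + ‖w₀‖) := by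
    intro τ hτ
    have h1 := hgb τ (hsub hτ)
    have h2 := hmild _ u hu τ (Ioo_subset_Icc_self (hsub hτ))
    have h3 : ‖B w₀‖ ≤ (1 + ‖B‖) * (1 + ‖w₀‖) := by nlinarith [norm_nonneg B, norm_nonneg w₀]
    have h4 : 1 + ‖B w₀‖ ≤ (1 + ‖B‖) * (1 + ‖w₀‖) := by nlinarith [norm_nonneg B, norm_nonneg w₀]
    calc _ ≤ ‖g τ‖ + ‖F τ (u τ)‖ := norm_add_le _ _
      _ ≤ C₁ * ((1 + ‖B‖) * (1 + ‖w₀‖)) + C₂ * ((1 + ‖B‖) * (1 + ‖w₀‖)) :=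
          add_le_add (h1.trans (by gcongr)) (h2.trans (by gcongr))
      _ = _ := by ring
  have hhc : ContinuousOn h (Ioo 0 t) := (hgc.mono hsub).add
    ((continuousOn_nonlinearity hF hu.continuousOn).mono (hsub.trans Ioo_subset_Icc_self))
  obtain ⟨w, hw, hwn⟩ := hfrac t ht' (fun τ => U t τ (h τ))
    (q * ((C₁ + C₂) * (1 + ‖B‖) * (1 + ‖w₀‖)))
    (hU.continuousOn_apply continuousOn_const continuousOn_id hhc
      fun τ hτ => ⟨hτ.1.le, hτ.2.le, ht.2⟩) fun τ hτ => by
      obtain ⟨m, hm⟩ := hb' τ t hτ.1.le hτ.2 ht.2 (h τ)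
      have htτ : 0 < t - τ := by linarith [hτ.2]
      refine ⟨m, ?_, ?_⟩
      · exact ContinuousLinearMap.le_of_opNorm_le_of_le _
          ((hb τ t hτ.1.le hτ.2.le ht.2).trans hKq) (hhb τ hτ)
      · calc _ ≤ (1 + K * T) * ‖A t ⟨U t τ (h τ), m⟩‖ := hA.norm_apply_le ht h0T _
          _ ≤ (1 + K * T) * (K₀ / (t - τ) * ((C₁ + C₂) * (1 + ‖B‖) * (1 + ‖w₀‖))) := by
              gcongr
              exact hm.trans (by gcongr; exact hhb τ hτ)
          _ = _ := by rw [hq]; ring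
  refine ⟨W t 0 w₀ + w, ?_, ?_⟩
  · have hcomm : W t 0 * B = B * W t 0 :=
      hA0.commute_negFracPow (fun r hr => hW.mul_resolvent hA0 ht hr) hα
    have e1 : W t 0 (B w₀) = B (W t 0 w₀) := congrArg (fun S : H →L[ℂ] H => S w₀) hcomm
    rw [hu.eq t ht', hge, map_add, hw, e1, add_assoc,
      ← intervalIntegral.integral_add hgi (hu.integrable t ht')]
    simp only [hh, map_add]
  · have h1 := (W t 0).le_of_opNorm_le (hb₁ 0 t le_rfl ht.1 ht.2) w₀
    have h2 : K₁ * ‖w₀‖ ≤ (1 + K₁) * (1 + ‖w₀‖) := by nlinarith [norm_nonneg w₀]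
    calc _ ≤ ‖W t 0 w₀‖ + ‖w‖ := norm_add_le _ _
      _ ≤ (1 + K₁) * (1 + ‖w₀‖) + C₃ * (q * ((C₁ + C₂) * (1 + ‖B‖) * (1 + ‖w₀‖))) :=
          add_le_add (h1.trans h2) hwn
      _ = _ := by ring

theorem IsEvolutionSystemOf.exists_norm_mildSolution_le (hT : 0 ≤ T)
    {U : ℝ → ℝ → H →L[ℂ] H} (hU : IsEvolutionSystemOf T A U) {F : ℝ → H → H} {K₄ : ℝ}
    (hK₄ : 0 ≤ K₄)
    (hF : ∀ s ∈ Icc 0 T, ∀ t ∈ Icc 0 T, ∀ u v : H,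
      ‖F t u - F s v‖ ≤ K₄ * (|t - s| + ‖u - v‖)) :
    ∃ C, ∀ u₀ u, IsMildSolution T U F u₀ u → ∀ t ∈ Icc 0 T, ‖u t‖ ≤ C * (1 + ‖u₀‖) := by
  obtain ⟨K₀, hK₀, hb⟩ := hU.exists_norm_le
  obtain ⟨C, hC, hmild⟩ := hU.exists_mildSolution_bound hT hK₄ hF
  refine ⟨1 + K₀ + K₀ * C * T, fun u₀ u hu t ht => ?_⟩
  have hn := norm_nonneg u₀
  rcases ht.1.eq_or_lt with rfl | h0
  · rw [hu.initial]
    have : 0 ≤ (K₀ + K₀ * C * T) * (1 + ‖u₀‖) := by positivity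
    linarith
  have h1 := (U t 0).le_of_opNorm_le (hb 0 t le_rfl ht.1 ht.2) u₀
  have h2 : ‖∫ s in (0 : ℝ)..t, U t s (F s (u s))‖ ≤ K₀ * (C * (1 + ‖u₀‖)) * |t - 0| := by
    refine intervalIntegral.norm_integral_le_of_norm_le_const fun s hs => ?_
    rw [uIoc_of_le ht.1] at hs
    exact ContinuousLinearMap.le_of_opNorm_le_of_le _ (hb s t hs.1.le hs.2 ht.2)
      (hmild u₀ u hu s ⟨hs.1.le, hs.2.trans ht.2⟩)
  rw [sub_zero, abs_of_pos h0] at h2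
  have h3 : K₀ * (C * (1 + ‖u₀‖)) * t ≤ K₀ * (C * (1 + ‖u₀‖)) * T := by gcongr; exact ht.2
  rw [hu.eq t ⟨h0, ht.2⟩]
  calc _ ≤ ‖U t 0 u₀‖ + ‖∫ s in (0 : ℝ)..t, U t s (F s (u s))‖ := norm_add_le _ _
    _ ≤ (1 + K₀) * (1 + ‖u₀‖) + K₀ * (C * (1 + ‖u₀‖)) * T := by nlinarith
    _ = _ := by ring

end Regularity

theorem theorem1 {H : Type*} [NormedAddCommGroup H] [InnerProductSpace ℂ H] [CompleteSpace H]
    {D : Submodule ℂ H} (T : ℝ) (hT : 0 < T) (A : ℝ → D →ₗ[ℂ] H) (F : ℝ → H → H)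
    (hA : LinearPartAssumption T A) (hF : NonlinearPartAssumption T A F) :
    ∃ U : ℝ → ℝ → H →L[ℂ] H,
      -- `U` is the unique evolution system of the family `A(t)`
      IsEvolutionSystemOf T A U ∧
      (∀ V : ℝ → ℝ → H →L[ℂ] H, IsEvolutionSystemOf T A V →
        ∀ s t : ℝ, 0 ≤ s → s ≤ t → t ≤ T → V t s = U t s) ∧
      -- existence and uniqueness of the mild solution
      (∀ β ∈ Icc (0 : ℝ) 2, ∀ u₀ ∈ (fracPow (A 0) (β / 2)).domain,
        ∃ u : ℝ → H, IsMildSolution T U F u₀ u ∧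
          ∀ w : ℝ → H, IsMildSolution T U F u₀ w → EqOn w u (Icc 0 T)) ∧
      -- space regularity
      (∀ β ∈ Ico (0 : ℝ) 2, ∃ C : ℝ, ∀ u₀ : (fracPow (A 0) (β / 2)).domain,
        ∀ u : ℝ → H, IsMildSolution T U F u₀ u → ∀ t ∈ Icc 0 T,
          ∃ h : u t ∈ (fracPow (A 0) (β / 2)).domain,
            ‖fracPow (A 0) (β / 2) ⟨u t, h⟩‖ ≤ C * (1 + ‖fracPow (A 0) (β / 2) u₀‖)) := by
  obtain ⟨c, K, hfam⟩ := hA.exists_isSectorialFamily hT.le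
  obtain ⟨U, hU⟩ := hfam.exists_isEvolutionSystemOf hT.le
  obtain ⟨K₄, hK₄, hlip⟩ := hF.lipschitz
  have hA0 := hfam.sectorial 0 ⟨le_rfl, hT.le⟩
  refine ⟨U, hU, fun V hV s t hs hst ht => hU.unique hV hs hst ht, fun β _ u₀ _ => ?_,
    fun β hβ => ?_⟩
  · obtain ⟨u, hu⟩ := hU.exists_isMildSolution hT.le hK₄ hlip u₀
    exact ⟨u, hu, fun w hw => hU.mildSolution_unique hK₄ hlip hu hw⟩
  · rcases hβ.1.eq_or_lt with rfl | hβ0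
    · have hid : negFracPow (A 0) (0 / 2) = ContinuousLinearMap.id ℂ H := by
        rw [zero_div, negFracPow, if_pos rfl]
      have hinj : ∀ w, negFracPow (A 0) (0 / 2) w = 0 → w = 0 := fun w hw => by
        rwa [hid] at hw
      have hval : ∀ u : H, negFracPow (A 0) (0 / 2) u = u := fun u => by rw [hid]; rfl
      obtain ⟨C, hC⟩ := hU.exists_norm_mildSolution_le hT.le hK₄ hlip
      refine ⟨C, fun u₀ u hu t ht => ⟨mem_fracPow_domain.2 ⟨u t, hval _⟩, ?_⟩⟩
      rw [fracPow_eq_of_eq hinj (hval _), fracPow_eq_of_eq hinj (hval _) u₀.2]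
      exact hC _ u hu t ht
    · have hα : β / 2 ∈ Ioo (0 : ℝ) 1 := ⟨by linarith, by linarith [hβ.2]⟩
      have hinj : ∀ w, negFracPow (A 0) (β / 2) w = 0 → w = 0 := fun w hw =>
        hA0.negFracPow_injective hα hw
      obtain ⟨C, hC⟩ := hU.exists_regularity_bound hfam hT.le hK₄ hlip hα
      refine ⟨C, fun u₀ u hu t ht => ?_⟩
      obtain ⟨w₀, hw₀⟩ := mem_fracPow_domain.1 u₀.2
      rw [← hw₀] at hu
      obtain ⟨w, hw, hwn⟩ := hC w₀ u hu t ht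
      refine ⟨mem_fracPow_domain.2 ⟨w, hw⟩, ?_⟩
      rw [fracPow_eq_of_eq hinj hw, fracPow_eq_of_eq hinj hw₀ u₀.2]
      exact hwn
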